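/- Let $q=1+\epsilon$ with $\epsilon^2=0$, let $W$ be the associative $\mathbb{Q}[\epsilon]/(\epsilon^2)$-algebra with generators $E,F$ and relation $FE=qEF+1$. Write $t^{1/2}=1+h$, so that $\mathbb{Q}(t^{1/2})=\mathbb{Q}(h)\subset\mathbb{Q}((h))$ (expansion at $t^{1/2}=1$). Let $\mathcal{W}_q=W((h))$, with $h$ central, and for a finite set $S$ let $\mathcal{W}_q^{\otimes S}=(W^{\otimes S})((h))$ be its completed tensor power with tensor factors labelled by $S$. Let $\mathcal{V}_q^{\otimes S}=\mathbb{Q}[\epsilon][e_s,f_s : s\in S]((h))$, that is, the power series in commuting variables $e_s,f_s$ with coefficients in $\mathbb{Q}((h))[\epsilon]/(\epsilon^2)$ that tend to $0$ $h$-adically, and let $\mathbb{O}:\mathcal{V}_q^{\otimes S}\to\mathcal{W}_q^{\otimes S}$ be the normal ordering map, linear and coefficientwise in $h$, with $\prod_s e_s^{a_s}f_s^{b_s}\mapsto\bigotimes_s E^{a_s}F^{b_s}$. Then $\mathbb{O}$ is bijective for $S=\{1,\dots,n\}$ and every $n\ge 0$ (so the product and the stitching operations of $\mathcal{W}_q$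 can be pulled back to $\mathcal{V}_q$), and $\mathcal{W}_q$, or equivalently $\mathcal{V}_q$, is a snarl algebra with the following elements. For $\sigma=\pm1$ put $$X^{\sigma}_{ij}=t^{\sigma/2}\exp\Big((1-t^\sigma)(e_i-e_j)f_j+\epsilon\,\tfrac{t-1}{t+1}\,P\Big),\qquad \alpha_i^{\sigma}=t^{\sigma/2}\exp\Big(\epsilon\,\sigma\,\tfrac{t-1}{t+1}\,e_if_i\Big),$$ $$P=\sigma\Big(\big(\tfrac{1-t^\sigma}{2}e_if_j\big)^2-\big(\tfrac{1+t^\sigma}{2}e_jf_j\big)^2+t^\sigma e_if_j\big(e_jf_i+\tfrac{1-t}{2}((\sigma+1)e_jf_j+(\sigma-1)e_if_i)\big)\Big),$$ where the exponentials are taken in the commutative ring $\mathcal{V}_q^{\otimes S}$ and the results are viewed in $\mathcal{W}_q^{\otimes S}$ through $\mathbb{O}$. That is: $X^{+1}$ and $X^{-1}$ are inverse to each other in $\mathcal{W}_q^{\otimes\{1,2\}}$, $\alpha^{+1}$ and $\alpha^{-1}$ are inverse to each other in $\mathcal{W}_q$, and, with $m^{(i_1i_2\ldots)(j_1j_2\ldots)\cdots}$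 denoting the map that replaces the tensor factors $i_1,i_2,\ldots$ by their product in this order, placed in factor $1$, the factors $j_1,j_2,\ldots$ by their product placed in factor $2$, and so on, the following hold (with all upper or all lower signs, and $\alpha^0=1$): $$m^{(123)}(X_{13}^{\pm}\alpha_2^{\mp1})=\alpha^0_1=m^{(123)}(X_{31}^{\pm}\alpha_2^{\pm1}),$$ $$m^{(13)(4526)}(X_{12}^{-}X_{34}^{+}\alpha_5\alpha_6^{-1})=\alpha_1^0\alpha_2^0=m^{(5163)(42)}(X_{12}^{+}X_{34}^{-}\alpha_5\alpha_6^{-1}),$$ $$m^{(13)(25)(46)}(X_{12}^{\pm}X_{34}^{\pm}X_{56}^{\pm})=m^{(35)(16)(24)}(X_{12}^{\pm}X_{34}^{\pm}X_{56}^{\pm}),$$ $$X_{12}^{\pm}=m^{(135)(246)}(\alpha_1^{\pm1}\alpha_2^{\pm1}X_{34}^{\pm}\alpha_5^{\mp1}\alpha_6^{\mp1}).$$ -/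

import Mathlib

open scoped DualNumber

noncomputable section

namespace Snarl

/-! ### Completed tensor powers, labelled tensor factors and stitching

`k` is a commutative ring and `W` a `k`-algebra.  The algebra that carries the snarl structure is
`A = W((h))`, with `h` a central formal parameter, and its `h`-adically completed tensor power with
factors labelled by `S` is `W^{⊗ S}((h))`. -/

section General

variable (k : Type) [CommRing k] (W : Type) [Ring W] [Algebra k W]

/-- The completed tensor power `A^{⊗ S}` of `A = W((h))`: Laurent series in `h` with coefficients
in the tensor power of `W` over `k` with tensor factors labelled by `S`. -/
abbrev Tens (S : Type) : Type := LaurentSeries (PiTensorProduct k (fun _ : S => W))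

/-- A rule for stitching components labelled by `S` to components labelled by `T`: the new
component `t` is the concatenation, in this order, of the old components listed in `strand t`.
Every old label is used exactly once. -/
structure Stitching (S T : Type) where
  strand : T → List S
  nodup : ∀ t, (strand t).Nodup
  exhaustive : ∀ s, ∃ t, s ∈ strand t
  disjoint : ∀ s t t', s ∈ strand t → s ∈ strand t' → t = t'

variable {k W}

lemma map_update_of_notMem {W S : Type} [DecidableEq S] (l : List S) (w : S → W) (s : S) (x : W)
    (hs : s ∉ l) : l.map (Function.update w s x) = l.map w := by
  apply List.map_congr_left
  intro a ha
  exact Function.update_of_ne (ne_of_mem_of_not_mem ha hs) _ _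

lemma prod_update_of_mem {S : Type} [DecidableEq S] (l : List S) (hl : l.Nodup) (w : S → W) (s : S)
    (hs : s ∈ l) :
    ∃ a b : W, ∀ x, (l.map (Function.update w s x)).prod = a * x * b := by
  obtain ⟨l₁, l₂, rfl⟩ := List.append_of_mem hs
  have h := List.nodup_middle.mp hl
  rw [List.nodup_cons, List.mem_append, not_or] at h
  refine ⟨(l₁.map w).prod, (l₂.map w).prod, fun x => ?_⟩
  simp [map_update_of_notMem _ _ _ _ h.1.1, map_update_of_notMem _ _ _ _ h.1.2, mul_assoc]

lemma Stitching.update {S T : Type} [DecidableEq S] [DecidableEq T] (τ : Stitching S T)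
    (w : S → W) (s : S) :
    ∃ (t : T) (a b : W), ∀ x,
      (fun t' => ((τ.strand t').map (Function.update w s x)).prod) =
        Function.update (fun t' => ((τ.strand t').map w).prod) t (a * x * b) := by
  obtain ⟨t, ht⟩ := τ.exhaustive s
  obtain ⟨a, b, hab⟩ := prod_update_of_mem (τ.strand t) (τ.nodup t) w s ht
  refine ⟨t, a, b, fun x => ?_⟩
  funext t'
  by_cases h : t' = t
  · subst h
    rw [Function.update_self]
    exact hab x
  · rw [Function.update_of_ne h, map_update_of_notMem]
    exact fun hm => h (τ.disjoint s t' t hm ht)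

variable (k W)

/-- The multilinear map `⊗_s w_s ↦ ⊗_t ∏_{s ∈ strand t} w_s` (ordered products). -/
def stitchMultilinear {S T : Type} (τ : Stitching S T) :
    MultilinearMap k (fun _ : S => W) (PiTensorProduct k (fun _ : T => W)) where
  toFun w := PiTensorProduct.tprod k fun t => ((τ.strand t).map w).prod
  map_update_add' := by
    classical
    intro inst w s x y
    obtain rfl : inst = fun a b => Classical.propDecidable (a = b) := Subsingleton.elim _ _
    obtain ⟨t, a, b, h⟩ := τ.update w s
    rw [h, h, h, mul_add, add_mul, MultilinearMap.map_update_add]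
  map_update_smul' := by
    classical
    intro inst w s c x
    obtain rfl : inst = fun a b => Classical.propDecidable (a = b) := Subsingleton.elim _ _
    obtain ⟨t, a, b, h⟩ := τ.update w s
    rw [h, h, mul_smul_comm, smul_mul_assoc, MultilinearMap.map_update_smul]

/-- Stitching `m^τ : W^{⊗ S} → W^{⊗ T}`. -/
def stitchLinear {S T : Type} (τ : Stitching S T) :
    PiTensorProduct k (fun _ : S => W) →ₗ[k] PiTensorProduct k (fun _ : T => W) :=
  PiTensorProduct.lift (stitchMultilinear k W τ)

/-- Placing tensor factors: `⊗_a w_a ↦ ∏_a (w_a in the factor labelled φ a)`.  For injective `φ`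
this puts the `a`-th factor into the factor labelled `φ a` and `1` into all other factors. -/
def placeLinear {n : ℕ} {S : Type} [DecidableEq S] (φ : Fin n → S) :
    PiTensorProduct k (fun _ : Fin n => W) →ₗ[k] PiTensorProduct k (fun _ : S => W) :=
  PiTensorProduct.lift
    ((MultilinearMap.mkPiAlgebraFin k n (PiTensorProduct k (fun _ : S => W))).compLinearMap
      fun a => (PiTensorProduct.singleAlgHom (R := k) (A := fun _ : S => W) (φ a)).toLinearMap)

variable {k W}

/-- Stitching `m^τ : A^{⊗ S} → A^{⊗ T}` on the completed tensor powers. -/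
def stitch {S T : Type} (τ : Stitching S T) (x : Tens k W S) : Tens k W T :=
  HahnSeries.map x (stitchLinear k W τ)

/-- The placement `A^{⊗ n} → A^{⊗ S}` on the completed tensor powers. -/
def place {n : ℕ} {S : Type} [DecidableEq S] (φ : Fin n → S) (x : Tens k W (Fin n)) :
    Tens k W S :=
  HahnSeries.map x (placeLinear k W φ)

/-- `X^σ_{ij}`: the element `X^σ` with its first factor (the over-strand) labelled `i` and its
second factor (the under-strand) labelled `j`. -/
def crossing {S : Type} [DecidableEq S] (X : (Tens k W (Fin 2))ˣ) (σ : ℤˣ) (i j : S) :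
    Tens k W S :=
  place ![i, j] ((X ^ (σ : ℤ) : (Tens k W (Fin 2))ˣ) : Tens k W (Fin 2))

/-- `α^r_i`: the element `α^r` in the factor labelled `i`. -/
def rotation {S : Type} [DecidableEq S] (α : (Tens k W (Fin 1))ˣ) (r : ℤ) (i : S) :
    Tens k W S :=
  place ![i] ((α ^ r : (Tens k W (Fin 1))ˣ) : Tens k W (Fin 1))

/-- `A = W((h))` with the invertible elements `X ∈ A^{⊗ 2}` and `α ∈ A = A^{⊗ 1}` is a snarl
algebra.  Labels are counted from `0`; a disjoint union of crossings and rotations corresponds to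
the product of the elements placed in disjoint sets of tensor factors. -/
structure IsSnarlAlgebra (X : (Tens k W (Fin 2))ˣ) (α : (Tens k W (Fin 1))ˣ) : Prop where
  /-- `X_{13}^± α_2^∓ // m^{(123)} = α_1^0`. -/
  kink_left : ∀ σ : ℤˣ,
    stitch (⟨![[0, 1, 2]], by decide, by decide, by decide⟩ : Stitching (Fin 3) (Fin 1))
      (crossing X σ 0 2 * rotation α (-σ) 1) = rotation α 0 0
  /-- `X_{31}^± α_2^± // m^{(123)} = α_1^0`. -/
  kink_right : ∀ σ : ℤˣ,
    stitch (⟨![[0, 1, 2]], by decide, by decide, by decide⟩ : Stitching (Fin 3) (Fin 1))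
      (crossing X σ 2 0 * rotation α σ 1) = rotation α 0 0
  /-- `X_{12}^- X_{34}^+ α_5 α_6^{-1} // m^{(13)(4526)} = α_1^0 α_2^0`. -/
  cancel_left :
    stitch (⟨![[0, 2], [3, 4, 1, 5]], by decide, by decide, by decide⟩ : Stitching (Fin 6) (Fin 2))
      (crossing X (-1) 0 1 * crossing X 1 2 3 * rotation α 1 4 * rotation α (-1) 5) =
      rotation α 0 0 * rotation α 0 1
  /-- `X_{12}^+ X_{34}^- α_5 α_6^{-1} // m^{(5163)(42)} = α_1^0 α_2^0`. -/
  cancel_right :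
    stitch (⟨![[4, 0, 5, 2], [3, 1]], by decide, by decide, by decide⟩ : Stitching (Fin 6) (Fin 2))
      (crossing X 1 0 1 * crossing X (-1) 2 3 * rotation α 1 4 * rotation α (-1) 5) =
      rotation α 0 0 * rotation α 0 1
  /-- `X_{12}^± X_{34}^± X_{56}^± // m^{(13)(25)(46)} = X_{12}^± X_{34}^± X_{56}^± //
  m^{(35)(16)(24)}`. -/
  braid : ∀ σ : ℤˣ,
    stitch (⟨![[0, 2], [1, 4], [3, 5]], by decide, by decide, by decide⟩ : Stitching (Fin 6) (Fin 3))
      (crossing X σ 0 1 * crossing X σ 2 3 * crossing X σ 4 5) =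
    stitch (⟨![[2, 4], [0, 5], [1, 3]], by decide, by decide, by decide⟩ : Stitching (Fin 6) (Fin 3))
      (crossing X σ 0 1 * crossing X σ 2 3 * crossing X σ 4 5)
  /-- `X_{12}^± = α_1^± α_2^± X_{34}^± α_5^∓ α_6^∓ // m^{(135)(246)}`. -/
  rotate : ∀ σ : ℤˣ,
    crossing X σ (0 : Fin 2) 1 =
    stitch (⟨![[0, 2, 4], [1, 3, 5]], by decide, by decide, by decide⟩ : Stitching (Fin 6) (Fin 2))
      (rotation α σ 0 * rotation α σ 1 * crossing X σ 2 3 * rotation α (-σ) 4 *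
        rotation α (-σ) 5)

end General

/-! ### The `q`-Weyl algebra for `q = 1 + ε`, `ε² = 0` -/

/-- The two generators of the `q`-Weyl algebra. -/
inductive Gen : Type
  | E
  | F

/-- The parameter `q = 1 + ε` in `ℚ[ε]`, where `ε² = 0`. -/
def q : ℚ[ε] := 1 + DualNumber.eps

/-- The defining relation `F E = q E F + 1`. -/
inductive QWeylRel : FreeAlgebra ℚ[ε] Gen → FreeAlgebra ℚ[ε] Gen → Prop
  | rel : QWeylRel (FreeAlgebra.ι _ Gen.F * FreeAlgebra.ι _ Gen.E)
      (q • (FreeAlgebra.ι _ Gen.E * FreeAlgebra.ι _ Gen.F) + 1)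

/-- The `q`-Weyl algebra over `ℚ[ε]`, polynomial version: generators `E`, `F` and relation
`F E = q E F + 1`.  The algebra `W_q` of convergent noncommutative power series is
`QWeyl((h))`. -/
def QWeyl : Type := RingQuot QWeylRel

instance : Ring QWeyl := RingQuot.instRing QWeylRel

instance : Algebra ℚ[ε] QWeyl := RingQuot.instAlgebra QWeylRel

/-- The generator `E`. -/
def E : QWeyl := RingQuot.mkAlgHom ℚ[ε] QWeylRel (FreeAlgebra.ι _ Gen.E)

/-- The generator `F`. -/
def F : QWeyl := RingQuot.mkAlgHom ℚ[ε] QWeylRel (FreeAlgebra.ι _ Gen.F)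

/-! ### Normal ordered power series

A Laurent series in `h` whose coefficients are polynomials in the commuting variables `e_s`, `f_s`
over `ℚ[ε]` is the same as a power series in the `e_s`, `f_s` with coefficients in `ℚ((h))[ε]`
that tend to `0` in the `h`-adic topology. -/

/-- The space `V_q^{⊗ S}` of normal ordered power series in `e_s`, `f_s`, `s ∈ S`, with its
commutative product; `Sum.inl s` stands for `e_s` and `Sum.inr s` for `f_s`. -/
abbrev VSeries (S : Type) : Type := LaurentSeries (MvPolynomial (S ⊕ S) ℚ[ε])

/-- The normal ordering map on polynomials, linear with
`∏_s e_s^{a_s} f_s^{b_s} ↦ ⊗_s E^{a_s} F^{b_s}`. -/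
def orderLinear (S : Type) :
    MvPolynomial (S ⊕ S) ℚ[ε] →ₗ[ℚ[ε]] PiTensorProduct ℚ[ε] (fun _ : S => QWeyl) :=
  (MvPolynomial.basisMonomials (S ⊕ S) ℚ[ε]).constr ℚ[ε] fun m =>
    PiTensorProduct.tprod ℚ[ε] fun s => E ^ m (Sum.inl s) * F ^ m (Sum.inr s)

/-- The normal ordering map `𝕆 : V_q^{⊗ S} → W_q^{⊗ S}`. -/
def normalOrder (S : Type) (g : VSeries S) : Tens ℚ[ε] QWeyl S :=
  HahnSeries.map g (orderLinear S)

/-- `t^{1/2} = 1 + h` in the field `ℚ(h) = ℚ(t^{1/2})`. -/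
def sqrtT : RatFunc ℚ := 1 + RatFunc.X

/-- `t`. -/
def t : RatFunc ℚ := sqrtT ^ 2

section Elements

variable {S : Type}

/-- An element of `ℚ(t^{1/2})` as a constant of `V_q^{⊗ S}`, through its Laurent expansion at
`t^{1/2} = 1`, that is, in powers of `h = t^{1/2} - 1`. -/
def scalar (r : RatFunc ℚ) : VSeries S :=
  HahnSeries.map (r : LaurentSeries ℚ)
    (algebraMap ℚ (MvPolynomial (S ⊕ S) ℚ[ε]))

/-- The constant `ε`. -/
def eps : VSeries S := HahnSeries.C (MvPolynomial.C DualNumber.eps)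

/-- The variable `e_s`. -/
def e (s : S) : VSeries S := HahnSeries.C (MvPolynomial.X (Sum.inl s))

/-- The variable `f_s`. -/
def f (s : S) : VSeries S := HahnSeries.C (MvPolynomial.X (Sum.inr s))

/-- The exponential `∑ gⁿ / n!` of a series `g` divisible by `h`. -/
def expV (g : VSeries S) : VSeries S :=
  PowerSeries.heval g (PowerSeries.exp (MvPolynomial (S ⊕ S) ℚ[ε]))

/-- The quartic `P`, for a crossing of sign `σ` with over-strand `i` and under-strand `j`. -/
def P (σ : ℤˣ) (i j : S) : VSeries S :=
  scalar ((σ : ℤ) : RatFunc ℚ) *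
    ((scalar ((1 - t ^ (σ : ℤ)) / 2) * e i * f j) ^ 2
      - (scalar ((1 + t ^ (σ : ℤ)) / 2) * e j * f j) ^ 2
      + scalar (t ^ (σ : ℤ)) * e i * f j *
        (e j * f i + scalar ((1 - t) / 2) *
          (scalar (((σ : ℤ) : RatFunc ℚ) + 1) * e j * f j
            + scalar (((σ : ℤ) : RatFunc ℚ) - 1) * e i * f i)))

/-- The normalization `(t - 1) / (t + 1)` of the deformation parameter. -/
def lam : RatFunc ℚ := (t - 1) / (t + 1)

/-- The crossing element
`t^{σ/2} exp((1 - t^σ)(e_i - e_j) f_j + ε ((t - 1)/(t + 1)) P)`. -/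
def crossingSeries (σ : ℤˣ) (i j : S) : VSeries S :=
  scalar (sqrtT ^ (σ : ℤ)) *
    expV (scalar (1 - t ^ (σ : ℤ)) * (e i - e j) * f j + eps * scalar lam * P σ i j)

/-- The rotation element `t^{σ/2} exp(ε σ ((t - 1)/(t + 1)) e_i f_i)`. -/
def rotationSeries (σ : ℤˣ) (i : S) : VSeries S :=
  scalar (sqrtT ^ (σ : ℤ)) *
    expV (eps * scalar ((σ : ℤ) : RatFunc ℚ) * scalar lam * e i * f i)

end Elements

end Snarl

end

/-!
To first order, the `q`-Weyl algebra is undeformed: since `ε² = 0`, the element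
`D = F - (ε / 2) E F²` satisfies `D E = E D + 1`, and `F = D + (ε / 2) E D²`. Hence normal ordering
for the Weyl pair `(E, D)`, which is bijective because `E` acts on polynomials by `e` and `D` by
`f + ∂/∂e`, differs from `𝕆` by the invertible operator `1 + (ε / 4) N` with
`N = ∑_s (2 e_s f_s² ∂_{f_s} + f_s² ∂_{f_s}²)` (`orderLinear_apply`). This proves bijectivity.

With respect to `(E, D)` the elements have symbols `a (1 + ε A) exp Q`, with `Q` the quadratic form
`(1 - t^σ) (e_i - e_j) f_j` or `0`, and `A` a polynomial of degree at most four (`crossSym`,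
`rotSym`). Stitching, transported to symbols, is characterized by a few rules: a variable at the
outer end of a strand can be pulled out, and moving `e` or `f` across the junction of two
consecutive components costs a derivative (`IsStitch`). Applied to `p exp Q` these rules are linear
equations among the functionals `p ↦ M (e_s p exp Q)` and `p ↦ M (f_s p exp Q)`. Solving them shows
that `p ↦ M (p exp Q)` obeys Wick's rule with explicit means and covariances (`IsGaussian`).

Every relation thus splits into two parts. In degree zero in `ε` one has to evaluate `M (exp Q)`.
Differentiating with respect to `h` turns this into `M (Q' exp Q)`, which Wick's rule makes a
multiple of `M (exp Q)`, and the resulting linear differential equation has a unique normalized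
solution. In degree one, Wick's rule for quartic monomials expresses `M (A exp Q)` as a polynomial
multiple of `M (exp Q)`, and the relation becomes an identity of polynomials. No completion of the
tensor powers is needed for this, because all symbols are power series in `h` with polynomial
coefficients.
-/

noncomputable section

namespace Snarl

/-! ### The Weyl pair inside the `q`-Weyl algebra -/

section WeylPair

variable {R : Type*} [CommRing R] {B : Type*} [Ring B] [Algebra R B]

/-- In a Weyl pair `b a = a b + 1`, the element `b + c a b²` with `c² = 0` satisfies the `q`-Weyl
relation with `a`, where `q = 1 + 2 c`. -/
lemma qWeyl_of_weyl {c : R} (hc : c * c = 0) {a b : B} (h : b * a = a * b + 1) :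
    (b + c • (a * b ^ 2)) * a = (1 + (c + c)) • (a * (b + c • (a * b ^ 2))) + 1 := by
  have h2 : b ^ 2 * a = a * b ^ 2 + (b + b) := by
    rw [pow_two, mul_assoc, h, mul_add, ← mul_assoc, h]; noncomm_ring
  rw [mul_add, mul_smul_comm, smul_add, smul_smul, add_mul, smul_mul_assoc, mul_assoc, h2, h,
    mul_add, mul_add, add_mul, add_mul, hc, one_mul, add_zero, add_zero]
  module

/-- Inversely, `b - c a b²` forms a Weyl pair with `a` if `b` satisfies the `q`-Weyl relation. -/
lemma weyl_of_qWeyl {c : R} (hc : c * c = 0) {a b : B}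
    (h : b * a = (1 + (c + c)) • (a * b) + 1) :
    (b - c • (a * b ^ 2)) * a = a * (b - c • (a * b ^ 2)) + 1 := by
  have h2 : c • (b ^ 2 * a) = c • (a * b ^ 2 + (b + b)) := by
    have hcq : c * (1 + (c + c)) = c := by linear_combination 2 * hc
    have h1 : c • (b * a) = c • (a * b + 1) := by
      rw [h, smul_add, smul_smul, hcq, smul_add]
    calc c • (b ^ 2 * a) = b * (c • (b * a)) := by rw [mul_smul_comm, pow_two, mul_assoc]
      _ = (c • (b * a)) * b + c • b := by
        rw [h1, mul_smul_comm, h1.symm, smul_mul_assoc, mul_add, mul_one, smul_add, mul_assoc]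
      _ = _ := by rw [h1, smul_mul_assoc, add_mul, one_mul, pow_two, mul_assoc]; module
  calc (b - c • (a * b ^ 2)) * a = b * a - a * (c • (b ^ 2 * a)) := by
        rw [sub_mul, smul_mul_assoc, mul_smul_comm, mul_assoc]
    _ = _ := by
        rw [h, h2, mul_smul_comm, mul_add, mul_add, mul_sub, mul_smul_comm]
        module

/-- If `c² = 0`, then `b ↦ b - c a b²` and `b ↦ b + c a b²` are inverse to each other. -/
lemma sub_add_smul_mul_sq {c : R} (hc : c * c = 0) (a b : B) :
    (b - c • (a * b ^ 2)) + c • (a * (b - c • (a * b ^ 2)) ^ 2) = b := by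
  have h : c • (b - c • (a * b ^ 2)) = c • b := by
    rw [smul_sub, smul_smul, hc, zero_smul, sub_zero]
  have h2 : c • (b - c • (a * b ^ 2)) ^ 2 = c • b ^ 2 := by
    rw [pow_two, ← smul_mul_assoc, h, smul_mul_assoc, ← mul_smul_comm, h, mul_smul_comm, pow_two]
  rw [← mul_smul_comm c a ((b - _) ^ 2), h2, mul_smul_comm, sub_add_cancel]

lemma add_sub_smul_mul_sq {c : R} (hc : c * c = 0) (a b : B) :
    (b + c • (a * b ^ 2)) - c • (a * (b + c • (a * b ^ 2)) ^ 2) = b := by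
  simpa [← sub_eq_add_neg] using sub_add_smul_mul_sq (c := -c) (by simpa using hc) a b

end WeylPair

/-- `ε / 2`. -/
def halfEps : ℚ[ε] := (1 / 2 : ℚ) • DualNumber.eps

lemma halfEps_add : halfEps + halfEps = DualNumber.eps := by
  rw [halfEps, ← add_smul]; norm_num

lemma halfEps_mul : halfEps * halfEps = 0 := by
  simp [halfEps, DualNumber.eps_mul_eps]

lemma F_mul_E : F * E = (1 + (halfEps + halfEps)) • (E * F) + 1 := by
  have := RingQuot.mkAlgHom_rel ℚ[ε] QWeylRel.rel
  simp only [map_mul, map_add, map_smul, map_one] at this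
  rw [halfEps_add]
  exact this

/-- The undeformed derivation generator `D = F - (ε/2) E F²`, for which `D E = E D + 1`. -/
def D : QWeyl := F - halfEps • (E * F ^ 2)

lemma D_mul_E : D * E = E * D + 1 := weyl_of_qWeyl halfEps_mul F_mul_E

lemma F_eq : F = D + halfEps • (E * D ^ 2) := (sub_add_smul_mul_sq halfEps_mul E F).symm

/-- The algebra homomorphism out of the `q`-Weyl algebra given by a Weyl pair `(a, b)`: it maps
`E` to `a` and `D` to `b`. -/
def weylLift {B : Type} [Ring B] [Algebra ℚ[ε] B] {a b : B} (h : b * a = a * b + 1) :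
    QWeyl →ₐ[ℚ[ε]] B :=
  RingQuot.liftAlgHom ℚ[ε] ⟨FreeAlgebra.lift ℚ[ε] fun g => match g with
    | Gen.E => a
    | Gen.F => b + halfEps • (a * b ^ 2), by
      rintro _ _ ⟨⟩
      have := qWeyl_of_weyl halfEps_mul h
      rw [halfEps_add] at this
      rw [← q] at this
      simpa only [map_mul, map_add, map_smul, map_one, FreeAlgebra.lift_ι_apply] using this⟩

lemma weylLift_E {B : Type} [Ring B] [Algebra ℚ[ε] B] {a b : B} (h : b * a = a * b + 1) :
    weylLift h E = a := by
  refine (RingQuot.liftAlgHom_mkAlgHom_apply _ _ _ _).trans ?_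
  simp

lemma weylLift_F {B : Type} [Ring B] [Algebra ℚ[ε] B] {a b : B} (h : b * a = a * b + 1) :
    weylLift h F = b + halfEps • (a * b ^ 2) := by
  refine (RingQuot.liftAlgHom_mkAlgHom_apply _ _ _ _).trans ?_
  simp

lemma weylLift_D {B : Type} [Ring B] [Algebra ℚ[ε] B] {a b : B} (h : b * a = a * b + 1) :
    weylLift h D = b := by
  rw [D, map_sub, map_smul, map_mul, map_pow, weylLift_E, weylLift_F,
    add_sub_smul_mul_sq halfEps_mul]

/-- A subalgebra containing `E` and `F` is everything. -/
lemma subalgebra_eq_top (B : Subalgebra ℚ[ε] QWeyl) (hE : E ∈ B) (hF : F ∈ B) : B = ⊤ := by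
  rw [eq_top_iff]
  rintro w -
  obtain ⟨x, rfl⟩ := RingQuot.mkAlgHom_surjective ℚ[ε] QWeylRel w
  induction x using FreeAlgebra.induction with
  | grade0 r => rw [AlgHom.commutes]; exact B.algebraMap_mem r
  | grade1 g => cases g <;> assumption
  | mul a b ha hb => rw [map_mul]; exact B.mul_mem ha hb
  | add a b ha hb => rw [map_add]; exact B.add_mem ha hb

/-! ### Normal ordering for a Weyl pair -/

section Ordering

open MvPolynomial

variable {R : Type} [CommRing R] {W : Type} [Ring W] [Algebra R W] {S T : Type}

/-- The element of the tensor power with `w` in the factor labelled `s` and `1` elsewhere. -/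
abbrev single [DecidableEq S] (s : S) : W →ₐ[R] PiTensorProduct R (fun _ : S => W) :=
  PiTensorProduct.singleAlgHom (R := R) (A := fun _ : S => W) s

lemma single_mul_tprod [DecidableEq S] (s : S) (w : W) (x : S → W) :
    single (R := R) s w * PiTensorProduct.tprod R x =
      PiTensorProduct.tprod R (fun i => (Pi.mulSingle s w : S → W) i * x i) := by
  rw [single, PiTensorProduct.singleAlgHom_apply, PiTensorProduct.tprod_mul_tprod]
  rfl

lemma tprod_mul_single [DecidableEq S] (s : S) (w : W) (x : S → W) :
    PiTensorProduct.tprod R x * single (R := R) s w =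
      PiTensorProduct.tprod R (fun i => x i * (Pi.mulSingle s w : S → W) i) := by
  rw [single, PiTensorProduct.singleAlgHom_apply, PiTensorProduct.tprod_mul_tprod]
  rfl

lemma single_comm [DecidableEq S] {s s' : S} (h : s ≠ s') (w w' : W) :
    single (R := R) s w * single s' w' = single s' w' * single s w := by
  simp only [single, PiTensorProduct.singleAlgHom_apply, PiTensorProduct.tprod_mul_tprod]
  congr 1
  exact Pi.mulSingle_commute (f := fun _ : S => W) h w w'

variable (R S) in
/-- The ordering map with `∏_s e_s^{a_s} f_s^{b_s} ↦ ⊗_s a^{a_s} b^{b_s}`. -/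
def order (a b : W) : MvPolynomial (S ⊕ S) R →ₗ[R] PiTensorProduct R (fun _ : S => W) :=
  (basisMonomials (S ⊕ S) R).constr R fun m =>
    PiTensorProduct.tprod R fun s => a ^ m (Sum.inl s) * b ^ m (Sum.inr s)

variable (a b : W)

lemma order_monomial (m : (S ⊕ S) →₀ ℕ) (r : R) :
    order R S a b (monomial m r) =
      r • PiTensorProduct.tprod R fun s => a ^ m (Sum.inl s) * b ^ m (Sum.inr s) := by
  have : monomial m r = r • basisMonomials (S ⊕ S) R m := by
    simp [coe_basisMonomials, smul_monomial]
  rw [this, map_smul, order, Module.Basis.constr_basis]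

lemma order_one : order R S a b 1 = 1 := by
  rw [← C_1, C_apply, order_monomial, one_smul, PiTensorProduct.one_def]
  congr 1
  funext s
  simp

lemma order_C (r : R) : order R S a b (C r) = r • 1 := by
  rw [← mul_one (C r), ← smul_eq_C_mul, map_smul, order_one]

variable [DecidableEq S]

lemma order_e_mul (s : S) (p : MvPolynomial (S ⊕ S) R) :
    order R S a b (X (Sum.inl s) * p) = single s a * order R S a b p := by
  induction p using MvPolynomial.monomial_add_induction_on with
  | C r =>
    rw [mul_comm, ← smul_eq_C_mul, map_smul, order_C, X, order_monomial, one_smul, mul_smul_comm,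
      mul_one, single, PiTensorProduct.singleAlgHom_apply]
    congr 2
    funext i
    by_cases h : i = s <;> simp [h]
  | monomial_add m r p hm hr hp =>
    rw [mul_add, map_add, map_add, mul_add, hp, X, monomial_mul, one_mul, order_monomial,
      order_monomial, mul_smul_comm, single_mul_tprod]
    congr 3
    funext i
    by_cases h : i = s
    · subst h; simp [pow_add, mul_assoc]
    · simp [h]

lemma order_f_mul (s : S) (p : MvPolynomial (S ⊕ S) R) :
    order R S a b (X (Sum.inr s) * p) = order R S a b p * single s b := by
  induction p using MvPolynomial.monomial_add_induction_on with
  | C r =>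
    rw [mul_comm, ← smul_eq_C_mul, map_smul, order_C, X, order_monomial, one_smul, smul_mul_assoc,
      one_mul, single, PiTensorProduct.singleAlgHom_apply]
    congr 2
    funext i
    by_cases h : i = s <;> simp [h]
  | monomial_add m r p hm hr hp =>
    rw [mul_add, map_add, map_add, add_mul, hp, X, monomial_mul, one_mul, order_monomial,
      order_monomial, smul_mul_assoc, tprod_mul_single, add_comm (Finsupp.single _ _)]
    congr 3
    funext i
    by_cases h : i = s
    · subst h; simp [pow_add, mul_assoc]
    · simp [h]

variable {a b}

/-- In a Weyl pair, right multiplication by `a` is `e + ∂_f` on normal ordered symbols. -/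
lemma order_mul_single (h : b * a = a * b + 1) (s : S) (p : MvPolynomial (S ⊕ S) R) :
    order R S a b p * single s a =
      order R S a b (X (Sum.inl s) * p + pderiv (Sum.inr s) p) := by
  induction p using MvPolynomial.induction_on with
  | C r => rw [pderiv_C, add_zero, order_e_mul, order_C, smul_mul_assoc, mul_smul_comm, one_mul,
      mul_one]
  | add p q hp hq => rw [map_add, add_mul, hp, hq, ← map_add, map_add (pderiv _)]; congr 1; ring
  | mul_X p i hp =>
    rw [mul_comm p]
    rcases i with i | i
    · rw [order_e_mul, mul_assoc, hp, ← order_e_mul]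
      congr 1
      simp [Derivation.leibniz]; ring
    · rw [order_f_mul, Derivation.leibniz, pderiv_X]
      by_cases his : i = s
      · subst his
        rw [mul_assoc, ← map_mul, h, map_add, mul_add, map_one, mul_one, map_mul, ← mul_assoc, hp,
          ← order_f_mul, ← map_add]
        congr 1
        simp; ring
      · rw [mul_assoc, single_comm his, ← mul_assoc, hp, ← order_f_mul]
        congr 1
        simp [his]; ring

/-- In a Weyl pair, left multiplication by `b` is `f + ∂_e` on normal ordered symbols. -/
lemma single_mul_order (h : b * a = a * b + 1) (s : S) (p : MvPolynomial (S ⊕ S) R) :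
    single s b * order R S a b p =
      order R S a b (X (Sum.inr s) * p + pderiv (Sum.inl s) p) := by
  induction p using MvPolynomial.induction_on with
  | C r => rw [pderiv_C, add_zero, order_f_mul, order_C, smul_mul_assoc, mul_smul_comm, one_mul,
      mul_one]
  | add p q hp hq => rw [map_add, mul_add, hp, hq, ← map_add, map_add (pderiv _)]; congr 1; ring
  | mul_X p i hp =>
    rw [mul_comm p]
    rcases i with i | i
    · rw [order_e_mul, Derivation.leibniz, pderiv_X]
      by_cases his : i = s
      · subst his
        rw [← mul_assoc, ← map_mul, h, map_add, add_mul, map_one, one_mul, map_mul, mul_assoc, hp,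
          ← order_e_mul, ← map_add]
        congr 1
        simp; ring
      · rw [← mul_assoc, single_comm (Ne.symm his), mul_assoc, hp, ← order_e_mul]
        congr 1
        simp [his]; ring
    · rw [order_f_mul, ← mul_assoc, hp, ← order_f_mul]
      congr 1
      simp [Derivation.leibniz]; ring

end Ordering

/-! ### Disjoint tensor factors and deformed normal ordering -/

section Ordering

open MvPolynomial

variable {R : Type} [CommRing R] {W : Type} [Ring W] [Algebra R W] {S T : Type}

/-- The variables `e_s`, `f_s` with `s ∈ A`. -/
def varsOn (A : Set S) : Set (S ⊕ S) := {i | Sum.elim id id i ∈ A}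

lemma order_monomial_mul_monomial (a b : W) {m m' : (S ⊕ S) →₀ ℕ}
    (h : ∀ s, (m (Sum.inl s) = 0 ∧ m (Sum.inr s) = 0) ∨ (m' (Sum.inl s) = 0 ∧ m' (Sum.inr s) = 0))
    (r r' : R) : order R S a b (monomial m r * monomial m' r') =
      order R S a b (monomial m r) * order R S a b (monomial m' r') := by
  rw [monomial_mul, order_monomial, order_monomial, order_monomial,
    PiTensorProduct.smul_tprod_mul_smul_tprod]
  congr 2
  funext s
  rcases h s with ⟨h1, h2⟩ | ⟨h1, h2⟩ <;> simp [h1, h2]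

/-- Symbols in the variables of disjoint sets of tensor factors multiply without correction. -/
lemma order_mul_of_disjoint (a b : W) {A B : Set S} (hAB : Disjoint A B)
    {p p' : MvPolynomial (S ⊕ S) R}
    (hp : p ∈ supported R (varsOn A)) (hp' : p' ∈ supported R (varsOn B)) :
    order R S a b (p * p') = order R S a b p * order R S a b p' := by
  rw [mem_supported] at hp hp'
  conv_lhs => rw [p.as_sum, p'.as_sum, Finset.sum_mul_sum]
  conv_rhs => rw [p.as_sum, p'.as_sum, map_sum, map_sum, Finset.sum_mul_sum]
  rw [map_sum]
  refine Finset.sum_congr rfl fun m hm => ?_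
  rw [map_sum]
  refine Finset.sum_congr rfl fun m' hm' => order_monomial_mul_monomial a b (fun s => ?_) _ _
  have key : ∀ {C : Set S} {g : MvPolynomial (S ⊕ S) R} {n : (S ⊕ S) →₀ ℕ}, n ∈ g.support →
      (g.vars : Set (S ⊕ S)) ⊆ varsOn C → s ∉ C → n (Sum.inl s) = 0 ∧ n (Sum.inr s) = 0 := by
    intro C g n hn hg hs
    constructor <;>
    · by_contra h0
      exact hs (hg ((mem_vars_iff_mem_support _).mpr ⟨n, hn, Finsupp.mem_support_iff.mpr h0⟩))
  by_cases hs : s ∈ A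
  · exact Or.inr (key hm' hp' (Set.disjoint_left.mp hAB hs))
  · exact Or.inl (key hm hp hs)

/-- The second order operator `∑_s (2 e_s f_s² ∂_{f_s} + f_s² ∂_{f_s}²)`. -/
def deformation (R : Type) [CommRing R] (S : Type) [Fintype S] :
    MvPolynomial (S ⊕ S) R →ₗ[R] MvPolynomial (S ⊕ S) R :=
  ∑ s : S, ((LinearMap.mulLeft R (2 * X (Sum.inl s) * X (Sum.inr s) ^ 2)).comp
      (pderiv (Sum.inr s)).toLinearMap +
    (LinearMap.mulLeft R (X (Sum.inr s) ^ 2)).comp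
      ((pderiv (Sum.inr s)).toLinearMap.comp (pderiv (Sum.inr s)).toLinearMap))

lemma deformation_apply [Fintype S] (p : MvPolynomial (S ⊕ S) R) :
    deformation R S p = ∑ s : S, (2 * X (Sum.inl s) * X (Sum.inr s) ^ 2 * pderiv (Sum.inr s) p +
      X (Sum.inr s) ^ 2 * pderiv (Sum.inr s) (pderiv (Sum.inr s) p)) := by
  simp [deformation, mul_assoc]

lemma deformation_e_mul [Fintype S] (s : S) (p : MvPolynomial (S ⊕ S) R) :
    deformation R S (X (Sum.inl s) * p) = X (Sum.inl s) * deformation R S p := by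
  classical
  rw [deformation_apply, deformation_apply, Finset.mul_sum]
  refine Finset.sum_congr rfl fun s' _ => ?_
  simp [Derivation.leibniz, pderiv_X]
  ring

lemma deformation_f_mul [Fintype S] (s : S) (p : MvPolynomial (S ⊕ S) R) :
    deformation R S (X (Sum.inr s) * p) = X (Sum.inr s) * deformation R S p +
      2 * X (Sum.inr s) ^ 2 * (X (Sum.inl s) * p + pderiv (Sum.inr s) p) := by
  classical
  rw [deformation_apply, deformation_apply, Finset.mul_sum, ← sub_eq_iff_eq_add',
    ← Finset.sum_sub_distrib, Finset.sum_eq_single s]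
  · simp [Derivation.leibniz]; ring
  · intro s' _ h
    simp [Derivation.leibniz, Ne.symm h]; ring
  · simp

/-- To first order in the deformation parameter, normal ordering of the deformed pair
`(a, b + 2 d a b²)` is normal ordering of the Weyl pair `(a, b)` after `1 + d N`, where `N` is the
operator `deformation`. -/
lemma order_deformed [Fintype S] [DecidableEq S] {a b : W} (h : b * a = a * b + 1) {d : R}
    (hd : d * d = 0) (p : MvPolynomial (S ⊕ S) R) :
    order R S a (b + (d + d) • (a * b ^ 2)) p = order R S a b (p + d • deformation R S p) := by
  have hmul : ∀ q : MvPolynomial (S ⊕ S) R, ∀ s, order R S a b q * single s (a * b ^ 2) =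
      order R S a b (X (Sum.inr s) ^ 2 * (X (Sum.inl s) * q + pderiv (Sum.inr s) q)) := by
    intro q s
    rw [map_mul, map_pow, pow_two, ← mul_assoc, order_mul_single h, pow_two, mul_assoc,
      order_f_mul, order_f_mul, mul_assoc]
  induction p using MvPolynomial.induction_on with
  | C r =>
    rw [order_C]
    simp [deformation_apply, order_C]
  | add p q hp hq =>
    rw [map_add, hp, hq, ← map_add, map_add (deformation R S), smul_add]
    congr 1
    abel
  | mul_X p i hp =>
    rw [mul_comm p]
    rcases i with s | s
    · rw [order_e_mul, hp, ← order_e_mul, deformation_e_mul, mul_add, mul_smul_comm]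
    · have h0 : ∀ q : MvPolynomial (S ⊕ S) R, (d + d) • (d • q) = 0 := by
        intro q; rw [smul_smul, add_mul, hd, add_zero, zero_smul]
      have h1 : (d + d) • (X (Sum.inr s) ^ 2 * (X (Sum.inl s) * (p + d • deformation R S p) +
          pderiv (Sum.inr s) (p + d • deformation R S p))) =
          (d + d) • (X (Sum.inr s) ^ 2 * (X (Sum.inl s) * p + pderiv (Sum.inr s) p)) := by
        rw [map_add, Derivation.map_smul, mul_add (X (Sum.inl s)), mul_smul_comm, add_add_add_comm,
          ← smul_add d, mul_add (X (Sum.inr s) ^ 2), mul_smul_comm, smul_add (d + d), h0, add_zero]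
      have h2 : single (R := R) s (b + (d + d) • (a * b ^ 2)) =
          single s b + (d + d) • single s (a * b ^ 2) := by rw [map_add, map_smul]
      rw [order_f_mul, hp, h2, mul_add, mul_smul_comm, hmul, ← order_f_mul,
        ← map_smul (order R S a b), ← map_add, h1, deformation_f_mul]
      congr 1
      rw [mul_add, mul_smul_comm, smul_add, mul_assoc 2, two_mul, add_assoc, add_smul, smul_add d]

end Ordering

/-! ### Bijectivity of normal ordering -/

section Bijectivity

open MvPolynomial

variable {S : Type}

/-- Multiplication by `e_s` and the operator `f_s + ∂/∂e_s` form a Weyl pair. -/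
lemma weyl_symbols {R : Type} [CommRing R] (s : S) :
    (LinearMap.mulLeft R (X (Sum.inr s) : MvPolynomial (S ⊕ S) R) +
        (pderiv (R := R) (Sum.inl s)).toLinearMap : Module.End R (MvPolynomial (S ⊕ S) R)) *
      LinearMap.mulLeft R (X (Sum.inl s)) =
    LinearMap.mulLeft R (X (Sum.inl s)) * (LinearMap.mulLeft R (X (Sum.inr s)) +
        (pderiv (R := R) (Sum.inl s)).toLinearMap) + 1 := by
  refine LinearMap.ext fun p => ?_
  simp [Derivation.leibniz]
  ring

/-- The action of the `q`-Weyl algebra on symbols by left multiplication in the factor `s`. -/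
def symbolAction (s : S) : QWeyl →ₐ[ℚ[ε]] Module.End ℚ[ε] (MvPolynomial (S ⊕ S) ℚ[ε]) :=
  weylLift (weyl_symbols s)

lemma symbolAction_monomial (s : S) (m n : ℕ) :
    symbolAction s (E ^ m * D ^ n) 1 = X (Sum.inl s) ^ m * X (Sum.inr s) ^ n := by
  have h1 : ∀ m : ℕ, ∀ p, ((LinearMap.mulLeft ℚ[ε]
      (X (Sum.inl s) : MvPolynomial (S ⊕ S) ℚ[ε])) ^ m) p = X (Sum.inl s) ^ m * p := by
    intro m p
    rw [LinearMap.pow_mulLeft, LinearMap.mulLeft_apply]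
  have h2 : ((LinearMap.mulLeft ℚ[ε] (X (Sum.inr s) : MvPolynomial (S ⊕ S) ℚ[ε]) +
      (pderiv (R := ℚ[ε]) (Sum.inl s)).toLinearMap :
        Module.End ℚ[ε] (MvPolynomial (S ⊕ S) ℚ[ε])) ^ n) 1 = X (Sum.inr s) ^ n := by
    induction n with
    | zero => simp
    | succ n ih =>
      rw [pow_succ', Module.End.mul_apply, ih, LinearMap.add_apply, LinearMap.mulLeft_apply,
        Derivation.coeFn_coe, Derivation.leibniz_pow, pderiv_X_of_ne (by simp), smul_zero,
        smul_zero, add_zero, pow_succ']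
  rw [symbolAction, map_mul, map_pow, map_pow, weylLift_E, weylLift_D, Module.End.mul_apply, h2, h1]

/-- The symbol of an element of the tensor power, the left inverse of normal ordering: a pure tensor
`⊗_s w_s` goes to the product of the polynomials `w_s • 1`. -/
def symbol (S : Type) [Fintype S] :
    PiTensorProduct ℚ[ε] (fun _ : S => QWeyl) →ₗ[ℚ[ε]] MvPolynomial (S ⊕ S) ℚ[ε] :=
  PiTensorProduct.lift
    ((MultilinearMap.mkPiAlgebra ℚ[ε] S (MvPolynomial (S ⊕ S) ℚ[ε])).compLinearMap fun s =>
      (LinearMap.applyₗ (1 : MvPolynomial (S ⊕ S) ℚ[ε])).comp (symbolAction s).toLinearMap)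

lemma symbol_order [Fintype S] (p : MvPolynomial (S ⊕ S) ℚ[ε]) :
    symbol S (order ℚ[ε] S E D p) = p := by
  have : (symbol S).comp (order ℚ[ε] S E D) = LinearMap.id := by
    refine (basisMonomials (S ⊕ S) ℚ[ε]).ext fun m => ?_
    rw [LinearMap.comp_apply, coe_basisMonomials, order_monomial, one_smul, symbol,
      PiTensorProduct.lift.tprod, LinearMap.id_apply, MultilinearMap.compLinearMap_apply,
      MultilinearMap.mkPiAlgebra_apply]
    refine Eq.trans ?_ (monomial_eq (a := (1 : ℚ[ε])) (s := m)).symm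
    rw [C_1, one_mul, Finsupp.prod_fintype _ _ (by simp), Fintype.prod_sum_type,
      ← Finset.prod_mul_distrib]
    refine Finset.prod_congr rfl fun s _ => ?_
    exact symbolAction_monomial s _ _
  exact LinearMap.congr_fun this p

lemma order_surjective [Fintype S] [DecidableEq S] :
    Function.Surjective (order ℚ[ε] S E D) := by
  let N := LinearMap.range (order ℚ[ε] S E D)
  -- The range is a left ideal, since it is stable under the generators; it contains `1`.
  let B : Subalgebra ℚ[ε] (PiTensorProduct ℚ[ε] (fun _ : S => QWeyl)) :=
    { carrier := {x | ∀ n ∈ N, x * n ∈ N}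
      mul_mem' := fun {x y} hx hy n hn => by rw [mul_assoc]; exact hx _ (hy _ hn)
      add_mem' := fun {x y} hx hy n hn => by rw [add_mul]; exact N.add_mem (hx _ hn) (hy _ hn)
      algebraMap_mem' := fun r n hn => by
        rw [← Algebra.smul_def]; exact N.smul_mem r hn }
  have hE : ∀ s, single s E ∈ B := by
    rintro s _ ⟨p, rfl⟩
    exact ⟨_, order_e_mul E D s p⟩
  have hD : ∀ s, single s D ∈ B := by
    rintro s _ ⟨p, rfl⟩
    exact ⟨_, (single_mul_order D_mul_E s p).symm⟩
  have hs : ∀ s w, single s w ∈ B := by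
    intro s w
    have htop : B.comap (single s) = ⊤ := subalgebra_eq_top _ (hE s) (by
      rw [Subalgebra.mem_comap, F_eq, map_add, map_smul, map_mul, map_pow]
      exact B.add_mem (hD s) (B.smul_mem (B.mul_mem (hE s) (B.pow_mem (hD s) 2)) _))
    exact (Subalgebra.mem_comap B _ w).mp (htop ▸ Algebra.mem_top)
  have ht : ∀ x : S → QWeyl, PiTensorProduct.tprod ℚ[ε] x ∈ B := by
    intro x
    have h : ∀ A : Finset S,
        PiTensorProduct.tprod ℚ[ε] (fun s => if s ∈ A then x s else 1) ∈ B := by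
      intro A
      induction A using Finset.induction_on with
      | empty => simp only [Finset.notMem_empty, if_false]; exact B.one_mem
      | insert s A hsA ih =>
        convert B.mul_mem (hs s (x s)) ih using 1
        refine Eq.trans ?_ (single_mul_tprod s (x s) _).symm
        congr 1
        funext i
        by_cases hi : i = s
        · subst hi; simp [hsA]
        · simp [hi]
    simpa using h Finset.univ
  intro w
  have hw : w ∈ B := by
    induction w using PiTensorProduct.induction_on with
    | smul_tprod r x => exact B.smul_mem (ht x) r
    | add x y hx hy => exact B.add_mem hx hy
  have := hw 1 ⟨1, order_one E D⟩
  rwa [mul_one] at this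

/-- Normal ordering with respect to the Weyl pair `(E, D)` is bijective. -/
def orderEquiv (S : Type) [Fintype S] [DecidableEq S] :
    MvPolynomial (S ⊕ S) ℚ[ε] ≃ₗ[ℚ[ε]] PiTensorProduct ℚ[ε] (fun _ : S => QWeyl) :=
  LinearEquiv.ofBijective (order ℚ[ε] S E D)
    ⟨Function.LeftInverse.injective symbol_order, order_surjective⟩

/-- `ε / 4`. -/
def quarterEps : ℚ[ε] := (1 / 4 : ℚ) • DualNumber.eps

lemma quarterEps_add : quarterEps + quarterEps = halfEps := by
  rw [quarterEps, ← add_smul, halfEps]; norm_num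

lemma quarterEps_mul : quarterEps * quarterEps = 0 := by
  simp [quarterEps, DualNumber.eps_mul_eps]

lemma orderLinear_apply [Fintype S] [DecidableEq S] (p : MvPolynomial (S ⊕ S) ℚ[ε]) :
    orderLinear S p = order ℚ[ε] S E D (p + quarterEps • deformation ℚ[ε] S p) := by
  have h := order_deformed D_mul_E quarterEps_mul p
  rw [quarterEps_add, ← F_eq] at h
  exact h

lemma orderLinear_bijective [Fintype S] [DecidableEq S] :
    Function.Bijective (orderLinear S) := by
  have h0 : ∀ q : MvPolynomial (S ⊕ S) ℚ[ε], quarterEps • (quarterEps • q) = 0 := by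
    intro q
    rw [smul_smul quarterEps quarterEps q, quarterEps_mul]
    exact zero_smul _ q
  have hN : Function.Bijective
      fun p : MvPolynomial (S ⊕ S) ℚ[ε] => p + quarterEps • deformation ℚ[ε] S p := by
    refine Function.bijective_iff_has_inverse.mpr
      ⟨fun p => p - quarterEps • deformation ℚ[ε] S p, fun p => ?_, fun p => ?_⟩
    · simp only [map_add, map_smul]
      rw [smul_add quarterEps, h0, add_zero, add_sub_cancel_right]
    · simp only [map_sub, map_smul]
      rw [smul_sub quarterEps, h0, sub_zero, sub_add_cancel]
  have : (orderLinear S : _ → _) = (orderEquiv S) ∘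
      fun p : MvPolynomial (S ⊕ S) ℚ[ε] => p + quarterEps • deformation ℚ[ε] S p := by
    funext p
    exact orderLinear_apply p
  rw [this]
  exact (orderEquiv S).bijective.comp hN

end Bijectivity

/-! ### Moving elements along strands -/

section Stitching

variable {R : Type} [CommRing R] {W : Type} [Ring W] [Algebra R W] {S T : Type}

lemma stitchLinear_tprod (τ : Stitching S T) (x : S → W) :
    stitchLinear R W τ (PiTensorProduct.tprod R x) =
      PiTensorProduct.tprod R fun t => ((τ.strand t).map x).prod := by
  rw [stitchLinear, PiTensorProduct.lift.tprod]
  rfl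

lemma stitchLinear_one (τ : Stitching S T) : stitchLinear R W τ 1 = 1 := by
  rw [PiTensorProduct.one_def, stitchLinear_tprod, PiTensorProduct.one_def]
  congr 1
  funext t
  exact List.prod_eq_one (by simp)

variable [DecidableEq S]

lemma map_mulSingle_mul_of_notMem (l : List S) {s : S} (hs : s ∉ l) (w : W) (x : S → W) :
    l.map (fun i => (Pi.mulSingle s w : S → W) i * x i) = l.map x := by
  refine List.map_congr_left fun i hi => ?_
  rw [Pi.mulSingle_eq_of_ne (ne_of_mem_of_not_mem hi hs), one_mul]

lemma map_mul_mulSingle_of_notMem (l : List S) {s : S} (hs : s ∉ l) (w : W) (x : S → W) :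
    l.map (fun i => x i * (Pi.mulSingle s w : S → W) i) = l.map x := by
  refine List.map_congr_left fun i hi => ?_
  rw [Pi.mulSingle_eq_of_ne (ne_of_mem_of_not_mem hi hs), mul_one]

/-- An element can be moved across the junction of two consecutive components of a strand. -/
lemma stitchLinear_mul_single (τ : Stitching S T) {s s' : S} {t : T}
    (h : [s, s'] <:+: τ.strand t) (w : W) (x : PiTensorProduct R (fun _ : S => W)) :
    stitchLinear R W τ (x * single s w) = stitchLinear R W τ (single s' w * x) := by
  induction x using PiTensorProduct.induction_on with
  | add x y hx hy => rw [add_mul, mul_add, map_add, map_add, hx, hy]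
  | smul_tprod r x =>
    rw [smul_mul_assoc, mul_smul_comm, map_smul, map_smul, tprod_mul_single, single_mul_tprod,
      stitchLinear_tprod, stitchLinear_tprod]
    congr 2
    funext t'
    by_cases ht : t' = t
    · subst ht
      obtain ⟨l₁, l₂, hl⟩ := h
      have hn := τ.nodup t'
      rw [← hl] at hn ⊢
      have hn' : (l₁ ++ s :: s' :: l₂).Nodup := by simpa using hn
      have hs := List.nodup_middle.mp hn'
      have hn'' : ((l₁ ++ [s]) ++ s' :: l₂).Nodup := by simpa using hn
      have hs' := List.nodup_middle.mp hn''
      simp only [List.nodup_cons, List.mem_append, List.mem_cons, List.mem_nil_iff, or_false,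
        not_or] at hs hs'
      simp only [List.map_append, List.map_cons, List.map_nil, List.prod_append, List.prod_cons,
        List.prod_nil, mul_one, map_mul_mulSingle_of_notMem _ hs.1.1,
        map_mul_mulSingle_of_notMem _ hs.1.2.2,
        map_mulSingle_mul_of_notMem _ hs'.1.1.1, map_mulSingle_mul_of_notMem _ hs'.1.2]
      rw [Pi.mulSingle_eq_same, Pi.mulSingle_eq_same, Pi.mulSingle_eq_of_ne (Ne.symm hs.1.2.1),
        Pi.mulSingle_eq_of_ne hs.1.2.1, one_mul, mul_one]
      simp only [mul_assoc]
    · have hs : s ∈ τ.strand t := h.subset (by simp)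
      have hs' : s' ∈ τ.strand t := h.subset (by simp)
      rw [map_mul_mulSingle_of_notMem _ fun hm => ht (τ.disjoint _ _ _ hm hs),
        map_mulSingle_mul_of_notMem _ fun hm => ht (τ.disjoint _ _ _ hm hs')]

variable [DecidableEq T]

lemma stitchLinear_single_mul (τ : Stitching S T) {s : S} {t : T}
    (h : [s] <+: τ.strand t) (w : W) (x : PiTensorProduct R (fun _ : S => W)) :
    stitchLinear R W τ (single s w * x) = single t w * stitchLinear R W τ x := by
  induction x using PiTensorProduct.induction_on with
  | add x y hx hy => rw [mul_add, map_add, map_add, mul_add, hx, hy]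
  | smul_tprod r x =>
    rw [mul_smul_comm, map_smul, map_smul, mul_smul_comm, single_mul_tprod,
      stitchLinear_tprod, stitchLinear_tprod, single_mul_tprod]
    congr 2
    funext t'
    by_cases ht : t' = t
    · subst ht
      obtain ⟨l, hl⟩ := h
      have hn := τ.nodup t'
      rw [← hl] at hn ⊢
      have hs : s ∉ l := by simpa using (List.nodup_cons.mp hn).1
      simp [map_mulSingle_mul_of_notMem _ hs, mul_assoc]
    · have hs : s ∈ τ.strand t := h.subset (by simp)
      rw [map_mulSingle_mul_of_notMem _ fun hm => ht (τ.disjoint _ _ _ hm hs),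
        Pi.mulSingle_eq_of_ne ht, one_mul]

lemma stitchLinear_mul_single_last (τ : Stitching S T) {s : S} {t : T}
    (h : [s] <:+ τ.strand t) (w : W) (x : PiTensorProduct R (fun _ : S => W)) :
    stitchLinear R W τ (x * single s w) = stitchLinear R W τ x * single t w := by
  induction x using PiTensorProduct.induction_on with
  | add x y hx hy => rw [add_mul, map_add, map_add, add_mul, hx, hy]
  | smul_tprod r x =>
    rw [smul_mul_assoc, map_smul, map_smul, smul_mul_assoc, tprod_mul_single,
      stitchLinear_tprod, stitchLinear_tprod, tprod_mul_single]
    congr 2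
    funext t'
    by_cases ht : t' = t
    · subst ht
      obtain ⟨l, hl⟩ := h
      have hn := τ.nodup t'
      rw [← hl] at hn ⊢
      have hs : s ∉ l := by simpa using (List.nodup_cons.mp (List.nodup_middle.mp hn)).1
      simp [map_mul_mulSingle_of_notMem _ hs, mul_assoc]
    · have hs : s ∈ τ.strand t := h.subset (by simp)
      rw [map_mul_mulSingle_of_notMem _ fun hm => ht (τ.disjoint _ _ _ hm hs),
        Pi.mulSingle_eq_of_ne ht, mul_one]

end Stitching

/-! ### Coefficientwise linear maps and the exponential of power series -/

section Coefficientwise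

variable {R : Type} [CommRing R] {A B C : Type} [Ring A] [Algebra R A] [Ring B] [Algebra R B]
  [Ring C] [Algebra R C]

/-- A linear map applied to the coefficients of a power series. -/
def coeffMap (φ : A →ₗ[R] B) : PowerSeries A →+ PowerSeries B where
  toFun f := PowerSeries.mk fun n => φ (PowerSeries.coeff n f)
  map_zero' := by ext; simp
  map_add' f g := by ext; simp

@[simp]
lemma coeff_coeffMap (φ : A →ₗ[R] B) (f : PowerSeries A) (n : ℕ) :
    PowerSeries.coeff n (coeffMap φ f) = φ (PowerSeries.coeff n f) := by
  simp [coeffMap]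

lemma coeffMap_comp (φ : A →ₗ[R] B) (ψ : B →ₗ[R] C) (f : PowerSeries A) :
    coeffMap ψ (coeffMap φ f) = coeffMap (ψ.comp φ) f := by
  ext; simp

lemma map_ofPowerSeries (φ : A →ₗ[R] B) (f : PowerSeries A) :
    HahnSeries.map (HahnSeries.ofPowerSeries ℤ A f) φ =
      HahnSeries.ofPowerSeries ℤ B (coeffMap φ f) := by
  ext n
  rw [HahnSeries.map_coeff]
  obtain ⟨m, rfl⟩ | h := em (∃ m : ℕ, (m : ℤ) = n)
  · rw [HahnSeries.ofPowerSeries_apply_coeff, HahnSeries.ofPowerSeries_apply_coeff, coeff_coeffMap]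
  · have hn : ∀ {D : Type} [Ring D] (f : PowerSeries D),
        (HahnSeries.ofPowerSeries ℤ D f).coeff n = 0 := by
      intro D _ f
      rw [HahnSeries.ofPowerSeries_apply]
      exact HahnSeries.embDomain_of_notMem_range fun ⟨m, hm⟩ => h ⟨m, hm⟩
    rw [hn, hn]
    exact map_zero φ

end Coefficientwise

section Commutative

variable {R : Type} [CommRing R] {A B : Type} [CommRing A] [Algebra R A] [CommRing B] [Algebra R B]

lemma coeffMap_const_mul (φ : A →ₗ[R] B) (c : PowerSeries R) (f : PowerSeries A) :
    coeffMap φ (algebraMap (PowerSeries R) (PowerSeries A) c * f) =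
      algebraMap (PowerSeries R) (PowerSeries B) c * coeffMap φ f := by
  ext n
  simp only [coeff_coeffMap, PowerSeries.coeff_mul, map_sum, PowerSeries.algebraMap_apply'',
    PowerSeries.coeff_map, ← Algebra.smul_def, map_smul]

lemma derivative_coeffMap (φ : A →ₗ[R] B) (f : PowerSeries A) :
    PowerSeries.derivative B (coeffMap φ f) = coeffMap φ (PowerSeries.derivative A f) := by
  ext n
  have h : ∀ {D : Type} [CommRing D] (x : D), x * ((n : D) + 1) = (n + 1) • x := by
    intro D _ x; rw [nsmul_eq_mul]; push_cast; ring
  rw [PowerSeries.coeff_derivative, coeff_coeffMap, coeff_coeffMap, PowerSeries.coeff_derivative,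
    h, h, map_nsmul]

lemma coeffMap_derivation_mul (d : Derivation R A A) (f g : PowerSeries A) :
    coeffMap d.toLinearMap (f * g) =
      f * coeffMap d.toLinearMap g + g * coeffMap d.toLinearMap f := by
  ext n
  simp only [coeff_coeffMap, map_add, PowerSeries.coeff_mul, map_sum, Derivation.coeFn_coe,
    Derivation.leibniz, smul_eq_mul, Finset.sum_add_distrib]
  congr 1
  rw [← Finset.Nat.sum_antidiagonal_swap]
  rfl

lemma derivative_algebraMap (c : PowerSeries R) :
    PowerSeries.derivative A (algebraMap (PowerSeries R) (PowerSeries A) c) =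
      algebraMap (PowerSeries R) (PowerSeries A) (PowerSeries.derivative R c) := by
  ext n
  simp [PowerSeries.algebraMap_apply'', PowerSeries.coeff_derivative]

end Commutative

section Exponential

variable {A : Type} [CommRing A] [Algebra ℚ A]

/-- The exponential of a power series without constant term. -/
def pexp (g : PowerSeries A) : PowerSeries A := (PowerSeries.exp A).subst g

lemma derivative_pexp {g : PowerSeries A} (hg : PowerSeries.constantCoeff g = 0) :
    PowerSeries.derivative A (pexp g) = PowerSeries.derivative A g * pexp g := by
  rw [pexp, PowerSeries.derivative_subst (PowerSeries.HasSubst.of_constantCoeff_zero' hg),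
    PowerSeries.derivative_exp, mul_comm]

lemma constantCoeff_pexp {g : PowerSeries A} (hg : PowerSeries.constantCoeff g = 0) :
    PowerSeries.constantCoeff (pexp g) = 1 := by
  rw [pexp, ← PowerSeries.coeff_zero_eq_constantCoeff_apply,
    PowerSeries.coeff_subst' (PowerSeries.HasSubst.of_constantCoeff_zero' hg),
    finsum_eq_single _ 0]
  · simp
  · intro n hn
    rw [PowerSeries.coeff_zero_eq_constantCoeff_apply, map_pow, hg, zero_pow hn, smul_zero]

/-- Uniqueness for the linear differential equation `y' = g' y` with initial value `0`. -/
lemma eq_zero_of_derivative {g y : PowerSeries A}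
    (hg : PowerSeries.constantCoeff g = 0)
    (hy : PowerSeries.derivative A y = PowerSeries.derivative A g * y)
    (h0 : PowerSeries.constantCoeff y = 0) : y = 0 := by
  have : IsAddTorsionFree A := .of_module_rat A
  have hneg : PowerSeries.constantCoeff (-g) = 0 := by rw [map_neg, hg, neg_zero]
  have h1 : pexp (-g) * y = 0 := by
    refine PowerSeries.derivative.ext ?_ (by rw [map_mul, h0, mul_zero, map_zero])
    rw [Derivation.leibniz, hy, derivative_pexp hneg, map_neg, map_zero, smul_eq_mul, smul_eq_mul]
    ring
  have h2 : IsUnit (pexp (-g)) := by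
    rw [PowerSeries.isUnit_iff_constantCoeff, constantCoeff_pexp hneg]
    exact isUnit_one
  exact h2.mul_right_eq_zero.mp h1

/-- The exponential is the solution of `y' = g' y` with initial value `1`. -/
lemma eq_pexp {g y : PowerSeries A} (hg : PowerSeries.constantCoeff g = 0)
    (hy : PowerSeries.derivative A y = PowerSeries.derivative A g * y)
    (h0 : PowerSeries.constantCoeff y = 1) : y = pexp g := by
  rw [← sub_eq_zero]
  refine eq_zero_of_derivative hg ?_ (by rw [map_sub, h0, constantCoeff_pexp hg, sub_self])
  rw [map_sub, hy, derivative_pexp hg, mul_sub]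

lemma pexp_add {g g' : PowerSeries A} (hg : PowerSeries.constantCoeff g = 0)
    (hg' : PowerSeries.constantCoeff g' = 0) : pexp g * pexp g' = pexp (g + g') := by
  refine eq_pexp (by rw [map_add, hg, hg', add_zero]) ?_
    (by rw [map_mul, constantCoeff_pexp hg, constantCoeff_pexp hg', mul_one])
  rw [Derivation.leibniz, derivative_pexp hg, derivative_pexp hg', map_add, smul_eq_mul,
    smul_eq_mul]
  ring

lemma pexp_zero : pexp (0 : PowerSeries A) = 1 :=
  (eq_pexp (map_zero _) (by simp) (map_one _)).symm

/-- The exponential of `c g` with `c² = 0`. -/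
lemma pexp_of_mul_self_eq_zero {g : PowerSeries A} (hg : PowerSeries.constantCoeff g = 0)
    (h : PowerSeries.derivative A g * g = 0) : pexp g = 1 + g := by
  refine (eq_pexp hg ?_ (by rw [map_add, hg, map_one, add_zero])).symm
  rw [map_add, mul_add, h, mul_one, add_zero, Derivation.map_one_eq_zero, zero_add]

lemma map_pexp {B : Type} [CommRing B] [Algebra ℚ B] (φ : A →+* B) {g : PowerSeries A}
    (hg : PowerSeries.constantCoeff g = 0) :
    PowerSeries.map φ (pexp g) = pexp (PowerSeries.map φ g) := by
  have hd : ∀ f : PowerSeries A, PowerSeries.derivative B (PowerSeries.map φ f) =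
      PowerSeries.map φ (PowerSeries.derivative A f) := by
    intro f; ext n; simp [PowerSeries.coeff_derivative]
  have hc : ∀ f : PowerSeries A, PowerSeries.constantCoeff (PowerSeries.map φ f) =
      φ (PowerSeries.constantCoeff f) := by
    intro f
    rw [← PowerSeries.coeff_zero_eq_constantCoeff_apply, PowerSeries.coeff_map,
      PowerSeries.coeff_zero_eq_constantCoeff_apply]
  refine eq_pexp (by rw [hc, hg, map_zero]) ?_ (by rw [hc, constantCoeff_pexp hg, map_one])
  rw [hd, hd, derivative_pexp hg, map_mul]

lemma coeffMap_derivation_pexp {R : Type} [CommRing R] [Algebra R A] (d : Derivation R A A)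
    {g : PowerSeries A} (hg : PowerSeries.constantCoeff g = 0) :
    coeffMap d.toLinearMap (pexp g) = coeffMap d.toLinearMap g * pexp g := by
  have h0 : ∀ f : PowerSeries A, PowerSeries.constantCoeff (coeffMap d.toLinearMap f) =
      d (PowerSeries.constantCoeff f) := by
    intro f
    rw [← PowerSeries.coeff_zero_eq_constantCoeff_apply, coeff_coeffMap]
    simp
  rw [← sub_eq_zero]
  refine eq_zero_of_derivative hg ?_ ?_
  · rw [map_sub, derivative_coeffMap, derivative_pexp hg, coeffMap_derivation_mul,
      Derivation.leibniz, derivative_pexp hg, derivative_coeffMap, smul_eq_mul, smul_eq_mul]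
    ring
  · rw [map_sub, map_mul, h0, h0, hg, constantCoeff_pexp hg, Derivation.map_one_eq_zero, map_zero,
      zero_mul, sub_zero]

lemma heval_exp {g : PowerSeries A} (hg : PowerSeries.constantCoeff g = 0) :
    PowerSeries.heval (HahnSeries.ofPowerSeries ℤ A g) (PowerSeries.exp A) =
      HahnSeries.ofPowerSeries ℤ A (pexp g) := by
  have hn : ∀ {n : ℤ}, (¬ ∃ m : ℕ, (m : ℤ) = n) → ∀ f : PowerSeries A,
      (HahnSeries.ofPowerSeries ℤ A f).coeff n = 0 := by
    intro n h f
    rw [HahnSeries.ofPowerSeries_apply]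
    exact HahnSeries.embDomain_of_notMem_range fun ⟨m, hm⟩ => h ⟨m, hm⟩
  have hpos : 0 < (HahnSeries.ofPowerSeries ℤ A g).orderTop := by
    induction h : (HahnSeries.ofPowerSeries ℤ A g).orderTop using WithTop.recTopCoe with
    | top => exact WithTop.coe_lt_top 0
    | coe i =>
      have hi := HahnSeries.coeff_orderTop_ne h
      obtain ⟨m, rfl⟩ : ∃ m : ℕ, (m : ℤ) = i := by
        by_contra h'
        exact hi (hn h' g)
      rw [HahnSeries.ofPowerSeries_apply_coeff] at hi
      have hm : m ≠ 0 := by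
        rintro rfl
        exact hi (by rw [PowerSeries.coeff_zero_eq_constantCoeff_apply, hg])
      exact WithTop.coe_lt_coe.mpr (by omega)
  have key : ∀ n k, (HahnSeries.SummableFamily.powerSeriesFamily (HahnSeries.ofPowerSeries ℤ A g)
      (PowerSeries.exp A)).coeff n k = PowerSeries.coeff k (PowerSeries.exp A) •
        (HahnSeries.ofPowerSeries ℤ A (g ^ k)).coeff n := by
    intro n k
    rw [map_pow, ← HahnSeries.coeff_smul,
      ← HahnSeries.SummableFamily.powerSeriesFamily_of_orderTop_pos hpos]
    rfl
  ext n
  rw [PowerSeries.coeff_heval]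
  obtain ⟨m, rfl⟩ | h := em (∃ m : ℕ, (m : ℤ) = n)
  · rw [HahnSeries.ofPowerSeries_apply_coeff, pexp,
      PowerSeries.coeff_subst' (PowerSeries.HasSubst.of_constantCoeff_zero' hg)]
    refine finsum_congr fun k => ?_
    rw [key, HahnSeries.ofPowerSeries_apply_coeff]
  · rw [hn h]
    refine finsum_eq_zero_of_forall_eq_zero fun k => ?_
    rw [key, hn h, smul_zero]

end Exponential

/-! ### Symbols, stitching rules and Wick's rule -/

section Symbols

variable {R : Type} [CommRing R] {S T : Type}

/-- Power series in `h` whose coefficients are polynomials in the variables `e_s`, `f_s`. -/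
abbrev Sym (R : Type) [CommRing R] (S : Type) : Type := PowerSeries (MvPolynomial (S ⊕ S) R)

/-- The constant `w ∈ R⟦h⟧`. -/
abbrev cst (w : PowerSeries R) : Sym R S := algebraMap (PowerSeries R) (Sym R S) w

/-- The variable `e_s`. -/
def ve (s : S) : Sym R S := PowerSeries.C (MvPolynomial.X (Sum.inl s))

/-- The variable `f_s`. -/
def vf (s : S) : Sym R S := PowerSeries.C (MvPolynomial.X (Sum.inr s))

/-- A derivation of the polynomials applied to the coefficients of a power series. -/
def coeffDerivation (d : Derivation R (MvPolynomial (S ⊕ S) R) (MvPolynomial (S ⊕ S) R)) :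
    Derivation (PowerSeries R) (Sym R S) (Sym R S) :=
  Derivation.mk'
    { toFun := coeffMap d.toLinearMap
      map_add' := map_add _
      map_smul' := fun c x => by
        rw [Algebra.smul_def, coeffMap_const_mul, RingHom.id_apply, Algebra.smul_def] }
    fun a b => coeffMap_derivation_mul d a b

lemma coeffDerivation_apply (d : Derivation R (MvPolynomial (S ⊕ S) R) (MvPolynomial (S ⊕ S) R))
    (p : Sym R S) : coeffDerivation d p = coeffMap d.toLinearMap p := rfl

/-- The derivation `∂/∂e_s`. -/
def dE (s : S) : Derivation (PowerSeries R) (Sym R S) (Sym R S) :=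
  coeffDerivation (MvPolynomial.pderiv (Sum.inl s))

/-- The derivation `∂/∂f_s`. -/
def dF (s : S) : Derivation (PowerSeries R) (Sym R S) (Sym R S) :=
  coeffDerivation (MvPolynomial.pderiv (Sum.inr s))

lemma coeffDerivation_C (d : Derivation R (MvPolynomial (S ⊕ S) R) (MvPolynomial (S ⊕ S) R))
    (p : MvPolynomial (S ⊕ S) R) :
    coeffDerivation d (PowerSeries.C p) = PowerSeries.C (d p) := by
  ext1 n
  rw [coeffDerivation_apply, coeff_coeffMap, PowerSeries.coeff_C, PowerSeries.coeff_C]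
  split_ifs <;> simp

@[simp] lemma dE_ve [DecidableEq S] (s s' : S) :
    dE s (ve s' : Sym R S) = if s' = s then 1 else 0 := by
  rw [dE, ve, coeffDerivation_C, MvPolynomial.pderiv_X, Pi.single_apply]
  split_ifs <;> simp_all

@[simp] lemma dE_vf (s s' : S) : dE s (vf s' : Sym R S) = 0 := by
  rw [dE, vf, coeffDerivation_C, MvPolynomial.pderiv_X_of_ne (by simp), map_zero]

@[simp] lemma dF_vf [DecidableEq S] (s s' : S) :
    dF s (vf s' : Sym R S) = if s' = s then 1 else 0 := by
  rw [dF, vf, coeffDerivation_C, MvPolynomial.pderiv_X, Pi.single_apply]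
  split_ifs <;> simp_all

@[simp] lemma dF_ve (s s' : S) : dF s (ve s' : Sym R S) = 0 := by
  rw [dF, ve, coeffDerivation_C, MvPolynomial.pderiv_X_of_ne (by simp), map_zero]

@[simp] lemma derivative_ve (s : S) : PowerSeries.derivative _ (ve s : Sym R S) = 0 := by
  rw [ve, PowerSeries.derivative_C]

@[simp] lemma derivative_vf (s : S) : PowerSeries.derivative _ (vf s : Sym R S) = 0 := by
  rw [vf, PowerSeries.derivative_C]

lemma derivative_cst (w : PowerSeries R) : PowerSeries.derivative _ (cst w : Sym R S) =
    cst (PowerSeries.derivative R w) := derivative_algebraMap w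

lemma constantCoeff_cst (w : PowerSeries R) : PowerSeries.constantCoeff (cst w : Sym R S) =
    MvPolynomial.C (PowerSeries.constantCoeff w) := by
  rw [cst, PowerSeries.algebraMap_apply'', ← PowerSeries.coeff_zero_eq_constantCoeff_apply,
    PowerSeries.coeff_map, PowerSeries.coeff_zero_eq_constantCoeff_apply]
  rfl

lemma map_cst_mul (L : Sym R S →ₗ[PowerSeries R] Sym R T) (w : PowerSeries R) (p : Sym R S) :
    L (cst w * p) = cst w * L p := by
  rw [cst, cst, ← Algebra.smul_def, map_smul, Algebra.smul_def]

/-- The rules for stitching normal ordered symbols: variables move freely to the outside of a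
strand, and moving `e` (or `f`) across the junction of two consecutive components produces a
derivative. -/
structure IsStitch (τ : Stitching S T) (M : Sym R S →ₗ[PowerSeries R] Sym R T) : Prop where
  one : M 1 = 1
  derivative : ∀ p, PowerSeries.derivative _ (M p) = M (PowerSeries.derivative _ p)
  constantCoeff : ∀ p, PowerSeries.constantCoeff p = 1 → PowerSeries.constantCoeff (M p) = 1
  e_head : ∀ {s t}, [s] <+: τ.strand t → ∀ p, M (ve s * p) = ve t * M p
  f_last : ∀ {s t}, [s] <:+ τ.strand t → ∀ p, M (vf s * p) = vf t * M p
  e_step : ∀ {s s' t}, [s, s'] <:+: τ.strand t → ∀ p, M (ve s' * p) = M (ve s * p) + M (dF s p)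
  f_step : ∀ {s s' t}, [s, s'] <:+: τ.strand t → ∀ p, M (vf s * p) = M (vf s' * p) + M (dE s' p)

/-- The functional `p ↦ M (p exp Q)`. -/
def gauss [Algebra ℚ R] (M : Sym R S →ₗ[PowerSeries R] Sym R T) (Q : Sym R S) :
    Sym R S →ₗ[PowerSeries R] Sym R T :=
  M.comp (LinearMap.mulRight (PowerSeries R) (pexp Q))

lemma gauss_apply [Algebra ℚ R] (M : Sym R S →ₗ[PowerSeries R] Sym R T) (Q p : Sym R S) :
    gauss M Q p = M (p * pexp Q) := rfl

section Gauss

variable [Algebra ℚ R] {τ : Stitching S T} {M : Sym R S →ₗ[PowerSeries R] Sym R T} {Q : Sym R S}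

lemma dE_pexp (hQ : PowerSeries.constantCoeff Q = 0) (s : S) :
    dE s (pexp Q) = dE s Q * pexp Q :=
  coeffMap_derivation_pexp (MvPolynomial.pderiv (R := R) (Sum.inl s)) hQ

lemma dF_pexp (hQ : PowerSeries.constantCoeff Q = 0) (s : S) :
    dF s (pexp Q) = dF s Q * pexp Q :=
  coeffMap_derivation_pexp (MvPolynomial.pderiv (R := R) (Sum.inr s)) hQ

lemma IsStitch.gauss_e_head (hM : IsStitch τ M) {s t} (h : [s] <+: τ.strand t) (p : Sym R S) :
    gauss M Q (ve s * p) = ve t * gauss M Q p := by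
  rw [gauss_apply, gauss_apply, mul_assoc, hM.e_head h]

lemma IsStitch.gauss_f_last (hM : IsStitch τ M) {s t} (h : [s] <:+ τ.strand t) (p : Sym R S) :
    gauss M Q (vf s * p) = vf t * gauss M Q p := by
  rw [gauss_apply, gauss_apply, mul_assoc, hM.f_last h]

lemma IsStitch.gauss_e_step (hM : IsStitch τ M) (hQ : PowerSeries.constantCoeff Q = 0) {s s' t}
    (h : [s, s'] <:+: τ.strand t) (p : Sym R S) :
    gauss M Q (ve s' * p) = gauss M Q (ve s * p) + gauss M Q (dF s p) + gauss M Q (dF s Q * p) := by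
  simp only [gauss_apply]
  rw [mul_assoc, hM.e_step h, Derivation.leibniz, dF_pexp hQ, ← map_add, ← map_add, ← map_add,
    smul_eq_mul, smul_eq_mul]
  exact congrArg M (by ring)

lemma IsStitch.gauss_f_step (hM : IsStitch τ M) (hQ : PowerSeries.constantCoeff Q = 0) {s s' t}
    (h : [s, s'] <:+: τ.strand t) (p : Sym R S) (hp : dE s' p = 0) :
    gauss M Q (vf s * p) = gauss M Q (vf s' * p) + gauss M Q (dE s' Q * p) := by
  simp only [gauss_apply]
  rw [mul_assoc, hM.f_step h, Derivation.leibniz, dE_pexp hQ, hp, smul_zero, add_zero, ← map_add,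
    ← map_add, smul_eq_mul]
  exact congrArg M (by ring)

lemma IsStitch.derivative_gauss (hM : IsStitch τ M) (hQ : PowerSeries.constantCoeff Q = 0) :
    PowerSeries.derivative _ (gauss M Q 1) = gauss M Q (PowerSeries.derivative _ Q) := by
  rw [gauss_apply, gauss_apply, hM.derivative, one_mul, derivative_pexp hQ]

lemma IsStitch.constantCoeff_gauss (hM : IsStitch τ M) (hQ : PowerSeries.constantCoeff Q = 0) :
    PowerSeries.constantCoeff (gauss M Q 1) = 1 := by
  rw [gauss_apply, one_mul]
  exact hM.constantCoeff _ (constantCoeff_pexp hQ)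

end Gauss

/-- A functional is Gaussian with means `eh`, `fh` and covariance `G` if it obeys Wick's rule:
a variable `e_s` can be replaced by `eh s`, up to its contractions with the variables `f_b`. -/
structure IsGaussian [Fintype S] (L : Sym R S →ₗ[PowerSeries R] Sym R T) (eh fh : S → Sym R T)
    (G : S → S → Sym R T) : Prop where
  e_mul : ∀ s p, L (ve s * p) = eh s * L p + ∑ b, G s b * L (dF b p)
  f_mul : ∀ s p, (∀ b, dE b p = 0) → L (vf s * p) = fh s * L p

section Wick

variable [Fintype S] [DecidableEq S] {L : Sym R S →ₗ[PowerSeries R] Sym R T}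
  {eh fh : S → Sym R T} {G : S → S → Sym R T}

lemma IsGaussian.wick_two (h : IsGaussian L eh fh G) (a b : S) :
    L (ve a * vf b) = (eh a * fh b + G a b) * L 1 := by
  have hf := h.f_mul b 1 fun b => by simp
  rw [mul_one] at hf
  rw [h.e_mul, hf, Finset.sum_eq_single b]
  · simp; ring
  · intro b' _ hb'; simp [Ne.symm hb']
  · simp

lemma IsGaussian.wick_four (h : IsGaussian L eh fh G) (a c b d : S) :
    L (ve a * ve c * vf b * vf d) =
      ((eh a * fh b + G a b) * (eh c * fh d + G c d) +
        (eh a * fh d + G a d) * (eh c * fh b + G c b) - eh a * eh c * fh b * fh d) * L 1 := by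
  have hf : ∀ b, L (vf b) = fh b * L 1 := fun b => by
    have hf := h.f_mul b 1 fun b => by simp
    rwa [mul_one] at hf
  have hff : ∀ b d, L (vf b * vf d) = fh b * (fh d * L 1) := fun b d => by
    rw [h.f_mul b _ fun b => by simp, hf]
  have hd : ∀ x, dF x (vf b * vf d : Sym R S) =
      (if d = x then vf b else 0) + (if b = x then vf d else 0) := fun x => by
    rw [Derivation.leibniz, dF_vf, dF_vf]; split_ifs <;> simp
  have h1 : ∀ a, L (ve a * (vf b * vf d)) =
      (eh a * fh b * fh d + G a d * fh b + G a b * fh d) * L 1 := fun a => by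
    have : ∀ x, G a x * L (dF x (vf b * vf d)) =
        (if d = x then G a d * (fh b * L 1) else 0) + (if b = x then G a b * (fh d * L 1) else 0) :=
      fun x => by rw [hd]; split_ifs <;> simp_all [mul_add]
    rw [h.e_mul, hff, Finset.sum_congr rfl fun x _ => this x, Finset.sum_add_distrib,
      Finset.sum_ite_eq, Finset.sum_ite_eq, if_pos (Finset.mem_univ _), if_pos (Finset.mem_univ _)]
    ring
  have h2 : ∀ b, L (ve c * vf b) = (eh c * fh b + G c b) * L 1 := fun b => h.wick_two c b
  have : ∀ x, G a x * L (dF x (ve c * (vf b * vf d))) =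
      (if d = x then G a d * ((eh c * fh b + G c b) * L 1) else 0) +
        (if b = x then G a b * ((eh c * fh d + G c d) * L 1) else 0) := fun x => by
    rw [Derivation.leibniz, hd, dF_ve]
    split_ifs <;> simp_all [mul_add]
  rw [mul_assoc, mul_assoc, h.e_mul, h1, Finset.sum_congr rfl fun x _ => this x,
    Finset.sum_add_distrib, Finset.sum_ite_eq, Finset.sum_ite_eq, if_pos (Finset.mem_univ _),
    if_pos (Finset.mem_univ _)]
  ring

end Wick

end Symbols

/-! ### Symbols of crossings and rotations -/

section Elements

variable {R : Type} [CommRing R] {S T : Type}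

/-- `a (1 + η A) exp Q`. -/
def perturbed [Algebra ℚ R] (η a : PowerSeries R) (A Q : Sym R S) : Sym R S :=
  cst a * (1 + cst η * A) * pexp Q

lemma perturbed_mul [Algebra ℚ R] {η : PowerSeries R} (hη : η * η = 0)
    (a b : PowerSeries R) (A B : Sym R S) {Q Q' : Sym R S} (hQ : PowerSeries.constantCoeff Q = 0)
    (hQ' : PowerSeries.constantCoeff Q' = 0) :
    perturbed η a A Q * perturbed η b B Q' = perturbed η (a * b) (A + B) (Q + Q') := by
  have h : cst η * cst η = (0 : Sym R S) := by rw [← map_mul, hη, map_zero]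
  rw [perturbed, perturbed, perturbed, ← pexp_add hQ hQ', cst, cst, cst, cst, map_mul]
  rw [cst] at h
  linear_combination (cst a * cst b * A * B * pexp Q * pexp Q') * h

lemma map_perturbed [Algebra ℚ R] (M : Sym R S →ₗ[PowerSeries R] Sym R T) (η a : PowerSeries R)
    (A Q : Sym R S) :
    M (perturbed η a A Q) = cst a * (gauss M Q 1 + cst η * gauss M Q A) := by
  rw [perturbed, mul_assoc, map_cst_mul, add_mul, mul_assoc, map_add, map_cst_mul]
  rfl

/-- The quadratic exponent `(1 - w) (e_i - e_j) f_j` of a crossing. -/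
def quadratic (w : PowerSeries R) (i j : S) : Sym R S := cst (1 - w) * ((ve i - ve j) * vf j)

/-- The first order correction of a crossing, with respect to normal ordering for the Weyl pair
`(E, D)`. Here `w = t^σ`, `κ = (1 - w) / (2 (1 + w))` and `δ = (1 + σ) / 2`. -/
def quartic (w κ δ : PowerSeries R) (i j : S) : Sym R S :=
  cst κ * (cst (w * (1 - w)) * (ve i * ve i * vf j * vf j) +
    cst (w * (1 + w) + 2 * δ * w * (w - 1)) * (ve i * ve j * vf j * vf j) -
    cst (2 * w) * (ve i * ve j * vf j * vf i) -
    cst (2 * (1 - δ) * (1 - w)) * (ve i * ve i * vf j * vf i))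

/-- The first order correction of a rotation. -/
def rotQuadratic (κ : PowerSeries R) (i : S) : Sym R S := cst (-2 * κ) * (ve i * vf i)

/-- The symbol of a crossing with `t^{σ/2} = s`, for normal ordering with respect to `(E, D)`. -/
def crossSym [Algebra ℚ R] (η s κ δ : PowerSeries R) (i j : S) : Sym R S :=
  perturbed η s (quartic (s ^ 2) κ δ i j) (quadratic (s ^ 2) i j)

/-- The symbol of a rotation. -/
def rotSym [Algebra ℚ R] (η s κ : PowerSeries R) (i : S) : Sym R S :=
  perturbed η s (rotQuadratic κ i) 0

lemma constantCoeff_quadratic {w : PowerSeries R} (hw : PowerSeries.constantCoeff w = 1) (i j : S) :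
    PowerSeries.constantCoeff (quadratic w i j) = 0 := by
  rw [quadratic, map_mul, constantCoeff_cst, map_sub, hw, map_one, sub_self, map_zero, zero_mul]

lemma derivative_quadratic (w : PowerSeries R) (i j : S) :
    PowerSeries.derivative _ (quadratic w i j) =
      cst (-PowerSeries.derivative R w) * (ve i * vf j - ve j * vf j) := by
  rw [quadratic, Derivation.leibniz, derivative_cst, Derivation.leibniz, map_sub, map_sub]
  simp
  ring

lemma dF_quadratic [DecidableEq S] (w : PowerSeries R) (i j s : S) :
    dF s (quadratic w i j) = if j = s then cst (1 - w) * (ve i - ve j) else 0 := by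
  rw [quadratic, Derivation.leibniz, Derivation.leibniz, Derivation.map_algebraMap]
  split_ifs with h <;> simp [h]

lemma dE_quadratic [DecidableEq S] (w : PowerSeries R) (i j s : S) :
    dE s (quadratic w i j) =
      cst (1 - w) * (((if i = s then 1 else 0) - (if j = s then 1 else 0)) * vf j) := by
  rw [quadratic, Derivation.leibniz, Derivation.leibniz, Derivation.map_algebraMap]
  simp [mul_comm]

/-- Wick's rule for `e_a e_c f_b f_d`. -/
def wickFour (eh fh : S → Sym R T) (G : S → S → Sym R T) (a c b d : S) : Sym R T :=
  (eh a * fh b + G a b) * (eh c * fh d + G c d) +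
    (eh a * fh d + G a d) * (eh c * fh b + G c b) - eh a * eh c * fh b * fh d

variable [Fintype S] [DecidableEq S] {L : Sym R S →ₗ[PowerSeries R] Sym R T}
  {eh fh : S → Sym R T} {G : S → S → Sym R T}

lemma IsGaussian.map_quartic (h : IsGaussian L eh fh G) (w κ δ : PowerSeries R) (i j : S) :
    L (quartic w κ δ i j) = cst κ * (cst w * (1 - cst w) * wickFour eh fh G i i j j +
      (cst w * (1 + cst w) + 2 * cst δ * cst w * (cst w - 1)) * wickFour eh fh G i j j j -
      2 * cst w * wickFour eh fh G i j j i -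
      2 * (1 - cst δ) * (1 - cst w) * wickFour eh fh G i i j i) * L 1 := by
  rw [quartic, map_cst_mul, map_sub, map_sub, map_add, map_cst_mul, map_cst_mul, map_cst_mul,
    map_cst_mul, h.wick_four, h.wick_four, h.wick_four, h.wick_four]
  simp only [cst, map_mul, map_sub, map_add, map_one, map_ofNat, wickFour]
  ring

lemma IsGaussian.map_rotQuadratic (h : IsGaussian L eh fh G) (κ : PowerSeries R) (i : S) :
    L (rotQuadratic κ i) = -(2 * cst κ * (eh i * fh i + G i i)) * L 1 := by
  rw [rotQuadratic, map_cst_mul, h.wick_two]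
  simp only [cst, map_mul, map_neg, map_ofNat]
  ring

lemma IsGaussian.map_derivative_quadratic (h : IsGaussian L eh fh G) (w : PowerSeries R) (i j : S) :
    L (PowerSeries.derivative _ (quadratic w i j)) = -cst (PowerSeries.derivative R w) *
      (eh i * fh j + G i j - (eh j * fh j + G j j)) * L 1 := by
  rw [derivative_quadratic, map_cst_mul, map_sub, h.wick_two, h.wick_two, cst, map_neg]
  ring

end Elements

section Shapes

variable {R : Type} [CommRing R] [Algebra ℚ R]

/-- A normalized solution of a homogeneous equation is `1`. -/
lemma eq_one_of_derivative {S : Type} {y : Sym R S} (hy : PowerSeries.derivative _ y = 0)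
    (h0 : PowerSeries.constantCoeff y = 1) : y = 1 := by
  rw [eq_pexp (g := 0) (map_zero _) (by rw [hy, map_zero, zero_mul]) h0, pexp_zero]

end Shapes

/-! ### Means and covariances of the stitched Gaussians -/

section Shapes

variable {R : Type} [CommRing R] [Algebra ℚ R]

/-- Means and covariances for the crossing of a kink, whose over-strand `0` comes before its
under-strand `2`. As in the similar lemmas below, `e0`, `e1`, … are the equations for moving `e` to
the front of its strand and `f0`, `f1`, … those for moving `f` to the end. They form a linear
system for the functionals `p ↦ L (e_s p)` and `p ↦ L (f_s p)`, and the linear combinations in the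
proof solve it. -/
lemma isGaussian_kink_left {τ : Stitching (Fin 3) (Fin 1)} (hτ : τ.strand = ![[0, 1, 2]])
    {M : Sym R (Fin 3) →ₗ[PowerSeries R] Sym R (Fin 1)} (hM : IsStitch τ M)
    {w : PowerSeries R} (hw0 : PowerSeries.constantCoeff w = 1) :
    IsGaussian (gauss M (quadratic w 0 2))
      ![ve 0, ve 0, ve 0]
      ![cst w * vf 0, cst w * vf 0, vf 0]
      ![![0, 0, 0],
        ![1, 0, 0],
        ![1, 1, 0]] := by
  have hQ : PowerSeries.constantCoeff (quadratic w 0 2 : Sym R (Fin 3)) = 0 :=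
    constantCoeff_quadratic (S := Fin 3) hw0 0 2
  have e0 := hM.gauss_e_head (Q := quadratic w 0 2) (s := 0) (t := 0) (by rw [hτ]; decide)
  have f2 := hM.gauss_f_last (Q := quadratic w 0 2) (s := 2) (t := 0) (by rw [hτ]; decide)
  have e1 := hM.gauss_e_step hQ (s := 0) (s' := 1) (t := 0) (by rw [hτ]; decide)
  have f0 := hM.gauss_f_step hQ (s := 0) (s' := 1) (t := 0) (by rw [hτ]; decide)
  have e2 := hM.gauss_e_step hQ (s := 1) (s' := 2) (t := 0) (by rw [hτ]; decide)
  have f1 := hM.gauss_f_step hQ (s := 1) (s' := 2) (t := 0) (by rw [hτ]; decide)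
  generalize gauss M (quadratic w 0 2) = L at *
  simp [dF_quadratic, dE_quadratic, sub_mul, mul_assoc, map_cst_mul]
    at e1 f0 e2 f1
  constructor
  · intro i p
    fin_cases i
    · simp [Fin.sum_univ_three]
      linear_combination e0 p
    · simp [Fin.sum_univ_three]
      linear_combination e1 p + e0 p
    · simp [Fin.sum_univ_three]
      linear_combination e2 p + e1 p + e0 p
  · intro i p hp
    replace f0 := f0 p (hp _)
    replace f1 := f1 p (hp _)
    replace f2 := f2 p
    fin_cases i
    · simp
      linear_combination f0 + f1 + cst w * f2
    · simp
      linear_combination f1 + cst w * f2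
    · simp
      linear_combination f2

/-- Here the crossing meets its under-strand first, so the linear system is cyclic: solving it
amounts to dividing by `w`. -/
lemma isGaussian_kink_right {τ : Stitching (Fin 3) (Fin 1)} (hτ : τ.strand = ![[0, 1, 2]])
    {M : Sym R (Fin 3) →ₗ[PowerSeries R] Sym R (Fin 1)} (hM : IsStitch τ M)
    {w w' : PowerSeries R} (hw : w * w' = 1) (hw0 : PowerSeries.constantCoeff w = 1) :
    IsGaussian (gauss M (quadratic w 2 0))
      ![ve 0, ve 0, ve 0]
      ![cst w' * vf 0, cst w' * vf 0, vf 0]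
      ![![0, 0, 0],
        ![cst w', cst w' - 1, 0],
        ![cst w', cst w', 0]] := by
  have hQ : PowerSeries.constantCoeff (quadratic w 2 0 : Sym R (Fin 3)) = 0 :=
    constantCoeff_quadratic (S := Fin 3) hw0 2 0
  have hc : cst w * cst w' = (1 : Sym R (Fin 1)) := by rw [← map_mul, hw, map_one]
  have e0 := hM.gauss_e_head (Q := quadratic w 2 0) (s := 0) (t := 0) (by rw [hτ]; decide)
  have f2 := hM.gauss_f_last (Q := quadratic w 2 0) (s := 2) (t := 0) (by rw [hτ]; decide)
  have e1 := hM.gauss_e_step hQ (s := 0) (s' := 1) (t := 0) (by rw [hτ]; decide)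
  have f0 := hM.gauss_f_step hQ (s := 0) (s' := 1) (t := 0) (by rw [hτ]; decide)
  have e2 := hM.gauss_e_step hQ (s := 1) (s' := 2) (t := 0) (by rw [hτ]; decide)
  have f1 := hM.gauss_f_step hQ (s := 1) (s' := 2) (t := 0) (by rw [hτ]; decide)
  generalize gauss M (quadratic w 2 0) = L at *
  simp [dF_quadratic, dE_quadratic, sub_mul, mul_sub, mul_assoc, map_cst_mul]
    at e1 f0 e2 f1
  constructor
  · intro i p
    fin_cases i
    · simp [Fin.sum_univ_three]
      linear_combination e0 p
    · simp [Fin.sum_univ_three]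
      linear_combination cst w' * (e1 p + e2 p) - (L (ve 2 * p) - L (ve 0 * p)) * hc + e0 p - e2 p
    · simp [Fin.sum_univ_three]
      linear_combination cst w' * (e1 p + e2 p) - (L (ve 2 * p) - L (ve 0 * p)) * hc + e0 p
  · intro i p hp
    replace f0 := f0 p (hp _)
    replace f1 := f1 p (hp _)
    replace f2 := f2 p
    fin_cases i
    · simp
      linear_combination cst w' * (f0 + f1 + f2) - L (vf 0 * p) * hc
    · simp
      linear_combination cst w' * (f0 + f1 + f2) - L (vf 0 * p) * hc - f0
    · simp
      linear_combination f2

/-- The product of a crossing with one of the opposite sign. -/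
lemma isGaussian_inverse {τ : Stitching (Fin 4) (Fin 2)} (hτ : τ.strand = ![[0, 2], [1, 3]])
    {M : Sym R (Fin 4) →ₗ[PowerSeries R] Sym R (Fin 2)} (hM : IsStitch τ M)
    {w w' : PowerSeries R} (hw0 : PowerSeries.constantCoeff w = 1)
    (hw0' : PowerSeries.constantCoeff w' = 1) :
    IsGaussian (gauss M (quadratic w 0 1 + quadratic w' 2 3))
      ![ve 0, ve 1, ve 0, cst w * ve 1 + (1 - cst w) * ve 0]
      ![vf 0 + (1 - cst w') * vf 1, cst w' * vf 1, vf 0, vf 1]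
      ![![0, 0, 0, 0],
        ![0, 0, 0, 0],
        ![1, 0, 0, 0],
        ![0, 1, 0, 0]] := by
  have hQ : PowerSeries.constantCoeff (quadratic w 0 1 + quadratic w' 2 3 : Sym R (Fin 4)) = 0 := by
    rw [map_add, constantCoeff_quadratic (S := Fin 4) hw0 0 1,
      constantCoeff_quadratic (S := Fin 4) hw0' 2 3]
    simp
  have e0 := hM.gauss_e_head (Q := quadratic w 0 1 + quadratic w' 2 3)
    (s := 0) (t := 0) (by rw [hτ]; decide)
  have f2 := hM.gauss_f_last (Q := quadratic w 0 1 + quadratic w' 2 3)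
    (s := 2) (t := 0) (by rw [hτ]; decide)
  have e2 := hM.gauss_e_step hQ (s := 0) (s' := 2) (t := 0) (by rw [hτ]; decide)
  have f0 := hM.gauss_f_step hQ (s := 0) (s' := 2) (t := 0) (by rw [hτ]; decide)
  have e1 := hM.gauss_e_head (Q := quadratic w 0 1 + quadratic w' 2 3)
    (s := 1) (t := 1) (by rw [hτ]; decide)
  have f3 := hM.gauss_f_last (Q := quadratic w 0 1 + quadratic w' 2 3)
    (s := 3) (t := 1) (by rw [hτ]; decide)
  have e3 := hM.gauss_e_step hQ (s := 1) (s' := 3) (t := 1) (by rw [hτ]; decide)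
  have f1 := hM.gauss_f_step hQ (s := 1) (s' := 3) (t := 1) (by rw [hτ]; decide)
  generalize gauss M (quadratic w 0 1 + quadratic w' 2 3) = L at *
  simp [dF_quadratic, dE_quadratic, sub_mul, mul_sub, mul_assoc, map_cst_mul]
    at e2 f0 e3 f1
  constructor
  · intro i p
    fin_cases i
    · simp [Fin.sum_univ_four]
      linear_combination e0 p
    · simp [Fin.sum_univ_four]
      linear_combination e1 p
    · simp [Fin.sum_univ_four]
      linear_combination e2 p + e0 p
    · simp [Fin.sum_univ_four]
      linear_combination e3 p + cst w * e1 p + (1 - cst w) * e0 p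
  · intro i p hp
    replace f0 := f0 p (hp _)
    replace f1 := f1 p (hp _)
    replace f2 := f2 p
    replace f3 := f3 p
    fin_cases i
    · simp
      linear_combination f0 + f2 + (1 - cst w') * f3
    · simp
      linear_combination f1 + cst w' * f3
    · simp
      linear_combination f2
    · simp
      linear_combination f3

/-- The cancellation of opposite crossings whose under-strands are joined by a turn. -/
lemma isGaussian_cancel_left {τ : Stitching (Fin 6) (Fin 2)}
    (hτ : τ.strand = ![[0, 2], [3, 4, 1, 5]])
    {M : Sym R (Fin 6) →ₗ[PowerSeries R] Sym R (Fin 2)} (hM : IsStitch τ M)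
    {w w' : PowerSeries R} (hw : w * w' = 1) (hw0 : PowerSeries.constantCoeff w = 1)
    (hw0' : PowerSeries.constantCoeff w' = 1) :
    IsGaussian (gauss M (quadratic w' 0 1 + quadratic w 2 3))
      ![ve 0, cst w * ve 1 + (1 - cst w) * ve 0, ve 0, ve 1, cst w * ve 1 + (1 - cst w) * ve 0,
        ve 1]
      ![vf 0 + (cst w' - 1) * vf 1, vf 1, vf 0, cst w' * vf 1, cst w' * vf 1, vf 1]
      ![![0, 0, 0, 0, 0, 0],
        ![1 - cst w, 0, 0, 1, 1, 0],
        ![1, 0, 0, 0, 0, 0],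
        ![0, 0, 0, 0, 0, 0],
        ![1 - cst w, 0, 0, 1, 0, 0],
        ![cst w' - 1, 1, 0, cst w', cst w', 0]] := by
  have hQ : PowerSeries.constantCoeff (quadratic w' 0 1 + quadratic w 2 3 : Sym R (Fin 6)) = 0 := by
    rw [map_add, constantCoeff_quadratic (S := Fin 6) hw0' 0 1,
      constantCoeff_quadratic (S := Fin 6) hw0 2 3]
    simp
  have hc : cst w * cst w' = (1 : Sym R (Fin 2)) := by rw [← map_mul, hw, map_one]
  have e0 := hM.gauss_e_head (Q := quadratic w' 0 1 + quadratic w 2 3)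
    (s := 0) (t := 0) (by rw [hτ]; decide)
  have f2 := hM.gauss_f_last (Q := quadratic w' 0 1 + quadratic w 2 3)
    (s := 2) (t := 0) (by rw [hτ]; decide)
  have e2 := hM.gauss_e_step hQ (s := 0) (s' := 2) (t := 0) (by rw [hτ]; decide)
  have f0 := hM.gauss_f_step hQ (s := 0) (s' := 2) (t := 0) (by rw [hτ]; decide)
  have e3 := hM.gauss_e_head (Q := quadratic w' 0 1 + quadratic w 2 3)
    (s := 3) (t := 1) (by rw [hτ]; decide)
  have f5 := hM.gauss_f_last (Q := quadratic w' 0 1 + quadratic w 2 3)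
    (s := 5) (t := 1) (by rw [hτ]; decide)
  have e4 := hM.gauss_e_step hQ (s := 3) (s' := 4) (t := 1) (by rw [hτ]; decide)
  have f3 := hM.gauss_f_step hQ (s := 3) (s' := 4) (t := 1) (by rw [hτ]; decide)
  have e1 := hM.gauss_e_step hQ (s := 4) (s' := 1) (t := 1) (by rw [hτ]; decide)
  have f4 := hM.gauss_f_step hQ (s := 4) (s' := 1) (t := 1) (by rw [hτ]; decide)
  have e5 := hM.gauss_e_step hQ (s := 1) (s' := 5) (t := 1) (by rw [hτ]; decide)
  have f1 := hM.gauss_f_step hQ (s := 1) (s' := 5) (t := 1) (by rw [hτ]; decide)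
  generalize gauss M (quadratic w' 0 1 + quadratic w 2 3) = L at *
  simp [dF_quadratic, dE_quadratic, sub_mul, mul_sub, mul_assoc, map_cst_mul]
    at e2 f0 e4 f3 e1 f4 e5 f1
  constructor
  · intro i p
    fin_cases i
    · simp [Fin.sum_univ_six]
      linear_combination e0 p
    · simp [Fin.sum_univ_six]
      linear_combination e1 p + (e4 p + (1 - cst w) * (e2 p + e0 p) + cst w * e3 p)
    · simp [Fin.sum_univ_six]
      linear_combination e2 p + e0 p
    · simp [Fin.sum_univ_six]
      linear_combination e3 p
    · simp [Fin.sum_univ_six]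
      linear_combination (e4 p + (1 - cst w) * (e2 p + e0 p) + cst w * e3 p)
    · simp [Fin.sum_univ_six]
      linear_combination e5 p +
        cst w' * (e1 p + (e4 p + (1 - cst w) * (e2 p + e0 p) + cst w * e3 p)) +
        (1 - cst w') * e0 p + (ve 1 * L p - ve 0 * L p - L (dF 0 p)) * hc
  · intro i p hp
    replace f0 := f0 p (hp _)
    replace f1 := f1 p (hp _)
    replace f2 := f2 p
    replace f3 := f3 p (hp _)
    replace f4 := f4 p (hp _)
    replace f5 := f5 p
    fin_cases i
    · simp
      linear_combination f0 + f2 + (1 - cst w) * (f3 + f4 + cst w' * (f1 + f5)) - vf 1 * L p * hc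
    · simp
      linear_combination f1 + f5
    · simp
      linear_combination f2
    · simp
      linear_combination f3 + f4 + cst w' * (f1 + f5)
    · simp
      linear_combination f4 + cst w' * (f1 + f5)
    · simp
      linear_combination f5

/-- The cancellation of opposite crossings whose over-strands are joined by a turn. -/
lemma isGaussian_cancel_right {τ : Stitching (Fin 6) (Fin 2)}
    (hτ : τ.strand = ![[4, 0, 5, 2], [3, 1]])
    {M : Sym R (Fin 6) →ₗ[PowerSeries R] Sym R (Fin 2)} (hM : IsStitch τ M)
    {w w' : PowerSeries R} (hw : w * w' = 1) (hw0 : PowerSeries.constantCoeff w = 1)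
    (hw0' : PowerSeries.constantCoeff w' = 1) :
    IsGaussian (gauss M (quadratic w 0 1 + quadratic w' 2 3))
      ![ve 0, cst w' * ve 1 + (1 - cst w') * ve 0, ve 0, ve 1, ve 0, ve 0]
      ![vf 0 + (cst w - 1) * vf 1, vf 1, vf 0, cst w * vf 1, vf 0, vf 0 + (cst w - 1) * vf 1]
      ![![0, 0, 0, 0, 1, 0],
        ![1 - cst w', 0, 0, 1, 1 - cst w', 1 - cst w'],
        ![1, 0, 0, 0, 1, 1],
        ![0, 0, 0, 0, 0, 0],
        ![0, 0, 0, 0, 0, 0],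
        ![1, 0, 0, 0, 1, 0]] := by
  have hQ : PowerSeries.constantCoeff (quadratic w 0 1 + quadratic w' 2 3 : Sym R (Fin 6)) = 0 := by
    rw [map_add, constantCoeff_quadratic (S := Fin 6) hw0 0 1,
      constantCoeff_quadratic (S := Fin 6) hw0' 2 3]
    simp
  have hc : cst w * cst w' = (1 : Sym R (Fin 2)) := by rw [← map_mul, hw, map_one]
  have e4 := hM.gauss_e_head (Q := quadratic w 0 1 + quadratic w' 2 3)
    (s := 4) (t := 0) (by rw [hτ]; decide)
  have f2 := hM.gauss_f_last (Q := quadratic w 0 1 + quadratic w' 2 3)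
    (s := 2) (t := 0) (by rw [hτ]; decide)
  have e0 := hM.gauss_e_step hQ (s := 4) (s' := 0) (t := 0) (by rw [hτ]; decide)
  have f4 := hM.gauss_f_step hQ (s := 4) (s' := 0) (t := 0) (by rw [hτ]; decide)
  have e5 := hM.gauss_e_step hQ (s := 0) (s' := 5) (t := 0) (by rw [hτ]; decide)
  have f0 := hM.gauss_f_step hQ (s := 0) (s' := 5) (t := 0) (by rw [hτ]; decide)
  have e2 := hM.gauss_e_step hQ (s := 5) (s' := 2) (t := 0) (by rw [hτ]; decide)
  have f5 := hM.gauss_f_step hQ (s := 5) (s' := 2) (t := 0) (by rw [hτ]; decide)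
  have e3 := hM.gauss_e_head (Q := quadratic w 0 1 + quadratic w' 2 3)
    (s := 3) (t := 1) (by rw [hτ]; decide)
  have f1 := hM.gauss_f_last (Q := quadratic w 0 1 + quadratic w' 2 3)
    (s := 1) (t := 1) (by rw [hτ]; decide)
  have e1 := hM.gauss_e_step hQ (s := 3) (s' := 1) (t := 1) (by rw [hτ]; decide)
  have f3 := hM.gauss_f_step hQ (s := 3) (s' := 1) (t := 1) (by rw [hτ]; decide)
  generalize gauss M (quadratic w 0 1 + quadratic w' 2 3) = L at *
  simp [dF_quadratic, dE_quadratic, sub_mul, mul_sub, mul_assoc, map_cst_mul]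
    at e0 f4 e5 f0 e2 f5 e1 f3
  constructor
  · intro i p
    fin_cases i
    · simp [Fin.sum_univ_six]
      linear_combination (e0 p + e4 p)
    · simp [Fin.sum_univ_six]
      linear_combination e1 p + cst w' * e3 p + (1 - cst w') * (e2 p + e5 p + e0 p + e4 p)
    · simp [Fin.sum_univ_six]
      linear_combination (e2 p + e5 p + e0 p + e4 p)
    · simp [Fin.sum_univ_six]
      linear_combination e3 p
    · simp [Fin.sum_univ_six]
      linear_combination e4 p
    · simp [Fin.sum_univ_six]
      linear_combination (e5 p + e0 p + e4 p)
  · intro i p hp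
    replace f0 := f0 p (hp _)
    replace f1 := f1 p
    replace f2 := f2 p
    replace f3 := f3 p (hp _)
    replace f4 := f4 p (hp _)
    replace f5 := f5 p (hp _)
    fin_cases i
    · simp
      linear_combination f0 + (f5 + f2 + (1 - cst w') * (f3 + cst w * f1) - vf 1 * L p * hc)
    · simp
      linear_combination f1
    · simp
      linear_combination f2
    · simp
      linear_combination (f3 + cst w * f1)
    · simp
      linear_combination f4 + f0 +
        (f5 + f2 + (1 - cst w') * (f3 + cst w * f1) - vf 1 * L p * hc) + (1 - cst w) * f1
    · simp
      linear_combination (f5 + f2 + (1 - cst w') * (f3 + cst w * f1) - vf 1 * L p * hc)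

/-- One side of the braid relation; `isGaussian_braid_right` is the other one. -/
lemma isGaussian_braid_left {τ : Stitching (Fin 6) (Fin 3)}
    (hτ : τ.strand = ![[0, 2], [1, 4], [3, 5]])
    {M : Sym R (Fin 6) →ₗ[PowerSeries R] Sym R (Fin 3)} (hM : IsStitch τ M)
    {w : PowerSeries R} (hw0 : PowerSeries.constantCoeff w = 1) :
    IsGaussian (gauss M (quadratic w 0 1 + quadratic w 2 3 + quadratic w 4 5))
      ![ve 0, ve 1, ve 0, ve 2, cst w * ve 1 + (1 - cst w) * ve 0,
        cst w * ve 2 + (1 - cst w) * ve 0]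
      ![vf 0 + cst w * (1 - cst w) * vf 2, vf 1 + (1 - cst w) * vf 2, vf 0, cst w * vf 2, vf 1,
        vf 2]
      ![![0, 0, 0, 0, 0, 0],
        ![0, 0, 0, 0, 0, 0],
        ![1, 0, 0, 0, 0, 0],
        ![0, 0, 0, 0, 0, 0],
        ![0, 1, 0, 0, 0, 0],
        ![1 - cst w, 0, 0, 1, 0, 0]] := by
  have hQ : PowerSeries.constantCoeff (quadratic w 0 1 + quadratic w 2 3 + quadratic w 4 5 :
      Sym R (Fin 6)) = 0 := by
    rw [map_add, map_add, constantCoeff_quadratic (S := Fin 6) hw0 0 1,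
      constantCoeff_quadratic (S := Fin 6) hw0 2 3,
      constantCoeff_quadratic (S := Fin 6) hw0 4 5]
    simp
  have e0 := hM.gauss_e_head (Q := quadratic w 0 1 + quadratic w 2 3 + quadratic w 4 5)
    (s := 0) (t := 0) (by rw [hτ]; decide)
  have f2 := hM.gauss_f_last (Q := quadratic w 0 1 + quadratic w 2 3 + quadratic w 4 5)
    (s := 2) (t := 0) (by rw [hτ]; decide)
  have e2 := hM.gauss_e_step hQ (s := 0) (s' := 2) (t := 0) (by rw [hτ]; decide)
  have f0 := hM.gauss_f_step hQ (s := 0) (s' := 2) (t := 0) (by rw [hτ]; decide)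
  have e1 := hM.gauss_e_head (Q := quadratic w 0 1 + quadratic w 2 3 + quadratic w 4 5)
    (s := 1) (t := 1) (by rw [hτ]; decide)
  have f4 := hM.gauss_f_last (Q := quadratic w 0 1 + quadratic w 2 3 + quadratic w 4 5)
    (s := 4) (t := 1) (by rw [hτ]; decide)
  have e4 := hM.gauss_e_step hQ (s := 1) (s' := 4) (t := 1) (by rw [hτ]; decide)
  have f1 := hM.gauss_f_step hQ (s := 1) (s' := 4) (t := 1) (by rw [hτ]; decide)
  have e3 := hM.gauss_e_head (Q := quadratic w 0 1 + quadratic w 2 3 + quadratic w 4 5)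
    (s := 3) (t := 2) (by rw [hτ]; decide)
  have f5 := hM.gauss_f_last (Q := quadratic w 0 1 + quadratic w 2 3 + quadratic w 4 5)
    (s := 5) (t := 2) (by rw [hτ]; decide)
  have e5 := hM.gauss_e_step hQ (s := 3) (s' := 5) (t := 2) (by rw [hτ]; decide)
  have f3 := hM.gauss_f_step hQ (s := 3) (s' := 5) (t := 2) (by rw [hτ]; decide)
  generalize gauss M (quadratic w 0 1 + quadratic w 2 3 + quadratic w 4 5) = L at *
  simp [dF_quadratic, dE_quadratic, sub_mul, mul_sub, mul_assoc, map_cst_mul]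
    at e2 f0 e4 f1 e5 f3
  constructor
  · intro i p
    fin_cases i
    · simp [Fin.sum_univ_six]
      linear_combination e0 p
    · simp [Fin.sum_univ_six]
      linear_combination e1 p
    · simp [Fin.sum_univ_six]
      linear_combination e2 p + e0 p
    · simp [Fin.sum_univ_six]
      linear_combination e3 p
    · simp [Fin.sum_univ_six]
      linear_combination e4 p + cst w * e1 p + (1 - cst w) * e0 p
    · simp [Fin.sum_univ_six]
      linear_combination e5 p + cst w * e3 p + (1 - cst w) * (e2 p + e0 p)
  · intro i p hp
    replace f0 := f0 p (hp _)
    replace f1 := f1 p (hp _)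
    replace f2 := f2 p
    replace f3 := f3 p (hp _)
    replace f4 := f4 p
    replace f5 := f5 p
    fin_cases i
    · simp
      linear_combination f0 + f2 + (1 - cst w) * (f3 + cst w * f5)
    · simp
      linear_combination f1 + f4 + (1 - cst w) * f5
    · simp
      linear_combination f2
    · simp
      linear_combination f3 + cst w * f5
    · simp
      linear_combination f4
    · simp
      linear_combination f5

lemma isGaussian_braid_right {τ : Stitching (Fin 6) (Fin 3)}
    (hτ : τ.strand = ![[2, 4], [0, 5], [1, 3]])
    {M : Sym R (Fin 6) →ₗ[PowerSeries R] Sym R (Fin 3)} (hM : IsStitch τ M)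
    {w : PowerSeries R} (hw0 : PowerSeries.constantCoeff w = 1) :
    IsGaussian (gauss M (quadratic w 0 1 + quadratic w 2 3 + quadratic w 4 5))
      ![ve 1, ve 2, ve 0, cst w * ve 2 + (1 - cst w) * ve 1, ve 0, ve 1]
      ![cst w * vf 1, cst w * vf 2, vf 0 + (1 - cst w) * vf 1, vf 2, vf 0, vf 1]
      ![![0, 0, 0, 0, 0, 0],
        ![0, 0, 0, 0, 0, 0],
        ![0, 0, 0, 0, 0, 0],
        ![0, 1, 0, 0, 0, 0],
        ![0, 0, 1, 0, 0, 0],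
        ![1, 0, 0, 0, 0, 0]] := by
  have hQ : PowerSeries.constantCoeff (quadratic w 0 1 + quadratic w 2 3 + quadratic w 4 5 :
      Sym R (Fin 6)) = 0 := by
    rw [map_add, map_add, constantCoeff_quadratic (S := Fin 6) hw0 0 1,
      constantCoeff_quadratic (S := Fin 6) hw0 2 3,
      constantCoeff_quadratic (S := Fin 6) hw0 4 5]
    simp
  have e2 := hM.gauss_e_head (Q := quadratic w 0 1 + quadratic w 2 3 + quadratic w 4 5)
    (s := 2) (t := 0) (by rw [hτ]; decide)
  have f4 := hM.gauss_f_last (Q := quadratic w 0 1 + quadratic w 2 3 + quadratic w 4 5)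
    (s := 4) (t := 0) (by rw [hτ]; decide)
  have e4 := hM.gauss_e_step hQ (s := 2) (s' := 4) (t := 0) (by rw [hτ]; decide)
  have f2 := hM.gauss_f_step hQ (s := 2) (s' := 4) (t := 0) (by rw [hτ]; decide)
  have e0 := hM.gauss_e_head (Q := quadratic w 0 1 + quadratic w 2 3 + quadratic w 4 5)
    (s := 0) (t := 1) (by rw [hτ]; decide)
  have f5 := hM.gauss_f_last (Q := quadratic w 0 1 + quadratic w 2 3 + quadratic w 4 5)
    (s := 5) (t := 1) (by rw [hτ]; decide)
  have e5 := hM.gauss_e_step hQ (s := 0) (s' := 5) (t := 1) (by rw [hτ]; decide)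
  have f0 := hM.gauss_f_step hQ (s := 0) (s' := 5) (t := 1) (by rw [hτ]; decide)
  have e1 := hM.gauss_e_head (Q := quadratic w 0 1 + quadratic w 2 3 + quadratic w 4 5)
    (s := 1) (t := 2) (by rw [hτ]; decide)
  have f3 := hM.gauss_f_last (Q := quadratic w 0 1 + quadratic w 2 3 + quadratic w 4 5)
    (s := 3) (t := 2) (by rw [hτ]; decide)
  have e3 := hM.gauss_e_step hQ (s := 1) (s' := 3) (t := 2) (by rw [hτ]; decide)
  have f1 := hM.gauss_f_step hQ (s := 1) (s' := 3) (t := 2) (by rw [hτ]; decide)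
  generalize gauss M (quadratic w 0 1 + quadratic w 2 3 + quadratic w 4 5) = L at *
  simp [dF_quadratic, dE_quadratic, sub_mul, mul_sub, mul_assoc, map_cst_mul]
    at e4 f2 e5 f0 e3 f1
  constructor
  · intro i p
    fin_cases i
    · simp [Fin.sum_univ_six]
      linear_combination e0 p
    · simp [Fin.sum_univ_six]
      linear_combination e1 p
    · simp [Fin.sum_univ_six]
      linear_combination e2 p
    · simp [Fin.sum_univ_six]
      linear_combination e3 p + cst w * e1 p + (1 - cst w) * e0 p
    · simp [Fin.sum_univ_six]
      linear_combination e4 p + e2 p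
    · simp [Fin.sum_univ_six]
      linear_combination e5 p + e0 p
  · intro i p hp
    replace f0 := f0 p (hp _)
    replace f1 := f1 p (hp _)
    replace f2 := f2 p (hp _)
    replace f3 := f3 p
    replace f4 := f4 p
    replace f5 := f5 p
    fin_cases i
    · simp
      linear_combination f0 + cst w * f5
    · simp
      linear_combination f1 + cst w * f3
    · simp
      linear_combination f2 + f4 + (1 - cst w) * f5
    · simp
      linear_combination f3
    · simp
      linear_combination f4
    · simp
      linear_combination f5

lemma isGaussian_rotate {τ : Stitching (Fin 6) (Fin 2)} (hτ : τ.strand = ![[0, 2, 4], [1, 3, 5]])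
    {M : Sym R (Fin 6) →ₗ[PowerSeries R] Sym R (Fin 2)} (hM : IsStitch τ M)
    {w : PowerSeries R} (hw0 : PowerSeries.constantCoeff w = 1) :
    IsGaussian (gauss M (quadratic w 2 3))
      ![ve 0, ve 1, ve 0, ve 1, ve 0, cst w * ve 1 + (1 - cst w) * ve 0]
      ![vf 0 + (1 - cst w) * vf 1, cst w * vf 1, vf 0, vf 1, vf 0, vf 1]
      ![![0, 0, 0, 0, 0, 0],
        ![0, 0, 0, 0, 0, 0],
        ![1, 0, 0, 0, 0, 0],
        ![0, 1, 0, 0, 0, 0],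
        ![1, 0, 1, 0, 0, 0],
        ![1 - cst w, cst w, 0, 1, 0, 0]] := by
  have hQ : PowerSeries.constantCoeff (quadratic w 2 3 : Sym R (Fin 6)) = 0 :=
    constantCoeff_quadratic (S := Fin 6) hw0 2 3
  have e0 := hM.gauss_e_head (Q := quadratic w 2 3) (s := 0) (t := 0) (by rw [hτ]; decide)
  have f4 := hM.gauss_f_last (Q := quadratic w 2 3) (s := 4) (t := 0) (by rw [hτ]; decide)
  have e2 := hM.gauss_e_step hQ (s := 0) (s' := 2) (t := 0) (by rw [hτ]; decide)
  have f0 := hM.gauss_f_step hQ (s := 0) (s' := 2) (t := 0) (by rw [hτ]; decide)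
  have e4 := hM.gauss_e_step hQ (s := 2) (s' := 4) (t := 0) (by rw [hτ]; decide)
  have f2 := hM.gauss_f_step hQ (s := 2) (s' := 4) (t := 0) (by rw [hτ]; decide)
  have e1 := hM.gauss_e_head (Q := quadratic w 2 3) (s := 1) (t := 1) (by rw [hτ]; decide)
  have f5 := hM.gauss_f_last (Q := quadratic w 2 3) (s := 5) (t := 1) (by rw [hτ]; decide)
  have e3 := hM.gauss_e_step hQ (s := 1) (s' := 3) (t := 1) (by rw [hτ]; decide)
  have f1 := hM.gauss_f_step hQ (s := 1) (s' := 3) (t := 1) (by rw [hτ]; decide)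
  have e5 := hM.gauss_e_step hQ (s := 3) (s' := 5) (t := 1) (by rw [hτ]; decide)
  have f3 := hM.gauss_f_step hQ (s := 3) (s' := 5) (t := 1) (by rw [hτ]; decide)
  generalize gauss M (quadratic w 2 3) = L at *
  simp [dF_quadratic, dE_quadratic, sub_mul, mul_sub, mul_assoc, map_cst_mul]
    at e2 f0 e4 f2 e3 f1 e5 f3
  constructor
  · intro i p
    fin_cases i
    · simp [Fin.sum_univ_six]
      linear_combination e0 p
    · simp [Fin.sum_univ_six]
      linear_combination e1 p
    · simp [Fin.sum_univ_six]
      linear_combination e2 p + e0 p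
    · simp [Fin.sum_univ_six]
      linear_combination e3 p + e1 p
    · simp [Fin.sum_univ_six]
      linear_combination e4 p + e2 p + e0 p
    · simp [Fin.sum_univ_six]
      linear_combination e5 p + cst w * (e3 p + e1 p) + (1 - cst w) * (e2 p + e0 p)
  · intro i p hp
    replace f0 := f0 p (hp _)
    replace f1 := f1 p (hp _)
    replace f2 := f2 p (hp _)
    replace f3 := f3 p (hp _)
    replace f4 := f4 p
    replace f5 := f5 p
    fin_cases i
    · simp
      linear_combination f0 + f2 + f4 + (1 - cst w) * (f3 + f5)
    · simp
      linear_combination f1 + cst w * (f3 + f5)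
    · simp
      linear_combination f2 + f4
    · simp
      linear_combination f3 + f5
    · simp
      linear_combination f4
    · simp
      linear_combination f5

end Shapes

/-! ### The relations on symbols -/

section Relations

section ConstantDerivatives

variable {R : Type} [CommRing R] {s s' : PowerSeries R}

lemma cst_derivative_sq {S : Type} (s : PowerSeries R) :
    (cst (PowerSeries.derivative R (s ^ 2)) : Sym R S) =
      2 * cst s * cst (PowerSeries.derivative R s) := by
  rw [pow_two, Derivation.leibniz, smul_eq_mul, cst, cst, cst, map_add, map_mul]
  ring

lemma cst_derivative_of_mul_eq_one {S : Type} (hs : s * s' = 1) :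
    (cst (PowerSeries.derivative R s') : Sym R S) =
      -cst s' ^ 2 * cst (PowerSeries.derivative R s) := by
  have h : PowerSeries.derivative R s' = -s' ^ 2 * PowerSeries.derivative R s := by
    have h1 := congrArg (PowerSeries.derivative R) hs
    rw [Derivation.leibniz, Derivation.map_one_eq_zero, smul_eq_mul, smul_eq_mul] at h1
    linear_combination s' * h1 - PowerSeries.derivative R s' * hs
  rw [h, cst, map_mul, map_neg, map_pow]

end ConstantDerivatives

variable {R : Type} [CommRing R] [Algebra ℚ R]

/-- A perturbed Gaussian stitches to `1` if its first order part vanishes and `a exp Q` stitches to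
a series with derivative `0`; the constant term is `1` by normalization. -/
lemma IsStitch.map_perturbed_eq_one {S T : Type} {τ : Stitching S T}
    {M : Sym R S →ₗ[PowerSeries R] Sym R T} (hM : IsStitch τ M) {η a : PowerSeries R}
    {A Q : Sym R S} (hQ : PowerSeries.constantCoeff Q = 0) (ha : PowerSeries.constantCoeff a = 1)
    (hA : gauss M Q A = 0)
    (hd : cst a * gauss M Q (PowerSeries.derivative _ Q) +
      cst (PowerSeries.derivative R a) * gauss M Q 1 = 0) :
    M (perturbed η a A Q) = 1 := by
  have h : cst a * gauss M Q 1 = 1 := by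
    refine eq_one_of_derivative ?_ ?_
    · rw [Derivation.leibniz, hM.derivative_gauss hQ, derivative_cst, smul_eq_mul, smul_eq_mul,
        ← hd]
      ring
    · rw [map_mul, constantCoeff_cst, ha, hM.constantCoeff_gauss hQ, map_one, one_mul]
  rw [map_perturbed, hA, mul_zero, add_zero, h]

variable {η s s' κ δ : PowerSeries R}

/-- The relations hold for all `κ` and `δ`: the first order corrections cancel as polynomials. -/
lemma kink_left_eq (hη : η * η = 0) (hs : s * s' = 1) (hs0 : PowerSeries.constantCoeff s = 1)
    {τ : Stitching (Fin 3) (Fin 1)} (hτ : τ.strand = ![[0, 1, 2]])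
    {M : Sym R (Fin 3) →ₗ[PowerSeries R] Sym R (Fin 1)} (hM : IsStitch τ M) :
    M (crossSym η s κ δ 0 2 * rotSym η s' (-κ) 1) = 1 := by
  have hw0 : PowerSeries.constantCoeff (s ^ 2) = 1 := by rw [map_pow, hs0, one_pow]
  have hQ := constantCoeff_quadratic (S := Fin 3) hw0 0 2
  have h := isGaussian_kink_left hτ hM hw0
  rw [crossSym, rotSym, perturbed_mul hη _ _ _ _ hQ (map_zero _), add_zero]
  refine hM.map_perturbed_eq_one hQ (by rw [hs, map_one]) ?_ ?_
  · rw [map_add, h.map_quartic, h.map_rotQuadratic]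
    simp [wickFour]
    ring
  · rw [h.map_derivative_quadratic, hs]
    simp

lemma kink_right_eq (hη : η * η = 0) (hs : s * s' = 1) (hs0 : PowerSeries.constantCoeff s = 1)
    {τ : Stitching (Fin 3) (Fin 1)} (hτ : τ.strand = ![[0, 1, 2]])
    {M : Sym R (Fin 3) →ₗ[PowerSeries R] Sym R (Fin 1)} (hM : IsStitch τ M) :
    M (crossSym η s κ δ 2 0 * rotSym η s κ 1) = 1 := by
  have hw0 : PowerSeries.constantCoeff (s ^ 2) = 1 := by rw [map_pow, hs0, one_pow]
  have hw : s ^ 2 * s' ^ 2 = 1 := by rw [← mul_pow, hs, one_pow]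
  have hc : cst s * cst s' = (1 : Sym R (Fin 1)) := by rw [← map_mul, hs, map_one]
  have hQ := constantCoeff_quadratic (S := Fin 3) hw0 2 0
  have h := isGaussian_kink_right hτ hM hw hw0
  rw [crossSym, rotSym, perturbed_mul hη _ _ _ _ hQ (map_zero _), add_zero]
  refine hM.map_perturbed_eq_one hQ (by rw [map_mul, hs0, one_mul]) ?_ ?_
  · rw [map_add, h.map_quartic, h.map_rotQuadratic]
    simp [wickFour]
    grind
  · rw [h.map_derivative_quadratic, ← pow_two, cst_derivative_sq]
    simp
    grind

lemma inverse_eq (hη : η * η = 0) (hs : s * s' = 1) (hs0 : PowerSeries.constantCoeff s = 1)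
    (hs0' : PowerSeries.constantCoeff s' = 1)
    {τ : Stitching (Fin 4) (Fin 2)} (hτ : τ.strand = ![[0, 2], [1, 3]])
    {M : Sym R (Fin 4) →ₗ[PowerSeries R] Sym R (Fin 2)} (hM : IsStitch τ M) :
    M (crossSym η s κ δ 0 1 * crossSym η s' (-κ) (1 - δ) 2 3) = 1 := by
  have hw0 : PowerSeries.constantCoeff (s ^ 2) = 1 := by rw [map_pow, hs0, one_pow]
  have hw0' : PowerSeries.constantCoeff (s' ^ 2) = 1 := by rw [map_pow, hs0', one_pow]
  have hw : s ^ 2 * s' ^ 2 = 1 := by rw [← mul_pow, hs, one_pow]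
  have hc : cst s * cst s' = (1 : Sym R (Fin 2)) := by rw [← map_mul, hs, map_one]
  have hQ1 := constantCoeff_quadratic (S := Fin 4) hw0 0 1
  have hQ2 := constantCoeff_quadratic (S := Fin 4) hw0' 2 3
  have hQ : PowerSeries.constantCoeff (quadratic (s ^ 2) 0 1 +
      quadratic (s' ^ 2) 2 3 : Sym R (Fin 4)) = 0 := by rw [map_add, hQ1, hQ2, add_zero]
  have h := isGaussian_inverse hτ hM hw0 hw0'
  have ha : s * s' = 1 := by linear_combination hs
  rw [crossSym, crossSym, perturbed_mul hη _ _ _ _ hQ1 hQ2]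
  refine hM.map_perturbed_eq_one hQ (by rw [ha, map_one]) ?_ ?_
  · rw [map_add, h.map_quartic, h.map_quartic]
    simp [wickFour]
    grind
  · rw [ha, map_add, map_add, h.map_derivative_quadratic, h.map_derivative_quadratic,
      cst_derivative_sq, cst_derivative_sq, cst_derivative_of_mul_eq_one hs]
    simp
    grind

lemma cancel_left_eq (hη : η * η = 0) (hs : s * s' = 1) (hs0 : PowerSeries.constantCoeff s = 1)
    (hs0' : PowerSeries.constantCoeff s' = 1)
    {τ : Stitching (Fin 6) (Fin 2)} (hτ : τ.strand = ![[0, 2], [3, 4, 1, 5]])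
    {M : Sym R (Fin 6) →ₗ[PowerSeries R] Sym R (Fin 2)} (hM : IsStitch τ M) :
    M (crossSym η s' (-κ) (1 - δ) 0 1 * crossSym η s κ δ 2 3 *
      rotSym η s κ 4 *
      rotSym η s' (-κ) 5) = 1 := by
  have hw0 : PowerSeries.constantCoeff (s ^ 2) = 1 := by rw [map_pow, hs0, one_pow]
  have hw0' : PowerSeries.constantCoeff (s' ^ 2) = 1 := by rw [map_pow, hs0', one_pow]
  have hw : s ^ 2 * s' ^ 2 = 1 := by rw [← mul_pow, hs, one_pow]
  have hc : cst s * cst s' = (1 : Sym R (Fin 2)) := by rw [← map_mul, hs, map_one]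
  have hQ1 := constantCoeff_quadratic (S := Fin 6) hw0' 0 1
  have hQ2 := constantCoeff_quadratic (S := Fin 6) hw0 2 3
  have hQ : PowerSeries.constantCoeff (quadratic (s' ^ 2) 0 1 +
      quadratic (s ^ 2) 2 3 : Sym R (Fin 6)) = 0 := by rw [map_add, hQ1, hQ2, add_zero]
  have h := isGaussian_cancel_left hτ hM hw hw0 hw0'
  have ha : s' * s * s * s' = 1 := by linear_combination (s * s' + 1) * hs
  simp only [crossSym, rotSym]
  rw [perturbed_mul hη _ _ _ _ hQ1 hQ2, perturbed_mul hη _ _ _ _ hQ (map_zero _), add_zero,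
    perturbed_mul hη _ _ _ _ hQ (map_zero _), add_zero]
  refine hM.map_perturbed_eq_one hQ (by rw [ha, map_one]) ?_ ?_
  · simp only [map_add, h.map_quartic, h.map_rotQuadratic]
    simp [wickFour]
    grind
  · rw [ha, map_add, map_add, h.map_derivative_quadratic, h.map_derivative_quadratic,
      cst_derivative_sq, cst_derivative_sq, cst_derivative_of_mul_eq_one hs]
    simp
    grind

lemma cancel_right_eq (hη : η * η = 0) (hs : s * s' = 1) (hs0 : PowerSeries.constantCoeff s = 1)
    (hs0' : PowerSeries.constantCoeff s' = 1)
    {τ : Stitching (Fin 6) (Fin 2)} (hτ : τ.strand = ![[4, 0, 5, 2], [3, 1]])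
    {M : Sym R (Fin 6) →ₗ[PowerSeries R] Sym R (Fin 2)} (hM : IsStitch τ M) :
    M (crossSym η s κ δ 0 1 * crossSym η s' (-κ) (1 - δ) 2 3 *
      rotSym η s κ 4 *
      rotSym η s' (-κ) 5) = 1 := by
  have hw0 : PowerSeries.constantCoeff (s ^ 2) = 1 := by rw [map_pow, hs0, one_pow]
  have hw0' : PowerSeries.constantCoeff (s' ^ 2) = 1 := by rw [map_pow, hs0', one_pow]
  have hw : s ^ 2 * s' ^ 2 = 1 := by rw [← mul_pow, hs, one_pow]
  have hc : cst s * cst s' = (1 : Sym R (Fin 2)) := by rw [← map_mul, hs, map_one]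
  have hQ1 := constantCoeff_quadratic (S := Fin 6) hw0 0 1
  have hQ2 := constantCoeff_quadratic (S := Fin 6) hw0' 2 3
  have hQ : PowerSeries.constantCoeff (quadratic (s ^ 2) 0 1 +
      quadratic (s' ^ 2) 2 3 : Sym R (Fin 6)) = 0 := by rw [map_add, hQ1, hQ2, add_zero]
  have h := isGaussian_cancel_right hτ hM hw hw0 hw0'
  have ha : s * s' * s * s' = 1 := by linear_combination (s * s' + 1) * hs
  simp only [crossSym, rotSym]
  rw [perturbed_mul hη _ _ _ _ hQ1 hQ2, perturbed_mul hη _ _ _ _ hQ (map_zero _), add_zero,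
    perturbed_mul hη _ _ _ _ hQ (map_zero _), add_zero]
  refine hM.map_perturbed_eq_one hQ (by rw [ha, map_one]) ?_ ?_
  · simp only [map_add, h.map_quartic, h.map_rotQuadratic]
    simp [wickFour]
    grind
  · rw [ha, map_add, map_add, h.map_derivative_quadratic, h.map_derivative_quadratic,
      cst_derivative_sq, cst_derivative_sq, cst_derivative_of_mul_eq_one hs]
    simp
    grind

end Relations

section BraidRotate

section BraidExponent

variable {R : Type} [CommRing R]

/-- The exponent of both sides of the braid relation: the quadratic form of the corresponding
linear substitution (the Burau representation). -/
def braidExponent (w : PowerSeries R) : Sym R (Fin 3) :=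
  cst (1 - w) * ((ve 0 - ve 1) * vf 1) + cst (1 - w) * (ve 0 * vf 2) +
    cst (w * (1 - w)) * (ve 1 * vf 2) - cst (1 - w ^ 2) * (ve 2 * vf 2)

lemma constantCoeff_braidExponent {w : PowerSeries R} (hw : PowerSeries.constantCoeff w = 1) :
    PowerSeries.constantCoeff (braidExponent w) = 0 := by
  simp only [braidExponent, map_add, map_sub, map_mul, constantCoeff_cst, map_one, map_pow, hw]
  simp

lemma derivative_braidExponent (w : PowerSeries R) :
    PowerSeries.derivative _ (braidExponent w) = -cst (PowerSeries.derivative R w) *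
      ((ve 0 - ve 1) * vf 1 + ve 0 * vf 2 + (2 * cst w - 1) * (ve 1 * vf 2) -
        2 * cst w * (ve 2 * vf 2)) := by
  simp [braidExponent, Derivation.leibniz, Derivation.leibniz_pow, derivative_algebraMap]
  ring

end BraidExponent

variable {R : Type} [CommRing R] [Algebra ℚ R] {η s s' κ δ : PowerSeries R}

/-- A stitched exponential is determined by its logarithmic derivative in `h`. -/
lemma IsStitch.gauss_one_eq_pexp {S T : Type} {τ : Stitching S T}
    {M : Sym R S →ₗ[PowerSeries R] Sym R T} (hM : IsStitch τ M) {Q : Sym R S} {g : Sym R T}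
    (hQ : PowerSeries.constantCoeff Q = 0) (hg : PowerSeries.constantCoeff g = 0)
    (h : gauss M Q (PowerSeries.derivative _ Q) = PowerSeries.derivative _ g * gauss M Q 1) :
    gauss M Q 1 = pexp g :=
  eq_pexp hg (by rw [hM.derivative_gauss hQ, h]) (hM.constantCoeff_gauss hQ)

/-- Both sides have the same zeroth order part `exp (braidExponent w)`, and the same first order
part by Wick's rule. -/
lemma braid_eq (hη : η * η = 0) (hs0 : PowerSeries.constantCoeff s = 1)
    {τ τ' : Stitching (Fin 6) (Fin 3)} (hτ : τ.strand = ![[0, 2], [1, 4], [3, 5]])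
    (hτ' : τ'.strand = ![[2, 4], [0, 5], [1, 3]])
    {M M' : Sym R (Fin 6) →ₗ[PowerSeries R] Sym R (Fin 3)} (hM : IsStitch τ M)
    (hM' : IsStitch τ' M') :
    M (crossSym η s κ δ 0 1 * crossSym η s κ δ 2 3 * crossSym η s κ δ 4 5) =
      M' (crossSym η s κ δ 0 1 * crossSym η s κ δ 2 3 * crossSym η s κ δ 4 5) := by
  have hw0 : PowerSeries.constantCoeff (s ^ 2) = 1 := by rw [map_pow, hs0, one_pow]
  have hq := constantCoeff_quadratic (S := Fin 6) hw0
  have hQ1 : PowerSeries.constantCoeff (quadratic (s ^ 2) 0 1 + quadratic (s ^ 2) 2 3 :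
      Sym R (Fin 6)) = 0 := by rw [map_add, hq, hq, add_zero]
  have hQ : PowerSeries.constantCoeff (quadratic (s ^ 2) 0 1 + quadratic (s ^ 2) 2 3 +
      quadratic (s ^ 2) 4 5 : Sym R (Fin 6)) = 0 := by rw [map_add, hQ1, hq, add_zero]
  have h := isGaussian_braid_left hτ hM hw0
  have h' := isGaussian_braid_right hτ' hM' hw0
  have hg := constantCoeff_braidExponent hw0
  have h1 := hM.gauss_one_eq_pexp hQ hg (by
    rw [map_add, map_add, map_add, map_add, h.map_derivative_quadratic, h.map_derivative_quadratic,
      h.map_derivative_quadratic, derivative_braidExponent]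
    simp
    ring)
  have h1' := hM'.gauss_one_eq_pexp hQ hg (by
    rw [map_add, map_add, map_add, map_add, h'.map_derivative_quadratic,
      h'.map_derivative_quadratic, h'.map_derivative_quadratic, derivative_braidExponent]
    simp
    ring)
  rw [crossSym, crossSym, crossSym, perturbed_mul hη _ _ _ _ (hq _ _) (hq _ _),
    perturbed_mul hη _ _ _ _ hQ1 (hq _ _), map_perturbed, map_perturbed]
  simp only [map_add, h.map_quartic, h'.map_quartic]
  rw [h1, h1']
  simp [wickFour]
  ring

lemma rotate_eq (hη : η * η = 0) (hs : s * s' = 1) (hs0 : PowerSeries.constantCoeff s = 1)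
    {τ : Stitching (Fin 6) (Fin 2)} (hτ : τ.strand = ![[0, 2, 4], [1, 3, 5]])
    {M : Sym R (Fin 6) →ₗ[PowerSeries R] Sym R (Fin 2)} (hM : IsStitch τ M) :
    M (rotSym η s κ 0 * rotSym η s κ 1 * crossSym η s κ δ 2 3 * rotSym η s' (-κ) 4 *
      rotSym η s' (-κ) 5) = crossSym η s κ δ 0 1 := by
  have hw0 : PowerSeries.constantCoeff (s ^ 2) = 1 := by rw [map_pow, hs0, one_pow]
  have hQ := constantCoeff_quadratic (S := Fin 6) hw0 2 3
  have hg := constantCoeff_quadratic (S := Fin 2) hw0 0 1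
  have h0 : PowerSeries.constantCoeff (0 : Sym R (Fin 6)) = 0 := map_zero _
  have h := isGaussian_rotate hτ hM hw0
  have h1 := hM.gauss_one_eq_pexp hQ hg (by
    rw [h.map_derivative_quadratic, derivative_quadratic]
    simp)
  have ha : s * s * s * s' * s' = s := by linear_combination s * (s * s' + 1) * hs
  rw [crossSym, crossSym, rotSym, rotSym, rotSym, rotSym, perturbed_mul hη _ _ _ _ h0 h0, add_zero,
    perturbed_mul hη _ _ _ _ h0 hQ, zero_add, perturbed_mul hη _ _ _ _ hQ h0, add_zero,
    perturbed_mul hη _ _ _ _ hQ h0, add_zero, ha, map_perturbed, perturbed]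
  simp only [map_add, h.map_quartic, h.map_rotQuadratic]
  have h2 : (algebraMap (PowerSeries R) (Sym R (Fin 2))) 2 = 2 := map_ofNat _ 2
  rw [h1, quartic]
  simp [wickFour, h2]
  ring

end BraidRotate

/-! ### Stitching, placement and products in terms of symbols -/

section SymbolStitching

open MvPolynomial

variable {R : Type} [CommRing R] {W : Type} [Ring W] [Algebra R W] {S T : Type}

/-- A linear map of polynomials applied to the coefficients of a power series. -/
def seriesMap (m : MvPolynomial (S ⊕ S) R →ₗ[R] MvPolynomial (T ⊕ T) R) :
    Sym R S →ₗ[PowerSeries R] Sym R T where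
  toFun := coeffMap m
  map_add' := map_add _
  map_smul' c p := by
    rw [Algebra.smul_def, coeffMap_const_mul, RingHom.id_apply, Algebra.smul_def]

lemma coeff_seriesMap (m : MvPolynomial (S ⊕ S) R →ₗ[R] MvPolynomial (T ⊕ T) R) (p : Sym R S)
    (n : ℕ) : PowerSeries.coeff n (seriesMap m p) = m (PowerSeries.coeff n p) :=
  coeff_coeffMap m p n

lemma coeff_ve_mul (s : S) (p : Sym R S) (n : ℕ) :
    PowerSeries.coeff n (ve s * p) = X (Sum.inl s) * PowerSeries.coeff n p :=
  PowerSeries.coeff_C_mul _ _ _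

lemma coeff_vf_mul (s : S) (p : Sym R S) (n : ℕ) :
    PowerSeries.coeff n (vf s * p) = X (Sum.inr s) * PowerSeries.coeff n p :=
  PowerSeries.coeff_C_mul _ _ _

lemma coeff_dE (s : S) (p : Sym R S) (n : ℕ) :
    PowerSeries.coeff n (dE s p) = pderiv (Sum.inl s) (PowerSeries.coeff n p) :=
  coeff_coeffMap (pderiv (R := R) (Sum.inl s)).toLinearMap p n

lemma coeff_dF (s : S) (p : Sym R S) (n : ℕ) :
    PowerSeries.coeff n (dF s p) = pderiv (Sum.inr s) (PowerSeries.coeff n p) :=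
  coeff_coeffMap (pderiv (R := R) (Sum.inr s)).toLinearMap p n

/-- Stitching, transported to symbols through normal ordering for a Weyl pair, obeys the rules for
moving variables along strands. -/
lemma isStitch_seriesMap [DecidableEq S] [DecidableEq T] {a b : W} (h : b * a = a * b + 1)
    (hinj : Function.Injective (order R T a b)) {τ : Stitching S T}
    {m : MvPolynomial (S ⊕ S) R →ₗ[R] MvPolynomial (T ⊕ T) R}
    (hm : ∀ p, order R T a b (m p) = stitchLinear R W τ (order R S a b p)) :
    IsStitch τ (seriesMap m) := by
  have hone : m 1 = 1 := hinj (by rw [hm, order_one, stitchLinear_one, order_one])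
  refine ⟨?_, fun p => derivative_coeffMap m p, fun p hp => ?_, fun hs p => ?_, fun hs p => ?_,
    fun hs p => ?_, fun hs p => ?_⟩
  · ext1 n
    rw [coeff_seriesMap, PowerSeries.coeff_one, PowerSeries.coeff_one]
    split_ifs
    exacts [hone, map_zero m]
  · rw [← PowerSeries.coeff_zero_eq_constantCoeff_apply] at hp ⊢
    rw [coeff_seriesMap, hp, hone]
  · ext1 n
    rw [coeff_seriesMap, coeff_ve_mul, coeff_ve_mul, coeff_seriesMap]
    apply hinj
    rw [hm, order_e_mul, stitchLinear_single_mul τ hs, ← hm, order_e_mul]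
  · ext1 n
    rw [coeff_seriesMap, coeff_vf_mul, coeff_vf_mul, coeff_seriesMap]
    apply hinj
    rw [hm, order_f_mul, stitchLinear_mul_single_last τ hs, ← hm, order_f_mul]
  · ext1 n
    rw [map_add, coeff_seriesMap, coeff_seriesMap, coeff_seriesMap, coeff_ve_mul, coeff_ve_mul,
      coeff_dF, ← map_add]
    apply hinj
    rw [hm, hm, order_e_mul, ← stitchLinear_mul_single τ hs, order_mul_single h]
  · ext1 n
    rw [map_add, coeff_seriesMap, coeff_seriesMap, coeff_seriesMap, coeff_vf_mul, coeff_vf_mul,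
      coeff_dE, ← map_add]
    apply hinj
    rw [hm, hm, order_f_mul, stitchLinear_mul_single τ hs, single_mul_order h]

end SymbolStitching

section Realization

open MvPolynomial

variable {R : Type} [CommRing R] {W : Type} [Ring W] [Algebra R W] {S T : Type}

/-- The element of the completed tensor power with a given symbol, for normal ordering with respect
to the pair `(a, b)`. -/
def realize (a b : W) (g : Sym R S) : Tens R W S :=
  HahnSeries.ofPowerSeries ℤ _ (coeffMap (order R S a b) g)

lemma realize_one (a b : W) : realize a b (1 : Sym R S) = 1 := by
  have : coeffMap (order R S a b) 1 = 1 := by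
    ext1 n
    rw [coeff_coeffMap, PowerSeries.coeff_one, PowerSeries.coeff_one]
    split_ifs
    exacts [order_one a b, map_zero _]
  rw [realize, this, map_one]

lemma stitch_realize {a b : W} {τ : Stitching S T}
    {m : MvPolynomial (S ⊕ S) R →ₗ[R] MvPolynomial (T ⊕ T) R}
    (hm : ∀ p, order R T a b (m p) = stitchLinear R W τ (order R S a b p)) (g : Sym R S) :
    stitch τ (realize a b g) = realize a b (seriesMap m g) := by
  rw [stitch, realize, map_ofPowerSeries, coeffMap_comp, realize]
  congr 1
  ext1 n
  rw [coeff_coeffMap, coeff_coeffMap, coeff_seriesMap, hm, LinearMap.comp_apply]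

/-- A power series in the variables labelled by `A`. -/
def SupportedOn (A : Set S) (g : Sym R S) : Prop :=
  ∀ n, PowerSeries.coeff n g ∈ supported R (varsOn A)

lemma realize_mul (a b : W) {A B : Set S} (hAB : Disjoint A B) {g g' : Sym R S}
    (hg : SupportedOn A g) (hg' : SupportedOn B g') :
    realize a b (g * g') = realize a b g * realize a b g' := by
  rw [realize, realize, realize, ← map_mul]
  congr 1
  ext1 n
  rw [coeff_coeffMap, PowerSeries.coeff_mul, PowerSeries.coeff_mul, map_sum]
  refine Finset.sum_congr rfl fun x _ => ?_
  rw [coeff_coeffMap, coeff_coeffMap, order_mul_of_disjoint a b hAB (hg _) (hg' _)]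

lemma SupportedOn.mul {A B : Set S} {g g' : Sym R S} (hg : SupportedOn A g)
    (hg' : SupportedOn B g') : SupportedOn (A ∪ B) (g * g') := by
  intro n
  rw [PowerSeries.coeff_mul]
  refine sum_mem fun x _ => mul_mem ?_ ?_
  · exact supported_mono (fun i hi => Or.inl hi) (hg x.1)
  · exact supported_mono (fun i hi => Or.inr hi) (hg' x.2)

/-- Relabelling the tensor factors of a symbol. -/
def relabel (φ : S → T) : Sym R S →+* Sym R T :=
  PowerSeries.map (rename (R := R) (Sum.map φ φ) : MvPolynomial (S ⊕ S) R →+* _)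

lemma coeff_relabel (φ : S → T) (g : Sym R S) (n : ℕ) :
    PowerSeries.coeff n (relabel φ g) = rename (Sum.map φ φ) (PowerSeries.coeff n g) := rfl

lemma supportedOn_range_relabel (φ : S → T) (g : Sym R S) :
    SupportedOn (Set.range φ) (relabel φ g) := by
  intro n
  rw [coeff_relabel, mem_supported]
  intro i hi
  classical
  obtain ⟨j, -, rfl⟩ := Finset.mem_image.mp (vars_rename _ _ hi)
  rcases j with j | j
  exacts [⟨j, rfl⟩, ⟨j, rfl⟩]

section Relabel

lemma relabel_ve (φ : S → T) (s : S) :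
    relabel φ (ve s : Sym R S) = ve (φ s) := by
  rw [ve, relabel, PowerSeries.map_C, ve]
  congr 1
  exact rename_X _ _

lemma relabel_vf (φ : S → T) (s : S) :
    relabel φ (vf s : Sym R S) = vf (φ s) := by
  rw [vf, relabel, PowerSeries.map_C, vf]
  congr 1
  exact rename_X _ _

lemma relabel_cst (φ : S → T) (w : PowerSeries R) :
    relabel φ (cst w : Sym R S) = cst w := by
  ext1 n
  rw [coeff_relabel, cst, cst, PowerSeries.algebraMap_apply'',
    PowerSeries.algebraMap_apply'', PowerSeries.coeff_map, PowerSeries.coeff_map]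
  exact AlgHom.commutes _ _

variable [Algebra ℚ R]

lemma relabel_pexp (φ : S → T) {g : Sym R S} (hg : PowerSeries.constantCoeff g = 0) :
    relabel φ (pexp g) = pexp (relabel φ g) := map_pexp _ hg

lemma relabel_crossSym (φ : S → T) {η s κ δ : PowerSeries R}
    (hs0 : PowerSeries.constantCoeff s = 1) (i j : S) :
    relabel φ (crossSym η s κ δ i j) =
      crossSym η s κ δ (φ i) (φ j) := by
  have hw0 : PowerSeries.constantCoeff (s ^ 2) = 1 := by rw [map_pow, hs0, one_pow]
  rw [crossSym, perturbed, map_mul, relabel_pexp _ (constantCoeff_quadratic hw0 i j), crossSym,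
    perturbed]
  simp only [quartic, quadratic, map_add, map_sub, map_mul, map_one, relabel_cst,
    relabel_ve, relabel_vf]

lemma relabel_rotSym (φ : S → T) (η s κ : PowerSeries R) (i : S) :
    relabel φ (rotSym η s κ i) = rotSym η s κ (φ i) := by
  rw [rotSym, perturbed, map_mul, relabel_pexp _ (map_zero _), rotSym, perturbed]
  simp only [rotQuadratic, map_add, map_zero, map_mul, map_one, relabel_cst,
    relabel_ve, relabel_vf]

end Relabel

variable [DecidableEq S]

/-- The placement of a pure tensor, extended by `1` to the factors outside the range. -/
lemma placeLinear_tprod {n : ℕ} {φ : Fin n → S} (hφ : Function.Injective φ) {x : Fin n → W}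
    {y : S → W} (hy : ∀ i, y (φ i) = x i) (hy' : ∀ s, s ∉ Set.range φ → y s = 1) :
    placeLinear R W φ (PiTensorProduct.tprod R x) = PiTensorProduct.tprod R y := by
  have key : ∀ l : List (Fin n), (l.map fun i => single (R := R) (φ i) (x i)).prod =
      PiTensorProduct.tprod R fun s =>
        (l.map fun i => (Pi.mulSingle (φ i) (x i) : S → W) s).prod := by
    intro l
    induction l with
    | nil => simp [PiTensorProduct.one_def]; rfl
    | cons i l ih =>
      rw [List.map_cons, List.prod_cons, ih, single_mul_tprod]
      simp
  rw [placeLinear, PiTensorProduct.lift.tprod, MultilinearMap.compLinearMap_apply,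
    MultilinearMap.mkPiAlgebraFin_apply]
  refine Eq.trans (congrArg List.prod (List.ofFn_eq_map ..)) (Eq.trans (key (List.finRange n)) ?_)
  congr 1
  funext s
  by_cases hs : s ∈ Set.range φ
  · obtain ⟨i, rfl⟩ := hs
    have hne : ∀ j, j ≠ i → j ∈ List.finRange n →
        (Pi.mulSingle (φ j) (x j) : S → W) (φ i) = 1 :=
      fun j hj _ => Pi.mulSingle_eq_of_ne (fun h => hj (hφ h).symm) _
    refine Eq.trans (List.prod_map_eq_pow_single i _ hne) ?_
    rw [List.count_eq_one_of_mem (List.nodup_finRange n) (List.mem_finRange i), pow_one,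
      Pi.mulSingle_eq_same, hy]
  · rw [hy' s hs]
    refine List.prod_eq_one ?_
    intro z hz
    obtain ⟨i, -, rfl⟩ := List.mem_map.mp hz
    exact Pi.mulSingle_eq_of_ne (fun h => hs ⟨i, h.symm⟩) _

/-- Placement of tensor factors is relabelling of normal ordered symbols. -/
lemma placeLinear_order (a b : W) {n : ℕ} {φ : Fin n → S} (hφ : Function.Injective φ)
    (p : MvPolynomial (Fin n ⊕ Fin n) R) :
    placeLinear R W φ (order R (Fin n) a b p) = order R S a b (rename (Sum.map φ φ) p) := by
  induction p using MvPolynomial.induction_on' with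
  | add p q hp hq => simp only [map_add, hp, hq]
  | monomial m r =>
    have hi : Function.Injective (Sum.map φ φ) := Sum.map_injective.mpr ⟨hφ, hφ⟩
    rw [rename_monomial, order_monomial, order_monomial, map_smul]
    congr 1
    refine placeLinear_tprod hφ (fun i => ?_) fun s hs => ?_
    · rw [← Sum.map_inl φ φ i, ← Sum.map_inr φ φ i, Finsupp.mapDomain_apply hi,
        Finsupp.mapDomain_apply hi]
    · rw [Finsupp.mapDomain_of_notMem_range, Finsupp.mapDomain_of_notMem_range, pow_zero, pow_zero,
        mul_one]
      all_goals
        rintro ⟨j | j, hj⟩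
        all_goals simp at hj; try exact hs ⟨j, hj⟩

lemma place_realize (a b : W) {n : ℕ} {φ : Fin n → S} (hφ : Function.Injective φ)
    (g : Sym R (Fin n)) :
    place φ (realize a b g) = realize a b (relabel φ g) := by
  rw [place, realize, map_ofPowerSeries, coeffMap_comp, realize]
  congr 1
  ext1 k
  rw [coeff_coeffMap, coeff_coeffMap, coeff_relabel, LinearMap.comp_apply,
    placeLinear_order a b hφ]

end Realization

/-! ### Snarl algebras from symbols -/

section Product

variable {R : Type} [CommRing R] {W : Type} [Ring W] [Algebra R W] {S : Type} [DecidableEq S]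
  {n : ℕ} {φ ψ : Fin n → S} {τ : Stitching S (Fin n)}

/-- The product of a tensor power is a stitching of two disjoint copies of it. -/
lemma stitchLinear_placeLinear_mul (hφ : Function.Injective φ) (hψ : Function.Injective ψ)
    (h : ∀ i j, φ i ≠ ψ j) (hτ : ∀ i, τ.strand i = [φ i, ψ i])
    (x y : PiTensorProduct R (fun _ : Fin n => W)) :
    stitchLinear R W τ (placeLinear R W φ x * placeLinear R W ψ y) = x * y := by
  induction x using PiTensorProduct.induction_on with
  | add x x' hx hx' => rw [map_add, add_mul, add_mul, map_add, hx, hx']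
  | smul_tprod r x =>
    induction y using PiTensorProduct.induction_on with
    | add y y' hy hy' => rw [map_add, mul_add, mul_add, map_add, hy, hy']
    | smul_tprod r' y =>
      have hx := placeLinear_tprod (R := R) hφ (x := x) (y := Function.extend φ x fun _ => 1)
        (fun i => hφ.extend_apply x _ i) (fun s hs => Function.extend_apply' x _ s hs)
      have hy := placeLinear_tprod (R := R) hψ (x := y) (y := Function.extend ψ y fun _ => 1)
        (fun i => hψ.extend_apply y _ i) (fun s hs => Function.extend_apply' y _ s hs)
      rw [map_smul, map_smul, hx, hy, smul_mul_smul_comm, smul_mul_smul_comm, map_smul,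
        PiTensorProduct.tprod_mul_tprod, stitchLinear_tprod, PiTensorProduct.tprod_mul_tprod]
      congr 2
      funext i
      have h1 : Function.extend ψ y (fun _ => 1) (φ i) = 1 :=
        Function.extend_apply' y _ _ (fun ⟨j, hj⟩ => h i j hj.symm)
      have h2 : Function.extend φ x (fun _ => 1) (ψ i) = 1 :=
        Function.extend_apply' x _ _ (fun ⟨j, hj⟩ => h j i hj)
      simp [hτ, hφ.extend_apply, hψ.extend_apply, h1, h2]

lemma stitch_place_mul_place (hφ : Function.Injective φ) (hψ : Function.Injective ψ)
    (h : ∀ i j, φ i ≠ ψ j) (hτ : ∀ i, τ.strand i = [φ i, ψ i]) (a b : W) (g g' : Sym R (Fin n)) :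
    stitch τ (place φ (realize a b g) * place ψ (realize a b g')) =
      realize a b g * realize a b g' := by
  rw [place, place, realize, realize, map_ofPowerSeries, map_ofPowerSeries, ← map_mul, stitch,
    map_ofPowerSeries, ← map_mul]
  congr 1
  ext1 k
  rw [coeff_coeffMap, PowerSeries.coeff_mul, PowerSeries.coeff_mul, map_sum]
  refine Finset.sum_congr rfl fun x _ => ?_
  simp only [coeff_coeffMap, stitchLinear_placeLinear_mul hφ hψ h hτ]

end Product

section Supports

variable {R : Type} [CommRing R] [Algebra ℚ R] {S : Type} {η s κ δ : PowerSeries R}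

lemma supportedOn_crossSym (hs0 : PowerSeries.constantCoeff s = 1) (i j : S) :
    SupportedOn {i, j} (crossSym η s κ δ i j) := by
  have h := supportedOn_range_relabel ![i, j] (crossSym η s κ δ 0 1)
  rw [relabel_crossSym _ hs0] at h
  simpa [Matrix.range_cons, Matrix.range_empty, Set.pair_comm] using h

lemma supportedOn_rotSym (i : S) : SupportedOn {i} (rotSym η s κ i) := by
  have h := supportedOn_range_relabel ![i] (rotSym η s κ 0)
  rw [relabel_rotSym] at h
  simpa [Matrix.range_cons, Matrix.range_empty] using h

end Supports

section Snarl

variable {R : Type} [CommRing R] {W : Type} [Ring W] [Algebra R W] {a b : W}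
  {η s s' κ δ : PowerSeries R}

/-- Since normal ordering is bijective, every stitching acts on symbols. -/
lemma exists_isStitch (h : b * a = a * b + 1)
    (hbij : ∀ n, Function.Bijective (order R (Fin n) a b)) {n k : ℕ}
    (τ : Stitching (Fin n) (Fin k)) :
    ∃ M : Sym R (Fin n) →ₗ[PowerSeries R] Sym R (Fin k),
      IsStitch τ M ∧ ∀ g, stitch τ (realize a b g) = realize a b (M g) := by
  let e := LinearEquiv.ofBijective (order R (Fin k) a b) (hbij k)
  have hm : ∀ p, order R (Fin k) a b
      ((e.symm.toLinearMap.comp ((stitchLinear R W τ).comp (order R (Fin n) a b))) p) =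
      stitchLinear R W τ (order R (Fin n) a b p) := fun p => e.apply_symm_apply _
  exact ⟨_, isStitch_seriesMap h (hbij k).1 hm, stitch_realize hm⟩

variable [Algebra ℚ R]

lemma rotSym_mul_eq (hη : η * η = 0) (hs : s * s' = 1)
    {τ : Stitching (Fin 2) (Fin 1)} (hτ : τ.strand = ![[0, 1]])
    {M : Sym R (Fin 2) →ₗ[PowerSeries R] Sym R (Fin 1)} (hM : IsStitch τ M) :
    M (rotSym η s κ 0 * rotSym η s' (-κ) 1) = 1 := by
  have h01 : [(0 : Fin 2), 1] <:+: τ.strand 0 := by simp [hτ]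
  have h0 : [(0 : Fin 2)] <+: τ.strand 0 := by simp [hτ]
  have h1 : [(1 : Fin 2)] <:+ τ.strand 0 := by rw [hτ]; exact ⟨[0], rfl⟩
  have hf1 : M (vf 1) = vf 0 := by
    have h := hM.f_last h1 1
    rwa [hM.one, mul_one, mul_one] at h
  have hf0 : M (vf 0) = vf 0 := by
    have h := hM.f_step h01 1
    rwa [mul_one, mul_one, hf1, Derivation.map_one_eq_zero, map_zero, add_zero] at h
  have he0 : M (ve 0 * vf 0) = ve 0 * vf 0 := by rw [hM.e_head h0, hf0]
  have he1 : M (ve 1 * vf 1) = ve 0 * vf 0 := by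
    rw [hM.e_step h01, hM.e_head h0, hf1, dF_vf, if_neg (by decide), map_zero, add_zero]
  rw [rotSym, rotSym, perturbed_mul hη _ _ _ _ (map_zero _) (map_zero _), hs, add_zero,
    map_perturbed, map_add]
  simp only [gauss_apply, pexp_zero, mul_one, rotQuadratic, map_cst_mul, hM.one, he0, he1]
  simp

lemma realize_crossSym_mul (h : b * a = a * b + 1)
    (hbij : ∀ n, Function.Bijective (order R (Fin n) a b)) (hη : η * η = 0) (hs : s * s' = 1)
    (hs0 : PowerSeries.constantCoeff s = 1) (hs0' : PowerSeries.constantCoeff s' = 1) :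
    realize a b (crossSym η s κ δ (0 : Fin 2) 1) *
      realize a b (crossSym η s' (-κ) (1 - δ) (0 : Fin 2) 1) = 1 := by
  let τ : Stitching (Fin 4) (Fin 2) := ⟨![[0, 2], [1, 3]], by decide, by decide, by decide⟩
  obtain ⟨M, hM, hstitch⟩ := exists_isStitch h hbij τ
  have h01 : Function.Injective ![(0 : Fin 4), 1] := by decide
  have h23 : Function.Injective ![(2 : Fin 4), 3] := by decide
  rw [← stitch_place_mul_place h01 h23 (τ := τ) (by decide) (by decide), place_realize a b h01,
    place_realize a b h23, relabel_crossSym _ hs0, relabel_crossSym _ hs0']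
  refine Eq.trans (congrArg (stitch τ) (realize_mul a b (A := {0, 1}) (B := {2, 3}) (by simp)
    (supportedOn_crossSym hs0 0 1) (supportedOn_crossSym hs0' 2 3)).symm) ?_
  rw [hstitch, inverse_eq hη hs hs0 hs0' rfl hM, realize_one]

lemma realize_rotSym_mul (h : b * a = a * b + 1)
    (hbij : ∀ n, Function.Bijective (order R (Fin n) a b)) (hη : η * η = 0) (hs : s * s' = 1) :
    realize a b (rotSym η s κ (0 : Fin 1)) * realize a b (rotSym η s' (-κ) (0 : Fin 1)) = 1 := by
  let τ : Stitching (Fin 2) (Fin 1) := ⟨![[0, 1]], by decide, by decide, by decide⟩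
  obtain ⟨M, hM, hstitch⟩ := exists_isStitch h hbij τ
  have h0 : Function.Injective ![(0 : Fin 2)] := by decide
  have h1 : Function.Injective ![(1 : Fin 2)] := by decide
  rw [← stitch_place_mul_place h0 h1 (τ := τ) (by decide) (by decide), place_realize a b h0,
    place_realize a b h1, relabel_rotSym, relabel_rotSym]
  refine Eq.trans (congrArg (stitch τ) (realize_mul a b (A := {0}) (B := {1}) (by simp)
    (supportedOn_rotSym 0) (supportedOn_rotSym 1)).symm) ?_
  rw [hstitch, rotSym_mul_eq hη hs rfl hM, realize_one]

variable {X : (Tens R W (Fin 2))ˣ} {α : (Tens R W (Fin 1))ˣ}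

/-- Elements with the symbols `crossSym` and `rotSym`, and inverses with the symbols for opposite
sign, form a snarl algebra, for all values of the parameters `κ` and `δ`. -/
lemma isSnarlAlgebra_of_symbols (h : b * a = a * b + 1)
    (hbij : ∀ n, Function.Bijective (order R (Fin n) a b)) (hη : η * η = 0) (hs : s * s' = 1)
    (hs0 : PowerSeries.constantCoeff s = 1) (hs0' : PowerSeries.constantCoeff s' = 1)
    (hX : (X : Tens R W (Fin 2)) = realize a b (crossSym η s κ δ 0 1))
    (hX' : ((X⁻¹ : (Tens R W (Fin 2))ˣ) : Tens R W (Fin 2)) =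
      realize a b (crossSym η s' (-κ) (1 - δ) 0 1))
    (hα : (α : Tens R W (Fin 1)) = realize a b (rotSym η s κ 0))
    (hα' : ((α⁻¹ : (Tens R W (Fin 1))ˣ) : Tens R W (Fin 1)) =
      realize a b (rotSym η s' (-κ) 0)) :
    IsSnarlAlgebra X α := by
  have hs' : s' * s = 1 := by rw [mul_comm, hs]
  -- The symbols of crossings and rotations placed in arbitrary tensor factors.
  have hc : ∀ {S : Type} [DecidableEq S] {i j : S}, i ≠ j →
      crossing X 1 i j = realize a b (crossSym η s κ δ i j) := by
    intro S _ i j hij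
    have hi : Function.Injective ![i, j] := by
      intro x y; fin_cases x <;> fin_cases y <;> simp [hij, hij.symm]
    rw [crossing, Units.val_one, zpow_one, hX, place_realize a b hi, relabel_crossSym _ hs0]
    rfl
  have hc' : ∀ {S : Type} [DecidableEq S] {i j : S}, i ≠ j →
      crossing X (-1) i j = realize a b (crossSym η s' (-κ) (1 - δ) i j) := by
    intro S _ i j hij
    have hi : Function.Injective ![i, j] := by
      intro x y; fin_cases x <;> fin_cases y <;> simp [hij, hij.symm]
    rw [crossing, Units.val_neg, Units.val_one, zpow_neg_one, hX', place_realize a b hi,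
      relabel_crossSym _ hs0']
    rfl
  have hi : ∀ {S : Type} (i : S), Function.Injective ![i] := fun i =>
    Function.injective_of_subsingleton _
  have hr : ∀ {S : Type} [DecidableEq S] (i : S),
      rotation α 1 i = realize a b (rotSym η s κ i) := by
    intro S _ i
    rw [rotation, zpow_one, hα, place_realize a b (hi i), relabel_rotSym]
    rfl
  have hr' : ∀ {S : Type} [DecidableEq S] (i : S),
      rotation α (-1) i = realize a b (rotSym η s' (-κ) i) := by
    intro S _ i
    rw [rotation, zpow_neg_one, hα', place_realize a b (hi i), relabel_rotSym]
    rfl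
  have hr0 : ∀ {S : Type} [DecidableEq S] (i : S), rotation α 0 i = 1 := by
    intro S _ i
    rw [rotation, zpow_zero, Units.val_one, ← realize_one a b, place_realize a b (hi i), map_one,
      realize_one]
  -- The supports, used to multiply symbols in disjoint tensor factors.
  have sc := fun {S : Type} (i j : S) => supportedOn_crossSym (η := η) (κ := κ) (δ := δ) hs0 i j
  have sc' := fun {S : Type} (i j : S) =>
    supportedOn_crossSym (η := η) (κ := -κ) (δ := 1 - δ) hs0' i j
  have sr := fun {S : Type} (i : S) => supportedOn_rotSym (η := η) (s := s) (κ := κ) i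
  have sr' := fun {S : Type} (i : S) => supportedOn_rotSym (η := η) (s := s') (κ := -κ) i
  refine ⟨fun σ => ?_, fun σ => ?_, ?_, ?_, fun σ => ?_, fun σ => ?_⟩
  · obtain ⟨M, hM, hstitch⟩ := exists_isStitch h hbij
      (⟨![[0, 1, 2]], by decide, by decide, by decide⟩ : Stitching (Fin 3) (Fin 1))
    rw [hr0]
    rcases Int.units_eq_one_or σ with rfl | rfl
    · rw [hc (by decide), Units.val_one, hr', ← realize_mul a b (by simp) (sc _ _) (sr' _), hstitch,
        kink_left_eq hη hs hs0 rfl hM, realize_one]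
    · have hk := kink_left_eq (κ := -κ) (δ := 1 - δ) hη hs' hs0' rfl hM
      rw [neg_neg] at hk
      rw [hc' (by decide), Units.val_neg, Units.val_one, neg_neg, hr,
        ← realize_mul a b (by simp) (sc' _ _) (sr _), hstitch, hk, realize_one]
  · obtain ⟨M, hM, hstitch⟩ := exists_isStitch h hbij
      (⟨![[0, 1, 2]], by decide, by decide, by decide⟩ : Stitching (Fin 3) (Fin 1))
    rw [hr0]
    rcases Int.units_eq_one_or σ with rfl | rfl
    · rw [hc (by decide), Units.val_one, hr, ← realize_mul a b (by simp) (sc _ _) (sr _), hstitch,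
        kink_right_eq hη hs hs0 rfl hM, realize_one]
    · rw [hc' (by decide), Units.val_neg, Units.val_one, hr',
        ← realize_mul a b (by simp) (sc' _ _) (sr' _), hstitch,
        kink_right_eq hη hs' hs0' rfl hM, realize_one]
  · obtain ⟨M, hM, hstitch⟩ := exists_isStitch h hbij
      (⟨![[0, 2], [3, 4, 1, 5]], by decide, by decide, by decide⟩ : Stitching (Fin 6) (Fin 2))
    rw [hr0, hr0, mul_one, hc (by decide), hc' (by decide), hr, hr',
      ← realize_mul a b (by simp) (sc' _ _) (sc _ _),
      ← realize_mul a b (by simp) ((sc' _ _).mul (sc _ _)) (sr _),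
      ← realize_mul a b (by simp) (((sc' _ _).mul (sc _ _)).mul (sr _)) (sr' _), hstitch,
      cancel_left_eq hη hs hs0 hs0' rfl hM, realize_one]
  · obtain ⟨M, hM, hstitch⟩ := exists_isStitch h hbij
      (⟨![[4, 0, 5, 2], [3, 1]], by decide, by decide, by decide⟩ : Stitching (Fin 6) (Fin 2))
    rw [hr0, hr0, mul_one, hc (by decide), hc' (by decide), hr, hr',
      ← realize_mul a b (by simp) (sc _ _) (sc' _ _),
      ← realize_mul a b (by simp) ((sc _ _).mul (sc' _ _)) (sr _),
      ← realize_mul a b (by simp) (((sc _ _).mul (sc' _ _)).mul (sr _)) (sr' _), hstitch,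
      cancel_right_eq hη hs hs0 hs0' rfl hM, realize_one]
  · obtain ⟨M, hM, hstitch⟩ := exists_isStitch h hbij
      (⟨![[0, 2], [1, 4], [3, 5]], by decide, by decide, by decide⟩ : Stitching (Fin 6) (Fin 3))
    obtain ⟨M', hM', hstitch'⟩ := exists_isStitch h hbij
      (⟨![[2, 4], [0, 5], [1, 3]], by decide, by decide, by decide⟩ : Stitching (Fin 6) (Fin 3))
    rcases Int.units_eq_one_or σ with rfl | rfl
    · rw [hc (by decide), hc (by decide), hc (by decide),
        ← realize_mul a b (by simp) (sc _ _) (sc _ _),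
        ← realize_mul a b (by simp) ((sc _ _).mul (sc _ _)) (sc _ _), hstitch, hstitch',
        braid_eq hη hs0 rfl rfl hM hM']
    · rw [hc' (by decide), hc' (by decide), hc' (by decide),
        ← realize_mul a b (by simp) (sc' _ _) (sc' _ _),
        ← realize_mul a b (by simp) ((sc' _ _).mul (sc' _ _)) (sc' _ _), hstitch, hstitch',
        braid_eq hη hs0' rfl rfl hM hM']
  · obtain ⟨M, hM, hstitch⟩ := exists_isStitch h hbij
      (⟨![[0, 2, 4], [1, 3, 5]], by decide, by decide, by decide⟩ : Stitching (Fin 6) (Fin 2))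
    rcases Int.units_eq_one_or σ with rfl | rfl
    · rw [hc (by decide), hc (by decide), Units.val_one, hr, hr, hr', hr',
        ← realize_mul a b (by simp) (sr _) (sr _),
        ← realize_mul a b (by simp) ((sr _).mul (sr _)) (sc _ _),
        ← realize_mul a b (by simp) (((sr _).mul (sr _)).mul (sc _ _)) (sr' _),
        ← realize_mul a b (by simp) ((((sr _).mul (sr _)).mul (sc _ _)).mul (sr' _)) (sr' _),
        hstitch, rotate_eq hη hs hs0 rfl hM]
    · have hk := rotate_eq (κ := -κ) (δ := 1 - δ) hη hs' hs0' rfl hM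
      rw [neg_neg] at hk
      rw [hc' (by decide), hc' (by decide), Units.val_neg, Units.val_one, neg_neg, hr', hr', hr, hr,
        ← realize_mul a b (by simp) (sr' _) (sr' _),
        ← realize_mul a b (by simp) ((sr' _).mul (sr' _)) (sc' _ _),
        ← realize_mul a b (by simp) (((sr' _).mul (sr' _)).mul (sc' _ _)) (sr _),
        ← realize_mul a b (by simp) ((((sr' _).mul (sr' _)).mul (sc' _ _)).mul (sr _)) (sr _),
        hstitch, hk]

end Snarl

/-! ### Laurent expansions of the given elements -/

section FirstOrder

variable {R : Type} [CommRing R] [Algebra ℚ R] {S : Type}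

/-- The exponential is affine in a first order perturbation of the exponent. -/
lemma pexp_add_first_order {η : PowerSeries R} (hη : η * η = 0)
    (hη' : PowerSeries.derivative R η = 0) {A Q : Sym R S}
    (hQ : PowerSeries.constantCoeff Q = 0) (hA : PowerSeries.constantCoeff A = 0)
    (a : PowerSeries R) : cst a * pexp (Q + cst η * A) = perturbed η a A Q := by
  have h0 : cst η * cst η = (0 : Sym R S) := by rw [← map_mul, hη, map_zero]
  have hA' : PowerSeries.constantCoeff (cst η * A) = 0 := by rw [map_mul, hA, mul_zero]
  rw [← pexp_add hQ hA', pexp_of_mul_self_eq_zero hA', perturbed]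
  · ring
  · have hz : (cst 0 : Sym R S) = 0 := map_zero (algebraMap (PowerSeries R) (Sym R S))
    rw [Derivation.leibniz, derivative_cst, hη', hz, smul_zero, add_zero, smul_eq_mul]
    linear_combination PowerSeries.derivative _ A * A * h0

end FirstOrder

section Deformation

open MvPolynomial

variable {R : Type} [CommRing R] {S : Type} [Fintype S]

lemma seriesMap_deformation (g : Sym R S) : seriesMap (deformation R S) g =
    ∑ s, (2 * ve s * vf s ^ 2 * dF s g + vf s ^ 2 * dF s (dF s g)) := by
  ext1 n
  rw [coeff_seriesMap, deformation_apply, map_sum]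
  refine Finset.sum_congr rfl fun s _ => ?_
  have h2 : PowerSeries.coeff n (2 * ve s * vf s ^ 2 * dF s g) = 2 * X (Sum.inl s) *
      X (Sum.inr s) ^ 2 * pderiv (Sum.inr s) (PowerSeries.coeff n g) := by
    have : 2 * ve s * vf s ^ 2 * dF s g = ve s * (vf s * (vf s * dF s g)) +
      ve s * (vf s * (vf s * dF s g)) := by ring
    rw [this, map_add, coeff_ve_mul, coeff_vf_mul, coeff_vf_mul, coeff_dF]
    ring
  rw [map_add, h2, pow_two (vf s), mul_assoc (vf s), coeff_vf_mul, coeff_vf_mul, coeff_dF, coeff_dF]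
  ring

variable [Algebra ℚ R]

lemma seriesMap_deformation_pexp {Q : Sym R S} (hQ : PowerSeries.constantCoeff Q = 0) :
    seriesMap (deformation R S) (pexp Q) =
      (∑ s, (2 * ve s * vf s ^ 2 * dF s Q + vf s ^ 2 * (dF s Q * dF s Q + dF s (dF s Q)))) *
        pexp Q := by
  rw [seriesMap_deformation, Finset.sum_mul]
  refine Finset.sum_congr rfl fun s _ => ?_
  rw [dF_pexp hQ, Derivation.leibniz, dF_pexp hQ, smul_eq_mul, smul_eq_mul]
  ring

/-- The change of ordering `1 + θ N`, `4 θ = η`, only affects the first order part of a perturbed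
Gaussian, which it shifts by the values of `N` on the Gaussian. -/
lemma perturbed_add_deformation {η θ a : PowerSeries R} (hθ : 4 * θ = η) (hθθ : θ * θ = 0)
    {A A' Q : Sym R S} (hQ : PowerSeries.constantCoeff Q = 0)
    (hA : 4 * (A' - A) =
      ∑ s, (2 * ve s * vf s ^ 2 * dF s Q + vf s ^ 2 * (dF s Q * dF s Q + dF s (dF s Q)))) :
    perturbed η a A Q + cst θ * seriesMap (deformation R S) (perturbed η a A Q) =
      perturbed η a A' Q := by
  have h0 : cst θ * cst θ = (0 : Sym R S) := by rw [← map_mul, hθθ, map_zero]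
  have h4 : cst η = 4 * (cst θ : Sym R S) := by rw [← hθ, cst, map_mul, map_ofNat]
  have h1 : cst θ * seriesMap (deformation R S) (perturbed η a A Q) =
      cst a * (cst θ * seriesMap (deformation R S) (pexp Q)) := by
    have : perturbed η a A Q = cst a * (pexp Q + cst θ * (4 * A * pexp Q)) := by
      rw [perturbed, h4]; ring
    rw [this, map_cst_mul, map_add, map_cst_mul]
    linear_combination cst a * seriesMap (deformation R S) (4 * A * pexp Q) * h0
  rw [h1, seriesMap_deformation_pexp hQ, ← hA, perturbed, perturbed, h4]
  ring

end Deformation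

section Expansions

open MvPolynomial

/-- The power series `u` is the expansion of the rational function `r` in powers of `h`. -/
def IsExpansion (r : RatFunc ℚ) (u : PowerSeries ℚ) : Prop :=
  (r : LaurentSeries ℚ) = HahnSeries.ofPowerSeries ℤ ℚ u

namespace IsExpansion

variable {r r' : RatFunc ℚ} {u u' : PowerSeries ℚ}

lemma add (h : IsExpansion r u) (h' : IsExpansion r' u') : IsExpansion (r + r') (u + u') := by
  rw [IsExpansion, map_add, map_add, h, h']

lemma sub (h : IsExpansion r u) (h' : IsExpansion r' u') : IsExpansion (r - r') (u - u') := by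
  rw [IsExpansion, map_sub, map_sub, h, h']

lemma mul (h : IsExpansion r u) (h' : IsExpansion r' u') : IsExpansion (r * r') (u * u') := by
  rw [IsExpansion, map_mul, map_mul, h, h']

lemma pow (h : IsExpansion r u) (n : ℕ) : IsExpansion (r ^ n) (u ^ n) := by
  rw [IsExpansion, map_pow, map_pow, h]

lemma one : IsExpansion 1 1 := by rw [IsExpansion, map_one, map_one]

lemma intCast (n : ℤ) : IsExpansion n n := by rw [IsExpansion, map_intCast, map_intCast]

lemma div {v : PowerSeries ℚ} (h : IsExpansion r u) (h' : IsExpansion r' u') (hu : u' ≠ 0)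
    (hv : v * u' = u) : IsExpansion (r / r') v := by
  have h0 : HahnSeries.ofPowerSeries ℤ ℚ u' ≠ 0 := by
    rw [Ne, ← map_zero (HahnSeries.ofPowerSeries ℤ ℚ)]
    exact fun h => hu (HahnSeries.ofPowerSeries_injective h)
  rw [IsExpansion, map_div₀, h, h', div_eq_iff h0, ← map_mul, hv]

end IsExpansion

lemma isExpansion_sqrtT : IsExpansion sqrtT (1 + PowerSeries.X) := by
  rw [IsExpansion, sqrtT, map_add, map_one, map_add, map_one, HahnSeries.ofPowerSeries_X,
    RatFunc.coe_X]

/-- A rational power series as a constant symbol. -/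
def ratCst (S : Type) : PowerSeries ℚ →+* Sym ℚ[ε] S :=
  (algebraMap (PowerSeries ℚ[ε]) (Sym ℚ[ε] S)).comp (PowerSeries.map (algebraMap ℚ ℚ[ε]))

variable {S : Type}

lemma IsExpansion.scalar_eq {r : RatFunc ℚ} {u : PowerSeries ℚ} (h : IsExpansion r u) :
    (scalar r : VSeries S) = HahnSeries.ofPowerSeries ℤ _ (ratCst S u) := by
  have h1 := map_ofPowerSeries (Algebra.linearMap ℚ (MvPolynomial (S ⊕ S) ℚ[ε])) u
  rw [IsExpansion] at h
  rw [scalar, h]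
  refine Eq.trans (HahnSeries.ext rfl) (h1.trans ?_)
  · congr 1
    ext1 n
    rw [coeff_coeffMap, ratCst, RingHom.comp_apply, PowerSeries.algebraMap_apply'',
      PowerSeries.coeff_map, PowerSeries.coeff_map]
    rfl

lemma e_eq (s : S) : e s = HahnSeries.ofPowerSeries ℤ _ (ve s : Sym ℚ[ε] S) := by
  rw [e, ve, HahnSeries.ofPowerSeries_C]

lemma f_eq (s : S) : f s = HahnSeries.ofPowerSeries ℤ _ (vf s : Sym ℚ[ε] S) := by
  rw [f, vf, HahnSeries.ofPowerSeries_C]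

/-- The constant power series `ε`. -/
def epsSeries : PowerSeries ℚ[ε] := PowerSeries.C DualNumber.eps

lemma epsSeries_mul : epsSeries * epsSeries = 0 := by
  rw [epsSeries, ← map_mul, DualNumber.eps_mul_eps, map_zero]

lemma eps_eq : (eps : VSeries S) = HahnSeries.ofPowerSeries ℤ _ (cst epsSeries : Sym ℚ[ε] S) := by
  rw [eps, ← HahnSeries.ofPowerSeries_C]
  congr 1
  rw [epsSeries, cst, PowerSeries.algebraMap_apply'', PowerSeries.map_C]
  rfl

/-- The expansion of `(t - 1) / (t + 1)` at `t^{1/2} = 1`. -/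
def lamSeries : PowerSeries ℚ :=
  ((1 + PowerSeries.X) ^ 2 - 1) * ((1 + PowerSeries.X) ^ 2 + 1)⁻¹

lemma lamSeries_mul : lamSeries * ((1 + PowerSeries.X) ^ 2 + 1) = (1 + PowerSeries.X) ^ 2 - 1 := by
  rw [lamSeries, mul_assoc, PowerSeries.inv_mul_cancel, mul_one]
  simp

lemma isExpansion_t : IsExpansion t ((1 + PowerSeries.X) ^ 2) := isExpansion_sqrtT.pow 2

lemma isExpansion_lam : IsExpansion lam lamSeries := by
  refine (isExpansion_t.sub .one).div (isExpansion_t.add .one) ?_ lamSeries_mul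
  intro h
  have := congrArg PowerSeries.constantCoeff h
  simp at this

/-- The expansion of `t^{-1/2}` at `t^{1/2} = 1`. -/
def invSqrtSeries : PowerSeries ℚ := (1 + PowerSeries.X)⁻¹

lemma sqrt_mul_invSqrtSeries : (1 + PowerSeries.X) * invSqrtSeries = 1 :=
  PowerSeries.mul_inv_cancel _ (by simp)

lemma constantCoeff_invSqrtSeries : PowerSeries.constantCoeff invSqrtSeries = 1 := by
  simp [invSqrtSeries]

lemma isExpansion_sqrtT_inv : IsExpansion (sqrtT ^ (-1 : ℤ)) invSqrtSeries := by
  rw [zpow_neg_one, inv_eq_one_div]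
  refine IsExpansion.one.div isExpansion_sqrtT ?_ (by rw [mul_comm, sqrt_mul_invSqrtSeries])
  intro h
  have := congrArg PowerSeries.constantCoeff h
  simp at this

/-- The series `1 / 2`. -/
def halfSeries : PowerSeries ℚ := PowerSeries.C (1 / 2)

lemma two_mul_halfSeries : 2 * halfSeries = 1 := by
  rw [halfSeries, ← map_ofNat PowerSeries.C 2, ← map_mul]
  norm_num

lemma IsExpansion.half {r : RatFunc ℚ} {u : PowerSeries ℚ} (h : IsExpansion r u) :
    IsExpansion (r / 2) (halfSeries * u) := by
  have h2 : IsExpansion 2 2 := by exact_mod_cast IsExpansion.intCast 2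
  refine h.div h2 (fun h => ?_) (by linear_combination u * two_mul_halfSeries)
  have := two_mul_halfSeries
  rw [h, zero_mul] at this
  exact zero_ne_one this

/-- The coefficient `(t - 1) / (t + 1) P` of `ε` in the exponent of a crossing, where `u` is the
expansion of `t^{σ/2}`. -/
def crossExponent (σ : ℤ) (u : PowerSeries ℚ) (i j : S) : Sym ℚ[ε] S :=
  ratCst S lamSeries * ((σ : Sym ℚ[ε] S) *
    ((ratCst S (halfSeries * (1 - u ^ 2)) * ve i * vf j) ^ 2
      - (ratCst S (halfSeries * (1 + u ^ 2)) * ve j * vf j) ^ 2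
      + ratCst S (u ^ 2) * ve i * vf j *
        (ve j * vf i + ratCst S (halfSeries * (1 - (1 + PowerSeries.X) ^ 2)) *
          (((σ : Sym ℚ[ε] S) + 1) * ve j * vf j + ((σ : Sym ℚ[ε] S) - 1) * ve i * vf i))))

lemma constantCoeff_ratCst (u : PowerSeries ℚ) : PowerSeries.constantCoeff (ratCst S u) =
    C (algebraMap ℚ ℚ[ε] (PowerSeries.constantCoeff u)) := by
  rw [ratCst, RingHom.comp_apply, constantCoeff_cst,
    ← PowerSeries.coeff_zero_eq_constantCoeff_apply, PowerSeries.coeff_map,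
    PowerSeries.coeff_zero_eq_constantCoeff_apply]

lemma constantCoeff_lamSeries : PowerSeries.constantCoeff lamSeries = 0 := by
  simp [lamSeries]

lemma expV_eq {g : VSeries S} {g' : Sym ℚ[ε] S} (hg : g = HahnSeries.ofPowerSeries ℤ _ g')
    (hg' : PowerSeries.constantCoeff g' = 0) :
    expV g = HahnSeries.ofPowerSeries ℤ _ (pexp g') := by
  rw [expV, hg]
  exact heval_exp hg'

lemma crossingSeries_eq {σ : ℤˣ} {u : PowerSeries ℚ} (h : IsExpansion (sqrtT ^ (σ : ℤ)) u)
    (hu : PowerSeries.constantCoeff u = 1) (i j : S) :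
    crossingSeries σ i j = HahnSeries.ofPowerSeries ℤ _ (ratCst S u *
      pexp (ratCst S (1 - u ^ 2) * ((ve i - ve j) * vf j) +
        cst epsSeries * crossExponent σ u i j)) := by
  have ht : IsExpansion (t ^ (σ : ℤ)) (u ^ 2) := by
    have : t ^ (σ : ℤ) = (sqrtT ^ (σ : ℤ)) ^ 2 := by
      rw [t, ← zpow_natCast, ← zpow_natCast, zpow_comm]
    rw [this]
    exact h.pow 2
  have hs : IsExpansion ((σ : ℤ) : RatFunc ℚ) ((σ : ℤ) : PowerSeries ℚ) := .intCast _
  rw [map_mul, crossingSeries, h.scalar_eq]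
  congr 1
  refine expV_eq ?_ ?_
  · rw [P, crossExponent,
      (IsExpansion.one.sub ht).scalar_eq, (IsExpansion.one.sub ht).half.scalar_eq,
      (IsExpansion.one.add ht).half.scalar_eq, ht.scalar_eq, hs.scalar_eq,
      (IsExpansion.one.sub isExpansion_t).half.scalar_eq, (hs.add .one).scalar_eq,
      (hs.sub .one).scalar_eq, isExpansion_lam.scalar_eq, eps_eq, e_eq, e_eq, f_eq, f_eq]
    simp only [map_mul, map_add, map_sub, map_pow, map_one, map_intCast]
    ring
  · rw [map_add, map_mul, constantCoeff_ratCst, crossExponent, map_mul, map_mul, map_mul,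
      constantCoeff_ratCst, constantCoeff_lamSeries, map_sub, map_pow, hu]
    simp

lemma rotationSeries_eq {σ : ℤˣ} {u : PowerSeries ℚ} (h : IsExpansion (sqrtT ^ (σ : ℤ)) u) (i : S) :
    rotationSeries σ i = HahnSeries.ofPowerSeries ℤ _ (ratCst S u *
      pexp (0 + cst epsSeries * (ratCst S ((σ : ℤ) * lamSeries) * (ve i * vf i)))) := by
  have hs : IsExpansion ((σ : ℤ) : RatFunc ℚ) ((σ : ℤ) : PowerSeries ℚ) := .intCast _
  rw [map_mul, rotationSeries, h.scalar_eq]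
  congr 1
  refine expV_eq ?_ ?_
  · rw [hs.scalar_eq, isExpansion_lam.scalar_eq, eps_eq, e_eq, f_eq]
    simp only [map_mul, map_intCast, zero_add]
    ring
  · rw [zero_add, map_mul, map_mul, constantCoeff_ratCst, map_mul, constantCoeff_lamSeries]
    simp

end Expansions

/-! ### The given elements in terms of symbols -/

section Ordering

open MvPolynomial

lemma coeff_cst_C_mul {R : Type} [CommRing R] {S : Type} (r : R) (p : Sym R S) (n : ℕ) :
    PowerSeries.coeff n (cst (PowerSeries.C r) * p) = r • PowerSeries.coeff n p := by
  have : (cst (PowerSeries.C r) : Sym R S) = PowerSeries.C (C r) := by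
    rw [cst, PowerSeries.algebraMap_apply'', PowerSeries.map_C]
    rfl
  rw [this, PowerSeries.coeff_C_mul, smul_eq_C_mul]

/-- The constant power series `ε / 4`. -/
def quarterEpsSeries : PowerSeries ℚ[ε] := PowerSeries.C quarterEps

lemma quarterEpsSeries_mul : quarterEpsSeries * quarterEpsSeries = 0 := by
  rw [quarterEpsSeries, ← map_mul, quarterEps_mul, map_zero]

lemma four_mul_quarterEpsSeries : 4 * quarterEpsSeries = epsSeries := by
  have : 4 * quarterEps = DualNumber.eps := by
    have h : 4 * quarterEps = (quarterEps + quarterEps) + (quarterEps + quarterEps) := by ring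
    rw [h, quarterEps_add, halfEps_add]
  rw [quarterEpsSeries, epsSeries, ← this, map_mul, map_ofNat]

lemma normalOrder_ofPowerSeries {S : Type} [Fintype S] [DecidableEq S] (g : Sym ℚ[ε] S) :
    normalOrder S (HahnSeries.ofPowerSeries ℤ _ g) =
      realize E D (g + cst quarterEpsSeries * seriesMap (deformation ℚ[ε] S) g) := by
  rw [normalOrder, map_ofPowerSeries, realize]
  congr 1
  ext1 n
  rw [coeff_coeffMap, coeff_coeffMap, orderLinear_apply, map_add (PowerSeries.coeff n),
    quarterEpsSeries, coeff_cst_C_mul, coeff_seriesMap]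

/-- A rational power series as a power series over `ℚ[ε]`. -/
def toDual : PowerSeries ℚ →+* PowerSeries ℚ[ε] := PowerSeries.map (algebraMap ℚ ℚ[ε])

lemma ratCst_apply {S : Type} (u : PowerSeries ℚ) : ratCst S u = cst (toDual u) := rfl

lemma algebraMap_toDual {S : Type} (u : PowerSeries ℚ) :
    algebraMap (PowerSeries ℚ[ε]) (Sym ℚ[ε] S) (toDual u) = ratCst S u := rfl

lemma constantCoeff_toDual {u : PowerSeries ℚ} (hu : PowerSeries.constantCoeff u = 1) :
    PowerSeries.constantCoeff (toDual u) = 1 := by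
  rw [toDual, ← PowerSeries.coeff_zero_eq_constantCoeff_apply, PowerSeries.coeff_map,
    PowerSeries.coeff_zero_eq_constantCoeff_apply, hu, map_one]

/-- The expansion of `κ = (1 - t) / (2 (1 + t))`. -/
def kappa : PowerSeries ℚ[ε] := toDual (-(halfSeries * lamSeries))

lemma normalOrder_crossingSeries {σ : ℤˣ} {u : PowerSeries ℚ}
    (h : IsExpansion (sqrtT ^ (σ : ℤ)) u) (hu : PowerSeries.constantCoeff u = 1)
    {κ δ : PowerSeries ℚ[ε]}
    (hA : 4 * (quartic (toDual u ^ 2) κ δ (0 : Fin 2) 1 - crossExponent σ u 0 1) =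
      2 * ve 1 * vf 1 ^ 2 * (cst (1 - toDual u ^ 2) * (ve 0 - ve 1)) +
        vf 1 ^ 2 * (cst (1 - toDual u ^ 2) * (ve 0 - ve 1)) ^ 2) :
    normalOrder (Fin 2) (crossingSeries σ 0 1) =
      realize E D (crossSym epsSeries (toDual u) κ δ 0 1) := by
  have hu2 : PowerSeries.constantCoeff (toDual u ^ 2) = 1 := by
    rw [map_pow, constantCoeff_toDual hu, one_pow]
  have hQ := constantCoeff_quadratic (S := Fin 2) hu2 0 1
  have hd : PowerSeries.derivative ℚ[ε] epsSeries = 0 := by rw [epsSeries, PowerSeries.derivative_C]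
  have hc : PowerSeries.constantCoeff (crossExponent σ u (0 : Fin 2) 1) = 0 := by
    rw [crossExponent, map_mul, constantCoeff_ratCst, constantCoeff_lamSeries, map_zero, map_zero,
      zero_mul]
  rw [crossingSeries_eq h hu, normalOrder_ofPowerSeries]
  have h1 : ratCst (Fin 2) u * pexp (ratCst (Fin 2) (1 - u ^ 2) * ((ve 0 - ve 1) * vf 1) +
      cst epsSeries * crossExponent σ u 0 1) =
      perturbed epsSeries (toDual u) (crossExponent σ u 0 1) (quadratic (toDual u ^ 2) 0 1) := by
    rw [← pexp_add_first_order epsSeries_mul hd hQ hc, quadratic, ratCst_apply, ratCst_apply,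
      map_sub, map_one, map_pow]
  rw [h1, perturbed_add_deformation four_mul_quarterEpsSeries quarterEpsSeries_mul hQ (A' :=
    quartic (toDual u ^ 2) κ δ 0 1), crossSym]
  rw [hA, Fin.sum_univ_two, dF_quadratic, dF_quadratic, if_neg (by decide), if_pos rfl,
    Derivation.leibniz, Derivation.map_algebraMap, map_sub, dF_ve, dF_ve, map_zero]
  simp only [sub_self, smul_zero, add_zero, mul_zero, zero_add]
  ring

lemma normalOrder_rotationSeries {σ : ℤˣ} {u : PowerSeries ℚ}
    (h : IsExpansion (sqrtT ^ (σ : ℤ)) u) {κ : PowerSeries ℚ[ε]}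
    (hκ : toDual ((σ : ℤ) * lamSeries) = -2 * κ) :
    normalOrder (Fin 1) (rotationSeries σ 0) =
      realize E D (rotSym epsSeries (toDual u) κ 0) := by
  have hd : PowerSeries.derivative ℚ[ε] epsSeries = 0 := by rw [epsSeries, PowerSeries.derivative_C]
  have hc : PowerSeries.constantCoeff (rotQuadratic κ (0 : Fin 1)) = 0 := by
    rw [rotQuadratic, ← hκ, ← ratCst_apply, map_mul, constantCoeff_ratCst, map_mul,
      constantCoeff_lamSeries, mul_zero, map_zero, map_zero, zero_mul]
  have h1 : ratCst (Fin 1) u * pexp (0 + cst epsSeries *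
      (ratCst (Fin 1) ((σ : ℤ) * lamSeries) * (ve 0 * vf 0))) =
      rotSym epsSeries (toDual u) κ 0 := by
    rw [rotSym, ← pexp_add_first_order epsSeries_mul hd (map_zero _) hc, rotQuadratic, ← hκ,
      ratCst_apply, ratCst_apply]
  rw [rotationSeries_eq h, normalOrder_ofPowerSeries, h1, rotSym,
    perturbed_add_deformation four_mul_quarterEpsSeries quarterEpsSeries_mul (map_zero _)]
  simp

lemma ratCst_lamSeries {S : Type} {y : PowerSeries ℚ} (hy : y = (1 + PowerSeries.X) ^ 2) :
    ratCst S lamSeries * (ratCst S y + 1) = ratCst S y - 1 := by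
  rw [← map_one (ratCst S), ← map_add, ← map_sub, ← map_mul, hy, lamSeries_mul]

lemma two_mul_ratCst_halfSeries {S : Type} : 2 * ratCst S halfSeries = 1 := by
  rw [← map_ofNat (ratCst S) 2, ← map_mul, two_mul_halfSeries, map_one]

lemma normalOrder_crossingSeries_pos : normalOrder (Fin 2) (crossingSeries 1 0 1) =
    realize E D (crossSym epsSeries (toDual (1 + PowerSeries.X)) kappa 1 0 1) := by
  refine normalOrder_crossingSeries (by simpa using isExpansion_sqrtT) (by simp) ?_
  have h2 := two_mul_ratCst_halfSeries (S := Fin 2)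
  have hl := ratCst_lamSeries (S := Fin 2) rfl
  rw [crossExponent, quartic, kappa]
  simp only [← map_pow toDual]
  -- What remains is a polynomial identity modulo `2 c = 1` and `l (x + 1) = x - 1`.
  generalize (1 + PowerSeries.X : PowerSeries ℚ) ^ 2 = y at *
  simp only [cst, map_mul, map_sub, map_add, map_one, map_neg, map_ofNat, Units.val_one,
    Int.cast_one] at *
  simp only [algebraMap_toDual] at *
  generalize ratCst (Fin 2) y = x at *
  generalize ratCst (Fin 2) halfSeries = c at *
  generalize ratCst (Fin 2) lamSeries = l at *
  grind

lemma normalOrder_crossingSeries_neg : normalOrder (Fin 2) (crossingSeries (-1) 0 1) =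
    realize E D (crossSym epsSeries (toDual invSqrtSeries) (-kappa) 0 0 1) := by
  refine normalOrder_crossingSeries (by simpa using isExpansion_sqrtT_inv)
    constantCoeff_invSqrtSeries ?_
  have h2 := two_mul_ratCst_halfSeries (S := Fin 2)
  have hl := ratCst_lamSeries (S := Fin 2) rfl
  have hx : ratCst (Fin 2) ((1 + PowerSeries.X) ^ 2) * ratCst (Fin 2) (invSqrtSeries ^ 2) = 1 := by
    rw [← map_mul, ← mul_pow, sqrt_mul_invSqrtSeries, one_pow, map_one]
  rw [crossExponent, quartic, kappa]
  simp only [← map_pow toDual]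
  -- Here `x = t⁻¹` and `y = t`, so that the relation `y x = 1` is needed in addition.
  generalize (1 + PowerSeries.X : PowerSeries ℚ) ^ 2 = y at *
  generalize (invSqrtSeries : PowerSeries ℚ) ^ 2 = x at *
  simp only [cst, map_mul, map_sub, map_add, map_one, map_neg, map_ofNat, Units.val_one,
    Units.val_neg, Int.cast_neg, Int.cast_one, map_zero] at *
  simp only [algebraMap_toDual] at *
  generalize ratCst (Fin 2) y = y at *
  generalize ratCst (Fin 2) x = x at *
  generalize ratCst (Fin 2) halfSeries = c at *
  generalize ratCst (Fin 2) lamSeries = l at *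
  grind

lemma toDual_lamSeries : toDual lamSeries = -2 * kappa := by
  have : toDual 2 = 2 := map_ofNat _ 2
  rw [kappa, ← this, ← map_neg, ← map_mul]
  congr 1
  linear_combination -lamSeries * two_mul_halfSeries

lemma normalOrder_rotationSeries_pos : normalOrder (Fin 1) (rotationSeries 1 0) =
    realize E D (rotSym epsSeries (toDual (1 + PowerSeries.X)) kappa 0) :=
  normalOrder_rotationSeries (by simpa using isExpansion_sqrtT)
    (by rw [Units.val_one, Int.cast_one, one_mul, toDual_lamSeries])

lemma normalOrder_rotationSeries_neg : normalOrder (Fin 1) (rotationSeries (-1) 0) =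
    realize E D (rotSym epsSeries (toDual invSqrtSeries) (-kappa) 0) :=
  normalOrder_rotationSeries (by simpa using isExpansion_sqrtT_inv) (by
    rw [Units.val_neg, Units.val_one, Int.cast_neg, Int.cast_one, neg_one_mul, map_neg,
      toDual_lamSeries]
    ring)

lemma normalOrder_bijective (S : Type) [Fintype S] [DecidableEq S] :
    Function.Bijective (normalOrder S) := by
  let e := LinearEquiv.ofBijective (orderLinear S) orderLinear_bijective
  refine Function.bijective_iff_has_inverse.mpr ⟨fun x => HahnSeries.map x e.symm, fun x => ?_,
    fun x => ?_⟩
  · ext1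
    funext n
    exact e.symm_apply_apply _
  · ext1
    funext n
    exact e.apply_symm_apply _

end Ordering

end Snarl

end

theorem proposition1 :
    (∀ n : ℕ, Function.Bijective (Snarl.normalOrder (Fin n))) ∧
    ∃ (X : (Snarl.Tens (DualNumber ℚ) Snarl.QWeyl (Fin 2))ˣ)
      (α : (Snarl.Tens (DualNumber ℚ) Snarl.QWeyl (Fin 1))ˣ),
      (∀ σ : ℤˣ,
        ((X ^ (σ : ℤ) : (Snarl.Tens (DualNumber ℚ) Snarl.QWeyl (Fin 2))ˣ) :
          Snarl.Tens (DualNumber ℚ) Snarl.QWeyl (Fin 2)) =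
          Snarl.normalOrder (Fin 2) (Snarl.crossingSeries σ 0 1)) ∧
      (∀ σ : ℤˣ,
        ((α ^ (σ : ℤ) : (Snarl.Tens (DualNumber ℚ) Snarl.QWeyl (Fin 1))ˣ) :
          Snarl.Tens (DualNumber ℚ) Snarl.QWeyl (Fin 1)) =
          Snarl.normalOrder (Fin 1) (Snarl.rotationSeries σ 0)) ∧
      Snarl.IsSnarlAlgebra X α := by
  open Snarl in
  refine ⟨fun n => normalOrder_bijective (Fin n), ?_⟩
  have hbij : ∀ n, Function.Bijective (order ℚ[ε] (Fin n) E D) := fun n =>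
    (orderEquiv (Fin n)).bijective
  have hs : toDual (1 + PowerSeries.X) * toDual invSqrtSeries = 1 := by
    rw [← map_mul, sqrt_mul_invSqrtSeries, map_one]
  have hs' : toDual invSqrtSeries * toDual (1 + PowerSeries.X) = 1 := by rw [mul_comm, hs]
  have hs0 : PowerSeries.constantCoeff (toDual (1 + PowerSeries.X)) = 1 :=
    constantCoeff_toDual (by simp)
  have hs0' : PowerSeries.constantCoeff (toDual invSqrtSeries) = 1 :=
    constantCoeff_toDual constantCoeff_invSqrtSeries
  have hX := realize_crossSym_mul (κ := kappa) (δ := 1) D_mul_E hbij epsSeries_mul hs hs0 hs0'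
  have hX' := realize_crossSym_mul (κ := -kappa) (δ := 0) D_mul_E hbij epsSeries_mul hs' hs0' hs0
  rw [sub_self] at hX
  rw [sub_zero, neg_neg] at hX'
  have hα := realize_rotSym_mul (κ := kappa) D_mul_E hbij epsSeries_mul hs
  have hα' := realize_rotSym_mul (κ := -kappa) D_mul_E hbij epsSeries_mul hs'
  rw [neg_neg] at hα'
  refine ⟨⟨_, _, hX, hX'⟩, ⟨_, _, hα, hα'⟩, fun σ => ?_, fun σ => ?_, ?_⟩
  · rcases Int.units_eq_one_or σ with rfl | rfl
    · rw [normalOrder_crossingSeries_pos, Units.val_one, zpow_one]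
    · rw [normalOrder_crossingSeries_neg, Units.val_neg, Units.val_one, zpow_neg_one]
      rfl
  · rcases Int.units_eq_one_or σ with rfl | rfl
    · rw [normalOrder_rotationSeries_pos, Units.val_one, zpow_one]
    · rw [normalOrder_rotationSeries_neg, Units.val_neg, Units.val_one, zpow_neg_one]
      rfl
  · exact isSnarlAlgebra_of_symbols (κ := kappa) (δ := 1) D_mul_E hbij epsSeries_mul hs hs0 hs0'
      rfl (by rw [sub_self]; rfl) rfl rfl
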